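/- Let $n\ge 3$. Write $\mathscr{A}_3(n)=(\mathbb{R}^3)^n$ for the space of $n$-edge open polygons in $\mathbb{R}^3$ up to translation, given by their edge vectors $(\vec e_1,\dots,\vec e_n)$; let $\mathscr{P}_3(n)\subset\mathscr{A}_3(n)$ be the linear subspace $\sum_i\vec e_i=\vec 0$ of closed polygons, and $\mathrm{Pol}_3(n)\subset\mathscr{P}_3(n)$ the set of closed polygons of total length $\sum_i|\vec e_i|=2$. The total curvature $\kappa$ of a closed polygon is the sum of its $n$ turning angles $\angle(\vec e_i,\vec e_{i+1})\in[0,\pi]$, with $\vec e_{n+1}=\vec e_1$. Let $\mathrm{Hopf}:\mathbb{H}^n\to\mathscr{A}_3(n)$ be the map $(q_1,\dots,q_n)\mapsto(\bar q_1\mathbf{i}q_1,\dots,\bar q_n\mathbf{i}q_n)$, where $\mathbb{R}^3$ is identified with the imaginary quaternions. The symmetric measure $\sigma$ on $\mathrm{Pol}_3(n)$ is the pushforward under $(u,v)\mapsto\mathrm{Hopf}(u+v\mathbf{j})$ of the normalized Riemannian volume of the Stiefel manifold $V_2(\mathbb{C}^n)\subset\mathbb{C}^n\times\mathbb{C}^n$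 of Hermitian orthonormal $2$-frames $(u,v)$ in $\mathbb{C}^n$. The Hopf-Gaussian measure on $\mathscr{A}_3(n)$ is the pushforward under $\mathrm{Hopf}$ of the standard Gaussian measure on $\mathbb{H}^n=\mathbb{R}^{4n}$. The Hopf-Gaussian measure $\mathrm{H}$ on $\mathscr{P}_3(n)$ is the subspace measure inherited from it, that is, the probability measure on $\mathscr{P}_3(n)$ proportional to the restriction to $\mathscr{P}_3(n)$ of its density, taken with respect to Lebesgue measure on $\mathscr{P}_3(n)$. Here the density at a point $x$ is the limit, as $r\to0$, of the measure of the ball $B(x,r)$ divided by its volume. Then $\sigma$ and $\mathrm{H}$ are well-defined probability measures, $\kappa$ is integrable with respect to both, and $$E(\kappa;\mathrm{Pol}_3(n),\sigma)=E(\kappa;\mathscr{P}_3(n),\mathrm{H})=\frac{\pi}{2}\,n+\frac{\pi}{4}\cdot\frac{2n}{2n-3}.$$ -/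

import Mathlib

open MeasureTheory Filter Topology
open scoped ENNReal Quaternion

noncomputable section

namespace RandomPolygon

/-! ### Polygons in three-space and their total curvature -/

/-- The space `𝒜₃(n)` of open `n`-edge polygons in `ℝ³` up to translation: an arm is the list of its
edge vectors. It is given the Euclidean structure of `ℝ³ × ⋯ × ℝ³ = ℝ³ⁿ`. -/
abbrev Arm (n : ℕ) : Type := PiLp 2 (fun _ : Fin n => EuclideanSpace ℝ (Fin 3))

/-- The linear subspace `𝒫₃(n)` of `𝒜₃(n)` of closed polygons (of arbitrary length): the edge vectors
sum to zero. -/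
def closedPolygons (n : ℕ) : Submodule ℝ (Arm n) where
  carrier := {e | ∑ i, e i = 0}
  zero_mem' := by simp
  add_mem' := by
    intro a b ha hb
    simp only [Set.mem_ofPred_eq] at ha hb
    simp [Finset.sum_add_distrib, ha, hb]
  smul_mem' := by
    intro c a ha
    simp only [Set.mem_ofPred_eq] at ha
    simp [← Finset.smul_sum, ha]

/-- The space `Pol₃(n)` of closed `n`-gons in `ℝ³` of total length `2`, up to translation. -/
def Pol (n : ℕ) : Set (Arm n) := {e | ∑ i, ‖e i‖ = 2 ∧ ∑ i, e i = 0}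

/-- The total curvature of a closed polygon with edge vectors `e₁, …, eₙ`: the sum of the `n` turning
angles `∠(eᵢ, eᵢ₊₁)`, where `eₙ` is followed by `e₁`. -/
def totalCurvature {n : ℕ} (e : Arm n) : ℝ :=
  ∑ i, InnerProductGeometry.angle (e i) (e (finRotate n i))

/-! ### The Hopf map -/

instance : MeasurableSpace ℍ[ℝ] := borel _

instance : BorelSpace ℍ[ℝ] := ⟨rfl⟩

/-- Quaternionic `n`-space `ℍⁿ` with its Euclidean structure `ℍⁿ = ℝ⁴ⁿ`. -/
abbrev QuatSpace (n : ℕ) : Type := PiLp 2 (fun _ : Fin n => ℍ[ℝ])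

/-- The quaternion unit `𝐢`. -/
def quatI : ℍ[ℝ] := ⟨0, 1, 0, 0⟩

/-- The quaternion unit `𝐣`. -/
def quatJ : ℍ[ℝ] := ⟨0, 0, 1, 0⟩

/-- The Hopf map `q ↦ q̄ 𝐢 q` from the quaternions to the imaginary quaternions, which are identified
with `ℝ³` through the coordinates along `𝐢, 𝐣, 𝐤`. -/
def hopf (q : ℍ[ℝ]) : EuclideanSpace ℝ (Fin 3) :=
  !₂[(star q * quatI * q).imI, (star q * quatI * q).imJ, (star q * quatI * q).imK]

/-- The coordinatewise Hopf map `ℍⁿ → 𝒜₃(n)`. -/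
def hopfArm {n : ℕ} (q : QuatSpace n) : Arm n := WithLp.toLp 2 (fun i => hopf (q i))

/-! ### The symmetric measure on `Pol₃(n)` -/

/-- The Stiefel manifold `V₂(ℂⁿ)` of Hermitian orthonormal `2`-frames `(u, v)` in `ℂⁿ`, as a subset of
`ℂⁿ × ℂⁿ` with its Euclidean structure. -/
def stiefel (n : ℕ) : Set (WithLp 2 (EuclideanSpace ℂ (Fin n) × EuclideanSpace ℂ (Fin n))) :=
  {p | ‖p.fst‖ = 1 ∧ ‖p.snd‖ = 1 ∧ inner ℂ p.fst p.snd = 0}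

/-- The identification of a pair `(u, v)` of vectors of `ℂⁿ` with the vector `u + v 𝐣` of `ℍⁿ`. For a
unitary frame this is `√2 (cos (π/4) u + sin (π/4) v 𝐣)`, on the sphere of radius `√2`. -/
def frameToQuat {n : ℕ} (p : WithLp 2 (EuclideanSpace ℂ (Fin n) × EuclideanSpace ℂ (Fin n))) :
    QuatSpace n :=
  WithLp.toLp 2 (fun i => (p.fst i : ℍ[ℝ]) + (p.snd i : ℍ[ℝ]) * quatJ)

/-- In coordinates, `hopf (a + b 𝐣) = (|a|² - |b|², 2 Im (a b̄), 2 Re (a b̄))`. -/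
theorem hopf_frame (a b : ℂ) : hopf ((a : ℍ[ℝ]) + (b : ℍ[ℝ]) * quatJ) =
    !₂[‖a‖ ^ 2 - ‖b‖ ^ 2, 2 * (a * star b).im, 2 * (a * star b).re] := by
  have i0 : quatI.re = 0 := rfl
  have i1 : quatI.imI = 1 := rfl
  have i2 : quatI.imJ = 0 := rfl
  have i3 : quatI.imK = 0 := rfl
  have j0 : quatJ.re = 0 := rfl
  have j1 : quatJ.imI = 0 := rfl
  have j2 : quatJ.imJ = 1 := rfl
  have j3 : quatJ.imK = 0 := rfl
  ext k
  fin_cases k <;> simp [hopf, i0, i1, i2, i3, j0, j1, j2, j3, Complex.sq_norm,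
    Complex.normSq_apply] <;> ring

/-- `|Hopf(a + b 𝐣)| = |a|² + |b|²`. -/
theorem norm_hopf_frame (a b : ℂ) :
    ‖hopf ((a : ℍ[ℝ]) + (b : ℍ[ℝ]) * quatJ)‖ = ‖a‖ ^ 2 + ‖b‖ ^ 2 := by
  rw [hopf_frame, EuclideanSpace.norm_eq, ← Real.sqrt_sq (by positivity : 0 ≤ ‖a‖ ^ 2 + ‖b‖ ^ 2)]
  congr 1
  simp [Fin.sum_univ_three, Complex.sq_norm, Complex.normSq_apply]
  ring

/-- The coordinatewise Hopf map takes `V₂(ℂⁿ)` to closed polygons of length `2`. -/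
theorem hopfArm_mem_Pol {n : ℕ} (p : stiefel n) : hopfArm (frameToQuat (p : _)) ∈ Pol n := by
  obtain ⟨p, h1, h2, h3⟩ := p
  have n1 : ∑ i, ‖p.fst i‖ ^ 2 = 1 := by rw [← EuclideanSpace.norm_sq_eq, h1, one_pow]
  have n2 : ∑ i, ‖p.snd i‖ ^ 2 = 1 := by rw [← EuclideanSpace.norm_sq_eq, h2, one_pow]
  have n3 : ∑ i, p.fst i * star (p.snd i) = 0 := by
    rw [← inner_eq_zero_symm] at h3
    simpa [PiLp.inner_apply] using h3
  constructor
  · simp only [hopfArm, frameToQuat, norm_hopf_frame]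
    rw [Finset.sum_add_distrib, n1, n2]
    norm_num
  · simp only [hopfArm, frameToQuat, hopf_frame]
    ext k
    fin_cases k
    · simp [n1, n2]
    · have := congrArg Complex.im n3
      simp only [Complex.im_sum, Complex.zero_im] at this
      simpa [← Finset.mul_sum] using this
    · have := congrArg Complex.re n3
      simp only [Complex.re_sum, Complex.zero_re] at this
      simpa [← Finset.mul_sum] using this

/-- The coordinatewise Hopf map on the model space, `V₂(ℂⁿ) → Pol₃(n)`. -/
def hopfPol {n : ℕ} (p : stiefel n) : Pol n := ⟨hopfArm (frameToQuat (p : _)), hopfArm_mem_Pol p⟩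

/-- The Riemannian volume of the compact manifold `V₂(ℂⁿ) ⊆ ℂⁿ × ℂⁿ` of real dimension `4n - 4`, i.e.
its Hausdorff measure in that dimension. -/
def stiefelVolume (n : ℕ) : Measure (stiefel n) := Measure.euclideanHausdorffMeasure (4 * n - 4)

/-- The symmetric measure `σ` on `Pol₃(n)`: the normalized volume of `V₂(ℂⁿ)`, pushed forward by the
coordinatewise Hopf map. -/
def symmetricMeasure (n : ℕ) : Measure (Pol n) :=
  (stiefelVolume n Set.univ)⁻¹ • (stiefelVolume n).map hopfPol

/-! ### The Hopf-Gaussian measure on `𝒜₃(n)` and on `𝒫₃(n)` -/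

/-- The Hopf-Gaussian measure on `𝒜₃(n)`: the standard Gaussian measure on `ℍⁿ = ℝ⁴ⁿ`, pushed forward by
the coordinatewise Hopf map. -/
def hopfGaussianArm (n : ℕ) : Measure (Arm n) :=
  (ProbabilityTheory.stdGaussian (QuatSpace n)).map hopfArm

section Subspace

variable {E : Type*} [NormedAddCommGroup E] [InnerProductSpace ℝ E] [FiniteDimensional ℝ E]
  [MeasurableSpace E] [BorelSpace E]

/-- The density at `x` of a measure `μ` with respect to Lebesgue measure: the limit of the ratios
`μ (B(x, r)) / vol (B(x, r))` as `r → 0` (the upper limit, where there is no limit). Wherever `μ` has a continuous probability density function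
near `x`, this is its value at `x`; unlike a density given up to null sets, it can be restricted to
a subspace. -/
def pointDensity (μ : Measure E) (x : E) : ℝ≥0∞ :=
  limsup (fun r : ℝ => μ (Metric.closedBall x r) / volume (Metric.closedBall x r)) (𝓝[>] 0)

/-- The restriction of the density of `μ` to a linear subspace `P`, times Lebesgue (that is, Hausdorff)
measure of `P`. -/
def restrictedDensityMeasure (μ : Measure E) (P : Submodule ℝ E) : Measure P :=
  (volume : Measure P).withDensity (fun x => pointDensity μ (x : E))

/-- The probability measure on a linear subspace `P` that is inherited from a measure `μ` with a density:
the law of a `μ`-random point conditioned to lie in `P`. If `μ` has the density `f` and `P` is the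
kernel of a linear map `L`, it is `f(x) δ(L x) dx`, normalized. -/
def subspaceMeasure (μ : Measure E) (P : Submodule ℝ E) : Measure P :=
  (restrictedDensityMeasure μ P Set.univ)⁻¹ • restrictedDensityMeasure μ P

end Subspace

/-- The Hopf-Gaussian measure on the space `𝒫₃(n)` of closed polygons: the subspace measure inherited from
the Hopf-Gaussian measure on `𝒜₃(n)`. -/
def hopfGaussianClosed (n : ℕ) : Measure (closedPolygons n) :=
  subspaceMeasure (hopfGaussianArm n) (closedPolygons n)

end RandomPolygon

end

open MeasureTheory Filter Topology
open scoped ENNReal Quaternion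

noncomputable section

namespace RandomPolygon

/-! ### Measure-theoretic tools -/

/-! Total curvature is a sum of `n` bounded turning angles, so by linearity it suffices that under
either measure each turning angle has mean `π(n-1)/(2n-3)`; no independence is used. The two means
are computed separately, and both reduce to the same one-variable integrals. In each case there is a
parameter `y ∈ (0,1)` with density proportional to `(1-y²) y^(2n-5)` such that, given `y`, the
turning angle is `2 arctan (t/y)` with `t` of density `2t/(1+t²)²`. The conditional mean is
`π/(1+y)` (`lintegral_arctan_div`), and averaging over `y` is a quotient of two polynomial integrals
(`lintegral_beta`, `lintegral_beta_angle`).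

For the Hopf-Gaussian measure, the Hopf map sends Lebesgue measure to a multiple of `de/|e|` and
satisfies `|hopf q| = |q|²`, so each edge has density proportional to `exp(-|e|/2)/|e|` and closed
polygons carry the product of these. One edge is solved for from the closing condition. The
remaining problem is relativistic kinematics: `(|e|, e)` is a null vector, `de/|e|` is the
Lorentz-invariant measure on the light cone, and the pair `(L, s)` of total length and sum is a
total momentum. The phase space of `k+2` edges has density `(L²-|s|²)^k`, and the direction of any
one edge is uniform in the rest frame, hence given by the aberration formula in terms of `s` and `L`
(`chainAngleLaw`, by induction on the number of edges). Here `y = √((L-|s|)/(L+|s|))` is the Doppler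
factor, whose law comes out of `lintegral_boost`.

For the symmetric measure, the unitary group acts transitively by isometries on the Stiefel
manifold, so its normalized volume is an average over Haar measure. Inversion exchanges rows and
columns, so the turning angle becomes a function of two coordinates of two orthonormal vectors. Such
a pair may be modelled by a complex Gaussian `x` and the part of another Gaussian orthogonal to it
(`lintegral_unitary_eq`). Given `x`, the tangent of half the angle is a ratio of moduli of two
orthogonal Gaussian coordinates, rescaled by `y = |x₂|/|x|`, where `x₂` collects the last `n-2`
coordinates of `x` (`lintegral_complexAngle_orthComponent`).

Multiplicative constants are mostly left unevaluated: only their being nonzero or finite matters,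
since they cancel on normalization. -/

theorem lintegral_pi_insertNth {α : Type*} [MeasureSpace α] [SigmaFinite (volume : Measure α)]
    {m : ℕ} (i : Fin (m + 1)) {F : (Fin (m + 1) → α) → ℝ≥0∞} (hF : Measurable F) :
    ∫⁻ x, F x = ∫⁻ a : α, ∫⁻ y : Fin m → α, F (i.insertNth a y) := by
  have h := (volume_preserving_piFinSuccAbove (fun _ : Fin (m + 1) => α) i).symm
  rw [← h.lintegral_comp hF, Measure.volume_eq_prod, lintegral_prod]
  · rfl
  · exact (hF.comp (MeasurableEquiv.measurable _)).aemeasurable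

/-- Uniqueness of Haar measure up to scale. The constant does not depend on `f`, so it cancels in
every normalized expectation and never has to be identified. -/
theorem exists_map_linearEquiv_eq_smul {E F : Type*} [NormedAddCommGroup E] [NormedSpace ℝ E]
    [FiniteDimensional ℝ E] [MeasurableSpace E] [BorelSpace E] [NormedAddCommGroup F]
    [NormedSpace ℝ F] [MeasurableSpace F] [BorelSpace F] [FiniteDimensional ℝ F] (L : E ≃ₗ[ℝ] F)
    (μ : Measure E) [μ.IsAddHaarMeasure] (ν : Measure F) [ν.IsAddHaarMeasure] :
    ∃ c : ℝ≥0∞, c ≠ 0 ∧ c ≠ ∞ ∧ ∀ f : F → ℝ≥0∞, Measurable f →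
      ∫⁻ y, f y ∂ν = c * ∫⁻ x, f (L x) ∂μ := by
  have hL : Measurable L := L.toContinuousLinearEquiv.continuous.measurable
  have : (μ.map L).IsAddHaarMeasure := L.toContinuousLinearEquiv.isAddHaarMeasure_map μ
  refine ⟨ν.addHaarScalarFactor (μ.map L), ?_, ENNReal.coe_ne_top, fun f hf => ?_⟩
  · exact_mod_cast (Measure.addHaarScalarFactor_pos_of_isAddHaarMeasure ν (μ.map L)).ne'
  · rw [← lintegral_map hf hL]
    conv_lhs => rw [Measure.isAddLeftInvariant_eq_smul ν (μ.map L)]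
    rw [lintegral_smul_measure]
    rfl

theorem lintegral_pi_prod {α : Type*} [MeasurableSpace α] {m : ℕ} (μ : Fin m → Measure α)
    [∀ i, SigmaFinite (μ i)] {f : Fin m → α → ℝ≥0∞} (hf : ∀ i, Measurable (f i)) :
    ∫⁻ x, ∏ i, f i (x i) ∂Measure.pi μ = ∏ i, ∫⁻ a, f i a ∂μ i := by
  induction m with
  | zero => simp
  | succ m ih =>
    have h := (measurePreserving_piFinSuccAbove μ 0).symm
    rw [← h.lintegral_comp (by fun_prop), lintegral_prod _ (by fun_prop), Fin.prod_univ_succ,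
      ← ih (fun i => μ i.succ) fun i => hf i.succ,
      ← lintegral_mul_const _ (hf 0)]
    refine lintegral_congr fun a => ?_
    rw [← lintegral_const_mul _ (by fun_prop)]
    refine lintegral_congr fun y => ?_
    rw [Fin.prod_univ_succ]
    simp [MeasurableEquiv.piFinSuccAbove]

theorem pi_withDensity {α : Type*} [MeasurableSpace α] {m : ℕ} (μ : Fin m → Measure α)
    [∀ i, SigmaFinite (μ i)] {f : Fin m → α → ℝ≥0∞} (hf : ∀ i, Measurable (f i))
    [∀ i, SigmaFinite ((μ i).withDensity (f i))] :
    Measure.pi (fun i => (μ i).withDensity (f i)) =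
      (Measure.pi μ).withDensity (fun x => ∏ i, f i (x i)) := by
  refine Measure.pi_eq fun s hs => ?_
  rw [withDensity_apply _ (MeasurableSet.univ_pi hs), Measure.restrict_pi_pi,
    lintegral_pi_prod _ hf]
  simp [withDensity_apply, hs]

/-- The Lebesgue measure of a finite-dimensional normed space in terms of the norm. -/
theorem lintegral_fun_norm {E : Type*} [NormedAddCommGroup E] [NormedSpace ℝ E]
    [FiniteDimensional ℝ E] [Nontrivial E] [MeasurableSpace E] [BorelSpace E] (μ : Measure E)
    [μ.IsAddHaarMeasure] :
    ∃ c : ℝ≥0∞, c ≠ 0 ∧ c ≠ ∞ ∧ ∀ f : ℝ → ℝ≥0∞, Measurable f → ∫⁻ x, f ‖x‖ ∂μ =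
      c * ∫⁻ r in Set.Ioi (0 : ℝ), ENNReal.ofReal (r ^ (Module.finrank ℝ E - 1)) * f r := by
  refine ⟨μ.toSphere Set.univ, ?_, measure_ne_top _ _, fun f hf => ?_⟩
  · rw [Ne, Measure.measure_univ_eq_zero]
    exact Measure.toSphere_ne_zero μ
  have h := μ.measurePreserving_homeomorphUnitSphereProd
  have e1 : ∫⁻ x, f ‖x‖ ∂μ = ∫⁻ x : ({0}ᶜ : Set E), f ‖(x : E)‖ ∂(μ.comap Subtype.val) := by
    rw [lintegral_subtype_comap (measurableSet_singleton (0 : E)).compl (fun x : E => f ‖x‖)]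
    refine (setLIntegral_univ _).symm.trans (setLIntegral_congr ?_)
    exact (ae_eq_univ.2 (by simp)).symm
  have e2 := h.lintegral_comp (f := fun p => f (p.2 : ℝ)) (by fun_prop)
  simp only [homeomorphUnitSphereProd_apply_snd_coe] at e2
  rw [e1, e2, lintegral_prod _ (by fun_prop)]
  simp only [lintegral_const]
  rw [mul_comm]
  congr 1
  rw [Measure.volumeIoiPow, lintegral_withDensity_eq_lintegral_mul _ (by fun_prop) (by fun_prop)]
  exact lintegral_subtype_comap measurableSet_Ioi
    (fun r : ℝ => ENNReal.ofReal (r ^ (Module.finrank ℝ E - 1)) * f r)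

/-! ### Invariant averages over groups and homogeneous spaces -/

/-- A left-invariant probability measure on a group agrees with a right-invariant one. -/
theorem eq_of_isMulLeftInvariant_of_isMulRightInvariant {G : Type*} [Group G] [MeasurableSpace G]
    [MeasurableMul₂ G] (μ ν : Measure G) [IsProbabilityMeasure μ] [IsProbabilityMeasure ν]
    [μ.IsMulLeftInvariant] [ν.IsMulRightInvariant] : μ = ν := by
  refine Measure.ext_of_lintegral _ fun f hf => ?_
  calc ∫⁻ x, f x ∂μ = ∫⁻ _y, ∫⁻ x, f x ∂μ ∂ν := by simp
    _ = ∫⁻ y, ∫⁻ x, f (y * x) ∂μ ∂ν := by simp_rw [lintegral_mul_left_eq_self]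
    _ = ∫⁻ x, ∫⁻ y, f (y * x) ∂ν ∂μ := lintegral_lintegral_swap (by fun_prop)
    _ = ∫⁻ x, f x ∂ν := by simp_rw [lintegral_mul_right_eq_self]; simp

/-- The image of `μ` under inversion is right-invariant, so it coincides with `μ` by the preceding
uniqueness. -/
theorem isInvInvariant_of_isProbabilityMeasure {G : Type*} [Group G] [MeasurableSpace G]
    [MeasurableMul₂ G] [MeasurableInv G] (μ : Measure G) [IsProbabilityMeasure μ]
    [μ.IsMulLeftInvariant] : μ.IsInvInvariant := by
  have : IsProbabilityMeasure μ.inv := Measure.isProbabilityMeasure_map measurable_inv.aemeasurable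
  exact ⟨(eq_of_isMulLeftInvariant_of_isMulRightInvariant μ μ.inv).symm⟩

/-- On a homogeneous space of a group with an invariant probability measure, the integral against
an invariant measure is the average over the group. -/
theorem lintegral_eq_lintegral_smul_of_isPretransitive {G X : Type*} [Group G] [MeasurableSpace G]
    [MeasurableMul₂ G] [MeasurableInv G] [MeasurableSpace X] [MulAction G X] [MeasurableSMul₂ G X]
    [MulAction.IsPretransitive G X] (μ : Measure G) [IsProbabilityMeasure μ] [μ.IsMulLeftInvariant]
    (σ : Measure X) [SFinite σ] [SMulInvariantMeasure G X σ] (f : X → ℝ≥0∞) (hf : Measurable f)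
    (x₀ : X) : ∫⁻ x, f x ∂σ = σ Set.univ * ∫⁻ g, f (g • x₀) ∂μ := by
  have := isInvInvariant_of_isProbabilityMeasure μ
  -- By transitivity and right invariance the average over an orbit does not depend on the starting
  -- point.
  have hr : ∀ x, ∫⁻ g, f (g • x) ∂μ = ∫⁻ g, f (g • x₀) ∂μ := by
    intro x
    obtain ⟨k, rfl⟩ := MulAction.exists_smul_eq G x₀ x
    simp_rw [← mul_smul]
    have : μ.IsMulRightInvariant := by
      rw [← Measure.inv_eq_self μ]; infer_instance
    exact lintegral_mul_right_eq_self (fun g => f (g • x₀)) k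
  calc ∫⁻ x, f x ∂σ = ∫⁻ _g : G, ∫⁻ x, f x ∂σ ∂μ := by simp
    _ = ∫⁻ g : G, ∫⁻ x, f (g • x) ∂σ ∂μ := by
        refine lintegral_congr fun g => ?_
        exact ((measurePreserving_smul g σ).lintegral_comp hf).symm
    _ = ∫⁻ x, ∫⁻ g : G, f (g • x) ∂μ ∂σ := lintegral_lintegral_swap (by fun_prop)
    _ = σ Set.univ * ∫⁻ g, f (g • x₀) ∂μ := by simp_rw [hr]; simp [mul_comm]

/-! ### Spherical coordinates in three-space -/

abbrev E3 : Type := EuclideanSpace ℝ (Fin 3)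

/-- `ℝ³` as `ℝ × ℂ`, in the order of coordinates in which the Hopf map is written. -/
def prodComplexEquiv : (ℝ × ℂ) ≃ₗ[ℝ] E3 where
  toFun p := !₂[p.1, p.2.im, p.2.re]
  map_add' p q := by ext i; fin_cases i <;> simp
  map_smul' c p := by ext i; fin_cases i <;> simp
  invFun e := (e 0, ⟨e 2, e 1⟩)
  left_inv p := by simp
  right_inv e := by ext i; fin_cases i <;> simp

theorem prodComplexEquiv_apply (p : ℝ × ℂ) : prodComplexEquiv p = !₂[p.1, p.2.im, p.2.re] := rfl

theorem norm_prodComplexEquiv (p : ℝ × ℂ) :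
    ‖prodComplexEquiv p‖ = √(p.1 ^ 2 + ‖p.2‖ ^ 2) := by
  rw [prodComplexEquiv_apply, EuclideanSpace.norm_eq]
  congr 1
  simp [Fin.sum_univ_three, Complex.sq_norm, Complex.normSq_apply]
  ring

/-- Cylindrical coordinates around the first axis; `ρ` is the planar polar Jacobian, and the angular
mass goes into `K`. -/
theorem lintegral_norm_coord : ∃ K : ℝ≥0∞, K ≠ 0 ∧ K ≠ ∞ ∧ ∀ G : ℝ → ℝ → ℝ≥0∞,
    Measurable (fun p : ℝ × ℝ => G p.1 p.2) → ∫⁻ e : E3, G ‖e‖ (e 0) =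
      K * ∫⁻ z : ℝ, ∫⁻ ρ in Set.Ioi (0 : ℝ), ENNReal.ofReal ρ * G √(z ^ 2 + ρ ^ 2) z := by
  obtain ⟨c, hc0, hct, hc⟩ := exists_map_linearEquiv_eq_smul prodComplexEquiv
    ((volume : Measure ℝ).prod (volume : Measure ℂ)) (volume : Measure E3)
  obtain ⟨d, hd0, hdt, hd⟩ := lintegral_fun_norm (volume : Measure ℂ)
  refine ⟨c * d, mul_ne_zero hc0 hd0, ENNReal.mul_ne_top hct hdt, fun G hG => ?_⟩
  rw [hc _ (by fun_prop), lintegral_prod _ (by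
    simp_rw [norm_prodComplexEquiv]
    refine (Measurable.comp (f := fun p : ℝ × ℂ => (√(p.1 ^ 2 + ‖p.2‖ ^ 2), p.1)) hG
      (by fun_prop)).aemeasurable),
    mul_assoc]
  congr 1
  rw [← lintegral_const_mul _ (Measurable.lintegral_prod_right' (f := fun p : ℝ × ℝ =>
    ENNReal.ofReal p.2 * G √(p.1 ^ 2 + p.2 ^ 2) p.1) (by fun_prop))]
  refine lintegral_congr fun z => ?_
  simp_rw [norm_prodComplexEquiv]
  have := hd (fun ρ => G √(z ^ 2 + ρ ^ 2) z) (by fun_prop)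
  simpa [prodComplexEquiv_apply, Complex.finrank_real_complex] using this

theorem lintegral_halfPlane_polar (F : ℝ → ℝ → ℝ≥0∞) (hF : Measurable (fun p : ℝ × ℝ => F p.1 p.2)) :
    ∫⁻ z : ℝ, ∫⁻ ρ in Set.Ioi (0 : ℝ), F z ρ = ∫⁻ r in Set.Ioi (0 : ℝ),
      ∫⁻ φ in Set.Ioo 0 Real.pi, ENNReal.ofReal r * F (r * Real.cos φ) (r * Real.sin φ) := by
  have h := lintegral_comp_polarCoord_symm (fun p => (Set.Ioi (0 : ℝ)).indicator (F p.1) p.2)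
  have hm : Measurable fun p : ℝ × ℝ => (Set.Ioi (0 : ℝ)).indicator (F p.1) p.2 := by
    have : (fun p : ℝ × ℝ => (Set.Ioi (0 : ℝ)).indicator (F p.1) p.2) =
        (Prod.snd ⁻¹' Set.Ioi (0 : ℝ)).indicator (fun p : ℝ × ℝ => F p.1 p.2) := by
      ext p; simp [Set.indicator]
    rw [this]
    exact hF.indicator (measurable_snd measurableSet_Ioi)
  have hl : ∫⁻ p : ℝ × ℝ, (Set.Ioi (0 : ℝ)).indicator (F p.1) p.2 =
      ∫⁻ z : ℝ, ∫⁻ ρ in Set.Ioi (0 : ℝ), F z ρ := by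
    rw [Measure.volume_eq_prod, lintegral_prod _ hm.aemeasurable]
    refine lintegral_congr fun z => ?_
    simp [lintegral_indicator]
  rw [← hl, ← h, polarCoord_target, Measure.volume_eq_prod, ← Measure.prod_restrict,
    lintegral_prod _ (by
      simp only [polarCoord_symm_apply, smul_eq_mul]
      exact ((by fun_prop : Measurable fun p : ℝ × ℝ => ENNReal.ofReal p.1).mul
        (Measurable.comp (f := fun p : ℝ × ℝ => (p.1 * Real.cos p.2, p.1 * Real.sin p.2)) hm
          (by fun_prop))).aemeasurable)]
  refine setLIntegral_congr_fun measurableSet_Ioi fun r hr => ?_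
  have hr : 0 < r := hr
  have hsub : Set.Ioo 0 Real.pi ⊆ Set.Ioo (-Real.pi) Real.pi :=
    Set.Ioo_subset_Ioo_left (by linarith [Real.pi_pos])
  rw [← Set.inter_eq_left.2 hsub, ← setLIntegral_indicator measurableSet_Ioo]
  refine setLIntegral_congr_fun measurableSet_Ioo fun φ hφ => ?_
  simp only [polarCoord_symm_apply, smul_eq_mul, Set.indicator, Set.mem_Ioi, Set.mem_Ioo]
  by_cases h0 : 0 < φ
  · have hs : 0 < r * Real.sin φ := mul_pos hr (Real.sin_pos_of_pos_of_lt_pi h0 hφ.2)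
    rw [if_pos hs, if_pos ⟨h0, hφ.2⟩]
  · have hs : ¬ 0 < r * Real.sin φ := not_lt.2 (mul_nonpos_of_nonneg_of_nonpos hr.le
      (Real.sin_nonpos_of_nonpos_of_neg_pi_le (not_lt.1 h0) hφ.1.le))
    rw [if_neg hs, if_neg (fun h => h0 h.1), mul_zero]

theorem exists_linearIsometryEquiv_smul_eq (s : E3) :
    ∃ R : E3 ≃ₗᵢ[ℝ] E3, R s = ‖s‖ • EuclideanSpace.single 0 1 := by
  have h : ‖s‖ = ‖‖s‖ • (EuclideanSpace.single 0 1 : E3)‖ := by simp [norm_smul]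
  exact ⟨_, Submodule.reflection_sub h⟩

/-- Spherical coordinates with polar axis `s`: a reflection moves `s` to the first axis, and
cylindrical coordinates become polar in the half-plane. That `K` is independent of `s` is what
permits integrating over `s` later. -/
theorem lintegral_norm_angle : ∃ K : ℝ≥0∞, K ≠ 0 ∧ K ≠ ∞ ∧ ∀ (s : E3), s ≠ 0 →
    ∀ G : ℝ → ℝ → ℝ≥0∞, Measurable (fun p : ℝ × ℝ => G p.1 p.2) →
      ∫⁻ e : E3, G ‖e‖ (InnerProductGeometry.angle s e) =
        K * ∫⁻ r in Set.Ioi (0 : ℝ), ∫⁻ φ in Set.Ioo 0 Real.pi,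
          ENNReal.ofReal (r ^ 2 * Real.sin φ) * G r φ := by
  obtain ⟨K, hK0, hKt, hK⟩ := lintegral_norm_coord
  refine ⟨K, hK0, hKt, fun s hs G hG => ?_⟩
  obtain ⟨R, hR⟩ := exists_linearIsometryEquiv_smul_eq s
  have hang : ∀ e : E3, InnerProductGeometry.angle s e = Real.arccos (R e 0 / ‖R e‖) := by
    intro e
    rw [← LinearIsometry.angle_map R.toLinearIsometry]
    simp only [LinearIsometryEquiv.coe_toLinearIsometry]
    rw [hR, InnerProductGeometry.angle_smul_left_of_pos _ _ (norm_pos_iff.2 hs),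
      InnerProductGeometry.angle]
    simp [EuclideanSpace.inner_single_left]
  have hm : Measurable fun e : E3 => G ‖e‖ (Real.arccos (e 0 / ‖e‖)) :=
    Measurable.comp (f := fun e : E3 => (‖e‖, Real.arccos (e 0 / ‖e‖))) hG
      (by have := Real.continuous_arccos.measurable; fun_prop)
  have hm2 : Measurable fun p : ℝ × ℝ => G p.1 (Real.arccos (p.2 / p.1)) :=
    Measurable.comp (f := fun p : ℝ × ℝ => (p.1, Real.arccos (p.2 / p.1))) hG
      (by have := Real.continuous_arccos.measurable; fun_prop)
  have hm3 : Measurable fun p : ℝ × ℝ => ENNReal.ofReal p.2 *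
      G √(p.1 ^ 2 + p.2 ^ 2) (Real.arccos (p.1 / √(p.1 ^ 2 + p.2 ^ 2))) :=
    Measurable.mul (by fun_prop)
      (Measurable.comp (f := fun p : ℝ × ℝ => (√(p.1 ^ 2 + p.2 ^ 2),
        Real.arccos (p.1 / √(p.1 ^ 2 + p.2 ^ 2)))) hG
        (by have := Real.continuous_arccos.measurable; fun_prop))
  calc ∫⁻ e : E3, G ‖e‖ (InnerProductGeometry.angle s e)
      = ∫⁻ e : E3, G ‖R e‖ (Real.arccos (R e 0 / ‖R e‖)) := by
        simp_rw [hang, LinearIsometryEquiv.norm_map]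
    _ = ∫⁻ e : E3, G ‖e‖ (Real.arccos (e 0 / ‖e‖)) := R.measurePreserving.lintegral_comp hm
    _ = _ := by
        rw [hK (fun r z => G r (Real.arccos (z / r))) hm2, lintegral_halfPlane_polar _ hm3]
        congr 1
        refine setLIntegral_congr_fun measurableSet_Ioi fun r hr => ?_
        refine setLIntegral_congr_fun measurableSet_Ioo fun φ hφ => ?_
        have hr : 0 < r := hr
        have hn : √((r * Real.cos φ) ^ 2 + (r * Real.sin φ) ^ 2) = r := by
          rw [mul_pow, mul_pow, ← mul_add, Real.cos_sq_add_sin_sq, mul_one, Real.sqrt_sq hr.le]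
        simp only [hn]
        rw [mul_div_cancel_left₀ _ hr.ne', Real.arccos_cos hφ.1.le hφ.2.le, ← mul_assoc,
          ← ENNReal.ofReal_mul hr.le]
        congr 2
        ring

/-! ### Integrals over the half-line -/

/-- The fundamental theorem of calculus for lower integrals; integrability comes from the sign of
the derivative and the finite limit. -/
theorem lintegral_Ioi_of_hasDerivAt {g g' : ℝ → ℝ} {a l : ℝ}
    (hd : ∀ x ∈ Set.Ici a, HasDerivAt g (g' x) x) (hn : ∀ x ∈ Set.Ioi a, 0 ≤ g' x)
    (hl : Tendsto g atTop (𝓝 l)) :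
    ∫⁻ x in Set.Ioi a, ENNReal.ofReal (g' x) = ENNReal.ofReal (l - g a) := by
  rw [← integral_Ioi_of_hasDerivAt_of_nonneg' hd hn hl]
  refine (ofReal_integral_eq_lintegral_ofReal (integrableOn_Ioi_deriv_of_nonneg' hd hn hl) ?_).symm
  exact (ae_restrict_iff' measurableSet_Ioi).2 (ae_of_all _ hn)

theorem hasDerivAt_arctan_div {k : ℝ} (hk : 0 < k) (t : ℝ) :
    HasDerivAt (fun t => Real.arctan (t / k)) (k / (k ^ 2 + t ^ 2)) t := by
  have h := ((hasDerivAt_id t).div_const k).arctan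
  refine h.congr_deriv ?_
  simp only [id]
  have : 0 < k ^ 2 + t ^ 2 := by positivity
  field_simp

theorem tendsto_arctan_div_atTop {k : ℝ} (hk : 0 < k) :
    Tendsto (fun t => Real.arctan (t / k)) atTop (𝓝 (Real.pi / 2)) :=
  (tendsto_nhds_of_tendsto_nhdsWithin Real.tendsto_arctan_atTop).comp
    (tendsto_id.atTop_div_const hk)

theorem tendsto_inv_one_add_sq_atTop : Tendsto (fun t : ℝ => (1 + t ^ 2)⁻¹) atTop (𝓝 0) :=
  tendsto_inv_atTop_zero.comp (tendsto_atTop_add_const_left _ _ (tendsto_pow_atTop two_ne_zero))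

theorem lintegral_two_mul_div_sq :
    ∫⁻ t in Set.Ioi (0 : ℝ), ENNReal.ofReal (2 * t / (1 + t ^ 2) ^ 2) = 1 := by
  have h := lintegral_Ioi_of_hasDerivAt (g := fun t => -(1 + t ^ 2)⁻¹)
    (g' := fun t => 2 * t / (1 + t ^ 2) ^ 2) (a := 0) (l := 0) (fun t _ => ?_) (fun t ht => ?_) ?_
  · rw [h]; simp
  · have := (((hasDerivAt_pow 2 t).const_add 1).inv (by positivity)).neg
    refine this.congr_deriv ?_
    simp [neg_div]
  · have : 0 < t := ht
    positivity
  · simpa using tendsto_inv_one_add_sq_atTop.neg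

/-- Integration by parts: the boundary term vanishes at both ends and leaves the rational function
`2k/((k²+t²)(1+t²))`. -/
theorem lintegral_arctan_div {k : ℝ} (hk : 0 < k) :
    ∫⁻ t in Set.Ioi (0 : ℝ), ENNReal.ofReal (2 * t / (1 + t ^ 2) ^ 2) *
      ENNReal.ofReal (2 * Real.arctan (t / k)) = ENNReal.ofReal (Real.pi / (1 + k)) := by
  have hpos : ∀ t ∈ Set.Ioi (0 : ℝ), 0 ≤ 2 * t / (1 + t ^ 2) ^ 2 * (2 * Real.arctan (t / k)) := by
    intro t ht
    have ht : 0 < t := ht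
    have := Real.arctan_pos.2 (div_pos ht hk)
    positivity
  have hA : ∀ t, HasDerivAt (fun t => -(2 * Real.arctan (t / k)) * (1 + t ^ 2)⁻¹)
      (2 * t / (1 + t ^ 2) ^ 2 * (2 * Real.arctan (t / k)) -
        2 * (k / (k ^ 2 + t ^ 2)) * (1 + t ^ 2)⁻¹) t := by
    intro t
    have h1 := ((hasDerivAt_arctan_div hk t).const_mul 2).neg
    have h2 := ((hasDerivAt_pow 2 t).const_add 1).inv (by positivity)
    refine (h1.mul h2).congr_deriv ?_
    simp only [Pi.neg_apply, Pi.inv_apply, Nat.cast_ofNat]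
    ring
  have hAl : Tendsto (fun t => -(2 * Real.arctan (t / k)) * (1 + t ^ 2)⁻¹) atTop (𝓝 0) := by
    simpa using (((tendsto_arctan_div_atTop hk).const_mul 2).neg).mul tendsto_inv_one_add_sq_atTop
  -- It remains to give a primitive `B` of the rational remainder. Partial fractions supply it,
  -- except that they degenerate at `k = 1`.
  have key : ∀ B : ℝ → ℝ, (∀ t, HasDerivAt B (2 * (k / (k ^ 2 + t ^ 2)) * (1 + t ^ 2)⁻¹) t) →
      B 0 = 0 → Tendsto B atTop (𝓝 (Real.pi / (1 + k))) →
      ∫⁻ t in Set.Ioi (0 : ℝ), ENNReal.ofReal (2 * t / (1 + t ^ 2) ^ 2) *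
        ENNReal.ofReal (2 * Real.arctan (t / k)) = ENNReal.ofReal (Real.pi / (1 + k)) := by
    intro B hB hB0 hBl
    have h := lintegral_Ioi_of_hasDerivAt (a := 0)
      (fun t _ => ((hA t).add (hB t)).congr_deriv (sub_add_cancel _ _)) hpos (hAl.add hBl)
    simp only [Pi.add_apply, hB0] at h
    rw [zero_add] at h
    simp only [zero_div, Real.arctan_zero, mul_zero, neg_zero, zero_mul, add_zero, sub_zero] at h
    rw [← h]
    refine setLIntegral_congr_fun measurableSet_Ioi fun t ht => ?_
    have ht : 0 < t := ht
    exact (ENNReal.ofReal_mul (by positivity)).symm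
  rcases eq_or_ne k 1 with rfl | hk1
  · refine key (fun t => t * (1 + t ^ 2)⁻¹ + Real.arctan (t / 1)) (fun t => ?_) (by simp) ?_
    · have h2 := ((hasDerivAt_pow 2 t).const_add 1).inv (by positivity)
      refine (((hasDerivAt_id t).mul h2).add (hasDerivAt_arctan_div one_pos t)).congr_deriv ?_
      have : 0 < 1 + t ^ 2 := by positivity
      simp only [id, Pi.inv_apply]
      field_simp
      norm_num
      ring
    · have h1 : Tendsto (fun t : ℝ => t * (1 + t ^ 2)⁻¹) atTop (𝓝 0) := by
        refine squeeze_zero' (eventually_ge_atTop 0 |>.mono fun t ht => by positivity)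
          (eventually_gt_atTop 0 |>.mono fun t ht => ?_) tendsto_inv_atTop_zero
        rw [← div_eq_mul_inv, div_le_iff₀ (by positivity), ← div_eq_inv_mul, le_div_iff₀ ht]
        nlinarith
      have h2 := h1.add (tendsto_arctan_div_atTop (k := 1) one_pos)
      norm_num at h2 ⊢
      exact h2
  · have hk2 : 1 - k ^ 2 ≠ 0 := by
      intro h
      have : (k - 1) * (k + 1) = 0 := by linarith
      rcases mul_eq_zero.1 this with h | h
      · exact hk1 (by linarith)
      · linarith
    refine key (fun t => 2 / (1 - k ^ 2) * (Real.arctan (t / k) - k * Real.arctan (t / 1)))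
      (fun t => ?_) (by simp) ?_
    · have h := ((hasDerivAt_arctan_div hk t).sub
        ((hasDerivAt_arctan_div one_pos t).const_mul k)).const_mul (2 / (1 - k ^ 2))
      refine h.congr_deriv ?_
      have h1 : 0 < 1 + t ^ 2 := by positivity
      have h2 : 0 < k ^ 2 + t ^ 2 := by positivity
      field_simp
      ring
    · have h := ((tendsto_arctan_div_atTop hk).sub
        ((tendsto_arctan_div_atTop (k := 1) one_pos).const_mul k)).const_mul (2 / (1 - k ^ 2))
      convert h using 2
      have : 1 + k ≠ 0 := by positivity
      field_simp
      ring

/-! ### Half-angle substitution and aberration -/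

theorem sin_two_mul_arctan (x : ℝ) : Real.sin (2 * Real.arctan x) = 2 * x / (1 + x ^ 2) := by
  have h : Real.sin (Real.arctan x) = x * Real.cos (Real.arctan x) := by
    rw [Real.sin_arctan, Real.cos_arctan]; ring
  rw [Real.sin_two_mul, h]
  linear_combination (2 * x) * Real.cos_sq_arctan x

theorem cos_two_mul_arctan (x : ℝ) :
    Real.cos (2 * Real.arctan x) = (1 - x ^ 2) / (1 + x ^ 2) := by
  rw [Real.cos_two_mul, Real.cos_sq_arctan]
  have : 0 < 1 + x ^ 2 := by positivity
  field_simp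
  ring

/-- The aberration formula: a uniformly distributed direction seen from a moving frame. -/
theorem lintegral_sin_div_sq {a L : ℝ} (ha : 0 ≤ a) (hL : a < L) (F : ℝ → ℝ≥0∞) :
    ∫⁻ φ in Set.Ioo 0 Real.pi,
        ENNReal.ofReal (Real.sin φ / (L - a * Real.cos φ) ^ 2) * F (Real.pi - φ) =
      ENNReal.ofReal (2 / (L ^ 2 - a ^ 2)) * ∫⁻ t in Set.Ioi (0 : ℝ),
        ENNReal.ofReal (2 * t / (1 + t ^ 2) ^ 2) *
          F (2 * Real.arctan (t / √((L - a) / (L + a)))) := by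
  set k := √((L - a) / (L + a)) with hkdef
  have hk : 0 < k := Real.sqrt_pos.2 (div_pos (by linarith) (by linarith))
  have hk2 : k ^ 2 = (L - a) / (L + a) := Real.sq_sqrt (div_pos (by linarith) (by linarith)).le
  -- The substitution takes the supplement `π - φ` to `2 arctan (t/k)`, because `F` is evaluated at
  -- `π - φ`, the angle seen from the closing edge.
  have him : (fun t => Real.pi - 2 * Real.arctan (t / k)) '' Set.Ioi 0 = Set.Ioo 0 Real.pi := by
    ext φ
    constructor
    · rintro ⟨t, ht, rfl⟩
      have h1 := Real.arctan_pos.2 (div_pos ht hk)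
      have h2 := Real.arctan_lt_pi_div_two (t / k)
      exact ⟨by linarith, by linarith⟩
    · rintro ⟨h1, h2⟩
      refine ⟨k * Real.tan ((Real.pi - φ) / 2), ?_, ?_⟩
      · exact mul_pos hk (Real.tan_pos_of_pos_of_lt_pi_div_two (by linarith) (by linarith))
      · simp only [mul_div_cancel_left₀ _ hk.ne']
        rw [Real.arctan_tan (by linarith) (by linarith)]
        ring
  rw [← him, lintegral_image_eq_lintegral_abs_deriv_mul measurableSet_Ioi
    (f' := fun t => -(2 * (k / (k ^ 2 + t ^ 2))))
    (fun t _ => (((hasDerivAt_arctan_div hk t).const_mul 2).const_sub Real.pi).hasDerivWithinAt)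
    (fun x _ y _ h => ?_), ← lintegral_const_mul' _ _ ENNReal.ofReal_ne_top]
  · refine setLIntegral_congr_fun measurableSet_Ioi fun t ht => ?_
    have ht : 0 < t := ht
    have hD : 0 < L ^ 2 - a ^ 2 := by nlinarith
    simp only [sub_sub_cancel]
    rw [← mul_assoc, ← mul_assoc, ← ENNReal.ofReal_mul (abs_nonneg _),
      ← ENNReal.ofReal_mul (by positivity), Real.sin_pi_sub, Real.cos_pi_sub, sin_two_mul_arctan,
      cos_two_mul_arctan, abs_neg, abs_of_pos (by positivity)]
    congr 2
    -- The choice of `k` makes `k²(L+a) = L-a`; this turns the denominator into a multiple of `1+t²`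
    -- and removes `a` and `L` from the density of `t`.
    have h1 : L - a * -((1 - (t / k) ^ 2) / (1 + (t / k) ^ 2)) =
        (L - a) * (1 + t ^ 2) / (k ^ 2 + t ^ 2) := by
      have : 0 < k ^ 2 + t ^ 2 := by positivity
      have h3 : k ^ 2 * (L + a) = L - a := by
        rw [hk2]; field_simp [(by linarith : L + a ≠ 0)]
      field_simp
      linear_combination h3
    rw [h1]
    have h2 : L ^ 2 - a ^ 2 = (L - a) ^ 2 / k ^ 2 := by
      rw [hk2]
      field_simp [(by linarith : L - a ≠ 0), (by linarith : L + a ≠ 0)]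
      ring
    rw [h2]
    have : 0 < L - a := by linarith
    field_simp
  · have h' : Real.arctan (x / k) = Real.arctan (y / k) := by
      have : Real.pi - 2 * Real.arctan (x / k) = Real.pi - 2 * Real.arctan (y / k) := h
      linarith
    have := Real.arctan_injective h'
    field_simp at this
    exact this

/-! ### The joint law of the sum and the total length of a chain of edges -/

theorem measurable_angle {α : Type*} [MeasurableSpace α] {f g : α → E3} (hf : Measurable f)
    (hg : Measurable g) : Measurable fun x => InnerProductGeometry.angle (f x) (g x) :=
  Real.continuous_arccos.measurable.comp ((hf.inner hg).div (hf.norm.mul hg.norm))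

/-- The power `(L² - a²)ʲ` on the cone `a < L`. -/
def coneWeight (j : ℕ) (a L : ℝ) : ℝ≥0∞ := if a < L then ENNReal.ofReal ((L ^ 2 - a ^ 2) ^ j) else 0

@[fun_prop]
theorem measurable_coneWeight (j : ℕ) : Measurable fun p : ℝ × ℝ => coneWeight j p.1 p.2 :=
  Measurable.ite (measurableSet_lt measurable_fst measurable_snd) (by fun_prop) measurable_const

theorem lintegral_coneWeight_mul (j : ℕ) (a : ℝ) (F : ℝ → ℝ≥0∞) :
    ∫⁻ L, coneWeight j a L * F L =
      ∫⁻ L in Set.Ioi a, ENNReal.ofReal ((L ^ 2 - a ^ 2) ^ j) * F L := by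
  rw [← lintegral_indicator measurableSet_Ioi]
  refine lintegral_congr fun L => ?_
  by_cases h : a < L <;> simp [coneWeight, Set.indicator, h]

/-- The integral of a function of the polar angle against the aberration density. -/
def aberration (a L : ℝ) (F : ℝ → ℝ≥0∞) : ℝ≥0∞ :=
  ∫⁻ φ in Set.Ioo 0 Real.pi, ENNReal.ofReal (Real.sin φ / (L - a * Real.cos φ) ^ 2) * F φ

theorem norm_sub_eq_sqrt (s e : E3) : ‖s - e‖ =
    √(‖s‖ ^ 2 - 2 * ‖s‖ * ‖e‖ * Real.cos (InnerProductGeometry.angle s e) + ‖e‖ ^ 2) := by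
  rw [← Real.sqrt_sq (norm_nonneg (s - e))]
  congr 1
  have := InnerProductGeometry.norm_sub_sq_eq_norm_sq_add_norm_sq_sub_two_mul_norm_mul_norm_mul_cos_angle s e
  linear_combination this

/-- With foci `0` and `s`, `|s| = a`, the sum `L` of the distances of `e` to the foci replaces the
radius `r` along a fixed ray. The curve `r = (L²-a²)/(2(L-a c))` is the polar equation of the
ellipse with that sum, where `c` and `σ` are the cosine and sine of the ray's angle to `s`. -/
theorem lintegral_prolate {a c σ : ℝ} (ha : 0 < a) (hc : |c| < 1) (hσ : 0 < σ) (h : ℝ → ℝ≥0∞) :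
    ∫⁻ r in Set.Ioi (0 : ℝ), ENNReal.ofReal (r ^ 2 * σ) * (ENNReal.ofReal r⁻¹ *
      (ENNReal.ofReal (√(a ^ 2 - 2 * a * r * c + r ^ 2))⁻¹ *
        h (r + √(a ^ 2 - 2 * a * r * c + r ^ 2)))) =
      ∫⁻ L in Set.Ioi a, ENNReal.ofReal ((L ^ 2 - a ^ 2) / 2 * (σ / (L - a * c) ^ 2)) * h L := by
  obtain ⟨hc1, hc2⟩ := abs_lt.1 hc
  have hpos : ∀ L, a < L → 0 < L - a * c := fun L hL => by nlinarith
  have hB : ∀ L, a < L → 0 < L ^ 2 - 2 * a * c * L + a ^ 2 := fun L hL => by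
    nlinarith [sq_nonneg (L - a), mul_pos (mul_pos ha (ha.trans hL)) (sub_pos.2 hc2)]
  -- The distance to the second focus is rational in `L` on the ellipse; together with `hsum` this
  -- recovers `L` from `r`, which later gives injectivity.
  have hb : ∀ L, a < L → √(a ^ 2 - 2 * a * ((L ^ 2 - a ^ 2) / (2 * (L - a * c))) * c +
      ((L ^ 2 - a ^ 2) / (2 * (L - a * c))) ^ 2) =
      (L ^ 2 - 2 * a * c * L + a ^ 2) / (2 * (L - a * c)) := by
    intro L hL
    have h0 := hpos L hL
    rw [← Real.sqrt_sq (x := (L ^ 2 - 2 * a * c * L + a ^ 2) / (2 * (L - a * c)))]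
    · congr 1
      field_simp
      ring
    · exact div_nonneg (hB L hL).le (by linarith)
  have hsum : ∀ L, a < L → (L ^ 2 - a ^ 2) / (2 * (L - a * c)) +
      (L ^ 2 - 2 * a * c * L + a ^ 2) / (2 * (L - a * c)) = L := by
    intro L hL
    have h0 := hpos L hL
    field_simp
    ring
  have him : (fun L => (L ^ 2 - a ^ 2) / (2 * (L - a * c))) '' Set.Ioi a = Set.Ioi 0 := by
    ext r
    constructor
    · rintro ⟨L, hL, rfl⟩
      have hL : a < L := hL
      have h0 := hpos L hL
      have hD : 0 < L ^ 2 - a ^ 2 := by nlinarith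
      show 0 < (L ^ 2 - a ^ 2) / (2 * (L - a * c))
      positivity
    · intro hr
      have hr : 0 < r := hr
      have hq : 0 ≤ a ^ 2 - 2 * a * r * c + r ^ 2 := by
        nlinarith [sq_nonneg (a - r), mul_pos ha hr]
      have hs := Real.sq_sqrt hq
      have hs0 := Real.sqrt_nonneg (a ^ 2 - 2 * a * r * c + r ^ 2)
      set b := √(a ^ 2 - 2 * a * r * c + r ^ 2)
      have hab : a < r + b := by
        by_contra hcon
        push Not at hcon
        nlinarith [mul_pos ha hr]
      refine ⟨r + b, hab, ?_⟩
      have h0 := hpos _ hab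
      simp only
      rw [div_eq_iff (by positivity)]
      nlinarith
  rw [← him, lintegral_image_eq_lintegral_abs_deriv_mul measurableSet_Ioi
    (f' := fun L => (L ^ 2 - 2 * a * c * L + a ^ 2) / (2 * (L - a * c) ^ 2)) (fun L hL => ?_)
    (fun x hx y hy hxy => ?_)]
  · refine setLIntegral_congr_fun measurableSet_Ioi fun L hL => ?_
    have hL : a < L := hL
    have h0 := hpos L hL
    have hD : 0 < L ^ 2 - a ^ 2 := by nlinarith
    have hB := hB L hL
    rw [hb L hL, hsum L hL, ← mul_assoc, ← mul_assoc, ← mul_assoc,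
      ← ENNReal.ofReal_mul (by positivity), ← ENNReal.ofReal_mul (by positivity),
      ← ENNReal.ofReal_mul (by positivity), abs_of_pos (by positivity)]
    congr 2
    generalize L ^ 2 - 2 * a * c * L + a ^ 2 = B at hB
    field_simp
  · have h0 := hpos L hL
    have h1 : HasDerivAt (fun L => L ^ 2 - a ^ 2) (2 * L) L := by
      simpa using (hasDerivAt_pow 2 L).sub_const (a ^ 2)
    have h2 : HasDerivAt (fun L => 2 * (L - a * c)) 2 L := by
      simpa using ((hasDerivAt_id L).sub_const (a * c)).const_mul 2
    refine ((h1.div h2 (by positivity)).congr_deriv ?_).hasDerivWithinAt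
    field_simp
    ring
  · have h1 := hsum x hx
    have h2 := hsum y hy
    rw [← hb x hx] at h1
    rw [← hb y hy] at h2
    have hxy : (x ^ 2 - a ^ 2) / (2 * (x - a * c)) = (y ^ 2 - a ^ 2) / (2 * (y - a * c)) := hxy
    rw [hxy] at h1
    exact h1.symm.trans h2

/-- The two-body case: for edges `e` and `s - e` with fixed sum, exchange the radius for the total
length ray by ray by `lintegral_prolate`. This is the base of the induction on the number of edges.
-/
theorem lintegral_two_edges : ∃ C : ℝ≥0∞, C ≠ 0 ∧ C ≠ ∞ ∧ ∀ s : E3, s ≠ 0 → ∀ h : ℝ → ℝ → ℝ≥0∞,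
    Measurable (fun p : ℝ × ℝ => h p.1 p.2) →
      ∫⁻ e : E3, ENNReal.ofReal ‖e‖⁻¹ * (ENNReal.ofReal ‖s - e‖⁻¹ *
        h (‖e‖ + ‖s - e‖) (InnerProductGeometry.angle s e)) =
      C * ∫⁻ L, coneWeight 1 ‖s‖ L * aberration ‖s‖ L (h L) := by
  obtain ⟨K, hK0, hKt, hK⟩ := lintegral_norm_angle
  refine ⟨K * ENNReal.ofReal (1 / 2), mul_ne_zero hK0 (by simp),
    ENNReal.mul_ne_top hKt ENNReal.ofReal_ne_top, fun s hs h hh => ?_⟩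
  have ha : 0 < ‖s‖ := norm_pos_iff.2 hs
  have hG : Measurable fun p : ℝ × ℝ => ENNReal.ofReal p.1⁻¹ * (ENNReal.ofReal
      (√(‖s‖ ^ 2 - 2 * ‖s‖ * p.1 * Real.cos p.2 + p.1 ^ 2))⁻¹ *
        h (p.1 + √(‖s‖ ^ 2 - 2 * ‖s‖ * p.1 * Real.cos p.2 + p.1 ^ 2)) p.2) := by
    fun_prop
  simp_rw [norm_sub_eq_sqrt s]
  rw [hK s hs (fun r φ => ENNReal.ofReal r⁻¹ * (ENNReal.ofReal
      (√(‖s‖ ^ 2 - 2 * ‖s‖ * r * Real.cos φ + r ^ 2))⁻¹ *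
        h (r + √(‖s‖ ^ 2 - 2 * ‖s‖ * r * Real.cos φ + r ^ 2)) φ)) hG, mul_assoc]
  congr 1
  rw [lintegral_lintegral_swap (by fun_prop), lintegral_coneWeight_mul]
  simp_rw [aberration]
  have hsw : ∀ L : ℝ, ENNReal.ofReal ((L ^ 2 - ‖s‖ ^ 2) ^ 1) * ∫⁻ φ in Set.Ioo 0 Real.pi,
      ENNReal.ofReal (Real.sin φ / (L - ‖s‖ * Real.cos φ) ^ 2) * h L φ =
      ∫⁻ φ in Set.Ioo 0 Real.pi, ENNReal.ofReal ((L ^ 2 - ‖s‖ ^ 2) ^ 1) *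
        (ENNReal.ofReal (Real.sin φ / (L - ‖s‖ * Real.cos φ) ^ 2) * h L φ) := fun L =>
    (lintegral_const_mul' _ _ ENNReal.ofReal_ne_top).symm
  simp_rw [hsw]
  conv_rhs => rw [lintegral_lintegral_swap (by fun_prop),
    ← lintegral_const_mul' _ _ ENNReal.ofReal_ne_top]
  refine setLIntegral_congr_fun measurableSet_Ioo fun φ hφ => ?_
  have hsin := Real.sin_pos_of_pos_of_lt_pi hφ.1 hφ.2
  have hcos : |Real.cos φ| < 1 := by
    rw [← sq_lt_one_iff_abs_lt_one]
    nlinarith [Real.sin_sq_add_cos_sq φ]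
  rw [lintegral_prolate ha hcos hsin (fun L => h L φ), ← lintegral_const_mul' _ _ ENNReal.ofReal_ne_top]
  refine setLIntegral_congr_fun measurableSet_Ioi fun L hL => ?_
  have hL : ‖s‖ < L := hL
  have hD : 0 < L ^ 2 - ‖s‖ ^ 2 := by nlinarith
  rw [← mul_assoc, ← mul_assoc, ← ENNReal.ofReal_mul (by positivity),
    ← ENNReal.ofReal_mul (by positivity)]
  congr 2
  ring


/-- The radial integral over a split-off edge of length `r`, with `D = L²-a²` and `g = L - a cos φ`;
`r` is what the spherical `r²` and the weight `1/r` leave. The upper limit is where the base of the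
power vanishes. -/
theorem lintegral_mul_sub_pow (j : ℕ) {D g σ : ℝ} (hD : 0 < D) (hg : 0 < g) (hσ : 0 < σ) :
    ∫⁻ r in Set.Ioo 0 (D / (2 * g)), ENNReal.ofReal (r * σ * (D - 2 * r * g) ^ j) =
      ENNReal.ofReal (1 / (4 * (j + 1) * (j + 2))) * ENNReal.ofReal (D ^ (j + 2) * (σ / g ^ 2)) := by
  have hc : Continuous fun r => r * σ * (D - 2 * r * g) ^ j := by fun_prop
  have hF : ∀ r, HasDerivAt (fun r => σ / (4 * g ^ 2) * ((D - 2 * r * g) ^ (j + 2) / (j + 2) -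
      D * ((D - 2 * r * g) ^ (j + 1) / (j + 1)))) (r * σ * (D - 2 * r * g) ^ j) r := by
    intro r
    have h0 : HasDerivAt (fun r => D - 2 * r * g) (-(2 * g)) r := by
      simpa using (((hasDerivAt_id r).const_mul 2).mul_const g).const_sub D
    have h1 := (h0.pow (j + 2)).div_const ((j : ℝ) + 2)
    have h2 := ((h0.pow (j + 1)).div_const ((j : ℝ) + 1)).const_mul D
    refine ((h1.sub h2).const_mul (σ / (4 * g ^ 2))).congr_deriv ?_
    have : (j : ℝ) + 1 ≠ 0 := by positivity
    have : (j : ℝ) + 2 ≠ 0 := by positivity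
    simp only [Nat.add_sub_cancel, show j + 2 - 1 = j + 1 by omega]
    push_cast
    field_simp
    ring
  have hle : (0 : ℝ) ≤ D / (2 * g) := by positivity
  have hint := intervalIntegral.integral_eq_sub_of_hasDerivAt (a := 0) (b := D / (2 * g))
    (fun r _ => hF r) (hc.intervalIntegrable _ _)
  rw [intervalIntegral.integral_of_le hle, integral_Ioc_eq_integral_Ioo] at hint
  rw [← ofReal_integral_eq_lintegral_ofReal, hint, ← ENNReal.ofReal_mul (by positivity)]
  · congr 1
    have e : D - 2 * (D / (2 * g)) * g = 0 := by field_simp; ring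
    have : (j : ℝ) + 1 ≠ 0 := by positivity
    have : (j : ℝ) + 2 ≠ 0 := by positivity
    rw [e]
    simp only [zero_pow (Nat.succ_ne_zero _), mul_zero, zero_mul, sub_zero, zero_div]
    field_simp
    ring
  · exact (hc.integrableOn_Icc).mono_set Set.Ioo_subset_Icc_self
  · refine (ae_restrict_iff' measurableSet_Ioo).2 (ae_of_all _ fun r hr => ?_)
    have : 0 ≤ D - 2 * r * g := by
      have := (lt_div_iff₀ (by positivity)).1 hr.2
      linarith
    have := hr.1
    simp only [Pi.zero_apply]
    positivity

/-- Removing a null vector `(r, e)` from `(L, s)` changes `L²-|s|²` by a term linear in `r`, since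
the form vanishes on `(r, e)`. The rest of the chain lies in the open forward cone exactly for `r`
below the stated bound. -/
theorem coneWeight_sub {a c r : ℝ} (ha : 0 < a) (hc : |c| < 1) (hr : 0 < r) (L : ℝ) (j : ℕ) :
    coneWeight j √(a ^ 2 - 2 * a * r * c + r ^ 2) (L - r) =
      if a < L ∧ r < (L ^ 2 - a ^ 2) / (2 * (L - a * c)) then
        ENNReal.ofReal ((L ^ 2 - a ^ 2 - 2 * r * (L - a * c)) ^ j) else 0 := by
  obtain ⟨hc1, hc2⟩ := abs_lt.1 hc
  have hq : 0 ≤ a ^ 2 - 2 * a * r * c + r ^ 2 := by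
    nlinarith [sq_nonneg (a - r), mul_pos ha hr]
  have hs := Real.sq_sqrt hq
  rw [coneWeight, hs]
  have hiff : √(a ^ 2 - 2 * a * r * c + r ^ 2) < L - r ↔
      a < L ∧ r < (L ^ 2 - a ^ 2) / (2 * (L - a * c)) := by
    constructor
    · intro h
      have hb0 := Real.sqrt_nonneg (a ^ 2 - 2 * a * r * c + r ^ 2)
      have hsq : a ^ 2 - 2 * a * r * c + r ^ 2 < (L - r) ^ 2 := by
        rw [← hs]; exact pow_lt_pow_left₀ h hb0 two_ne_zero
      have haL : a < L := by
        by_contra hcon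
        push Not at hcon
        nlinarith [mul_pos ha hr, mul_nonneg hr.le (sub_nonneg.2 hcon)]
      have hg : 0 < L - a * c := by nlinarith
      refine ⟨haL, (lt_div_iff₀ (by positivity)).2 ?_⟩
      linarith
    · rintro ⟨haL, h⟩
      have hg : 0 < L - a * c := by nlinarith
      rw [lt_div_iff₀ (by positivity)] at h
      have hB : 0 < L ^ 2 - 2 * a * c * L + a ^ 2 := by
        nlinarith [sq_nonneg (L - a), mul_pos (mul_pos ha (ha.trans haL)) (sub_pos.2 hc2)]
      have hLr : 0 < L - r := by
        by_contra hcon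
        push Not at hcon
        nlinarith [mul_nonneg hg.le (sub_nonneg.2 (sub_nonpos.1 hcon))]
      rw [Real.sqrt_lt' hLr]
      nlinarith
  simp only [hiff]
  congr 2
  ring

/-- The inductive convolution with one more edge. The exponent rises by two while the angle is kept;
integrating the angle out costs one again, so each edge contributes a net factor `L²-|s|²`. -/
theorem lintegral_edge_coneWeight (j : ℕ) : ∃ C : ℝ≥0∞, C ≠ 0 ∧ C ≠ ∞ ∧ ∀ s : E3, s ≠ 0 →
    ∀ (L : ℝ) (h : ℝ → ℝ≥0∞), Measurable h →
      ∫⁻ e : E3, ENNReal.ofReal ‖e‖⁻¹ * (coneWeight j ‖s - e‖ (L - ‖e‖) *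
        h (InnerProductGeometry.angle s e)) =
      C * (coneWeight (j + 2) ‖s‖ L * aberration ‖s‖ L h) := by
  obtain ⟨K, hK0, hKt, hK⟩ := lintegral_norm_angle
  have hj : (0 : ℝ) < 1 / (4 * (j + 1) * (j + 2)) := by positivity
  refine ⟨K * ENNReal.ofReal (1 / (4 * (j + 1) * (j + 2))), mul_ne_zero hK0 (by simpa using hj),
    ENNReal.mul_ne_top hKt ENNReal.ofReal_ne_top, fun s hs L h hh => ?_⟩
  have ha : 0 < ‖s‖ := norm_pos_iff.2 hs
  have hw : Measurable fun p : ℝ × ℝ =>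
      coneWeight j √(‖s‖ ^ 2 - 2 * ‖s‖ * p.1 * Real.cos p.2 + p.1 ^ 2) (L - p.1) :=
    Measurable.comp (f := fun p : ℝ × ℝ =>
      (√(‖s‖ ^ 2 - 2 * ‖s‖ * p.1 * Real.cos p.2 + p.1 ^ 2), L - p.1))
      (measurable_coneWeight j) (by fun_prop)
  have hG : Measurable fun p : ℝ × ℝ => ENNReal.ofReal p.1⁻¹ *
      (coneWeight j √(‖s‖ ^ 2 - 2 * ‖s‖ * p.1 * Real.cos p.2 + p.1 ^ 2) (L - p.1) * h p.2) := by
    fun_prop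
  simp_rw [norm_sub_eq_sqrt s]
  rw [hK s hs (fun r φ => ENNReal.ofReal r⁻¹ *
      (coneWeight j √(‖s‖ ^ 2 - 2 * ‖s‖ * r * Real.cos φ + r ^ 2) (L - r) * h φ)) hG,
    mul_assoc, aberration, lintegral_lintegral_swap (by fun_prop)]
  congr 1
  have hcw : coneWeight (j + 2) ‖s‖ L ≠ ∞ := by
    rw [coneWeight]; split_ifs <;> simp
  rw [← lintegral_const_mul' _ _ hcw, ← lintegral_const_mul' _ _ ENNReal.ofReal_ne_top]
  refine setLIntegral_congr_fun measurableSet_Ioo fun φ hφ => ?_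
  have hsin := Real.sin_pos_of_pos_of_lt_pi hφ.1 hφ.2
  have hcos : |Real.cos φ| < 1 := by
    rw [← sq_lt_one_iff_abs_lt_one]
    nlinarith [Real.sin_sq_add_cos_sq φ]
  have hint : ∀ r ∈ Set.Ioi (0 : ℝ), ENNReal.ofReal (r ^ 2 * Real.sin φ) * (ENNReal.ofReal r⁻¹ *
      (coneWeight j √(‖s‖ ^ 2 - 2 * ‖s‖ * r * Real.cos φ + r ^ 2) (L - r) * h φ)) =
      (if ‖s‖ < L ∧ r < (L ^ 2 - ‖s‖ ^ 2) / (2 * (L - ‖s‖ * Real.cos φ)) then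
        ENNReal.ofReal (r * Real.sin φ *
          (L ^ 2 - ‖s‖ ^ 2 - 2 * r * (L - ‖s‖ * Real.cos φ)) ^ j) else 0) * h φ := by
    intro r hr
    have hr : 0 < r := hr
    rw [coneWeight_sub ha hcos hr]
    split_ifs
    · rw [← mul_assoc, ← mul_assoc, ← ENNReal.ofReal_mul (by positivity),
        ← ENNReal.ofReal_mul (by positivity)]
      congr 2
      field_simp
    · simp
  rw [setLIntegral_congr_fun measurableSet_Ioi hint]
  by_cases hL : ‖s‖ < L
  · have hD : 0 < L ^ 2 - ‖s‖ ^ 2 := by nlinarith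
    have hg : 0 < L - ‖s‖ * Real.cos φ := by nlinarith [(abs_lt.1 hcos).2]
    have hset : ∀ r : ℝ, (if ‖s‖ < L ∧ r < (L ^ 2 - ‖s‖ ^ 2) / (2 * (L - ‖s‖ * Real.cos φ)) then
        ENNReal.ofReal (r * Real.sin φ *
          (L ^ 2 - ‖s‖ ^ 2 - 2 * r * (L - ‖s‖ * Real.cos φ)) ^ j) else 0) * h φ =
        (Set.Iio ((L ^ 2 - ‖s‖ ^ 2) / (2 * (L - ‖s‖ * Real.cos φ)))).indicator (fun r =>
          ENNReal.ofReal (r * Real.sin φ *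
          (L ^ 2 - ‖s‖ ^ 2 - 2 * r * (L - ‖s‖ * Real.cos φ)) ^ j) * h φ) r := by
      intro r
      simp only [hL, true_and, Set.indicator, Set.mem_Iio, ite_mul, zero_mul]
    simp_rw [hset]
    rw [setLIntegral_indicator measurableSet_Iio, Set.inter_comm, Set.Ioi_inter_Iio,
      lintegral_mul_const _ (by fun_prop), lintegral_mul_sub_pow j hD hg hsin, coneWeight, if_pos hL,
      ENNReal.ofReal_mul (by positivity)]
    ring
  · simp [coneWeight, hL]

theorem aberration_const {a L : ℝ} (ha : 0 ≤ a) (hL : a < L) (c : ℝ≥0∞) :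
    aberration a L (fun _ => c) = ENNReal.ofReal (2 / (L ^ 2 - a ^ 2)) * c := by
  rw [aberration, lintegral_sin_div_sq ha hL (fun _ => c), lintegral_mul_const _ (by fun_prop),
    lintegral_two_mul_div_sq, one_mul]

/-- The aberration density has total mass `2/(L²-a²)`, which lowers the exponent by one. -/
theorem coneWeight_succ_mul_aberration_const {a L : ℝ} (ha : 0 ≤ a) (k : ℕ) (c : ℝ≥0∞) :
    coneWeight (k + 1) a L * aberration a L (fun _ => c) = 2 * (coneWeight k a L * c) := by
  by_cases hL : a < L
  · have hD : 0 < L ^ 2 - a ^ 2 := by nlinarith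
    rw [aberration_const ha hL, coneWeight, coneWeight, if_pos hL, if_pos hL, ← mul_assoc,
      ← mul_assoc, ← ENNReal.ofReal_mul (by positivity)]
    congr 1
    rw [← ENNReal.ofReal_ofNat 2, ← ENNReal.ofReal_mul (by positivity)]
    congr 1
    field_simp
    ring
  · simp [coneWeight, hL]

/-- The density of the angle between the sum of a chain and one of its edges, jointly with the sum
and the total length. -/
def ChainAngleLaw (k : ℕ) : Prop := ∀ i : Fin (k + 2), ∃ C : ℝ≥0∞, C ≠ 0 ∧ C ≠ ∞ ∧
  ∀ h : E3 → ℝ → ℝ → ℝ≥0∞, Measurable (fun p : E3 × ℝ × ℝ => h p.1 p.2.1 p.2.2) →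
    ∫⁻ x : Fin (k + 2) → E3, (∏ j, ENNReal.ofReal ‖x j‖⁻¹) *
      h (∑ j, x j) (∑ j, ‖x j‖) (InnerProductGeometry.angle (∑ j, x j) (x i)) =
    C * ∫⁻ s, ∫⁻ L, coneWeight (k + 1) ‖s‖ L * aberration ‖s‖ L (h s L)

/-- The law of sum and length alone, obtained by forgetting the angle of an arbitrarily chosen edge.
-/
theorem ChainAngleLaw.sum_length {k : ℕ} (H : ChainAngleLaw k) : ∃ C : ℝ≥0∞, C ≠ 0 ∧ C ≠ ∞ ∧
    ∀ h : E3 → ℝ → ℝ≥0∞, Measurable (fun p : E3 × ℝ => h p.1 p.2) →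
      ∫⁻ x : Fin (k + 2) → E3, (∏ j, ENNReal.ofReal ‖x j‖⁻¹) * h (∑ j, x j) (∑ j, ‖x j‖) =
      C * ∫⁻ s, ∫⁻ L, coneWeight k ‖s‖ L * h s L := by
  obtain ⟨C, hC0, hCt, hC⟩ := H 0
  refine ⟨C * 2, mul_ne_zero hC0 two_ne_zero, ENNReal.mul_ne_top hCt (by simp), fun h hh => ?_⟩
  rw [hC (fun s L _ => h s L) (by fun_prop)]
  simp_rw [coneWeight_succ_mul_aberration_const (norm_nonneg _)]
  simp_rw [lintegral_const_mul' _ _ (ENNReal.ofNat_ne_top (n := 2))]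
  rw [mul_assoc]

theorem chainAngleLaw_zero : ChainAngleLaw 0 := by
  intro i
  obtain ⟨C, hC0, hCt, hC⟩ := lintegral_two_edges
  refine ⟨C, hC0, hCt, fun h hh => ?_⟩
  have hang : Measurable fun p : E3 × E3 => InnerProductGeometry.angle p.1 p.2 :=
    measurable_angle measurable_fst measurable_snd
  have hang' : Measurable fun x : Fin 2 → E3 => InnerProductGeometry.angle (∑ j, x j) (x i) :=
    measurable_angle (by fun_prop) (by fun_prop)
  have hang1 : ∀ e : E3, Measurable fun y : E3 => InnerProductGeometry.angle (e + y) e := fun e =>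
    measurable_angle (by fun_prop) (by fun_prop)
  rw [lintegral_pi_insertNth i (by fun_prop)]
  have e1 : ∀ e : E3, ∫⁻ y : Fin 1 → E3,
      (∏ j, ENNReal.ofReal ‖i.insertNth (α := fun _ => E3) e y j‖⁻¹) *
      h (∑ j, i.insertNth (α := fun _ => E3) e y j) (∑ j, ‖i.insertNth (α := fun _ => E3) e y j‖)
        (InnerProductGeometry.angle (∑ j, i.insertNth (α := fun _ => E3) e y j)
          (i.insertNth (α := fun _ => E3) e y i)) =
      ∫⁻ s, ENNReal.ofReal ‖e‖⁻¹ * (ENNReal.ofReal ‖s - e‖⁻¹ *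
        h s (‖e‖ + ‖s - e‖) (InnerProductGeometry.angle s e)) := by
    intro e
    simp only [Fin.prod_univ_succAbove _ i, Fin.sum_univ_succAbove _ i, Fin.insertNth_apply_same,
      Fin.insertNth_apply_succAbove, Finset.univ_unique, Finset.prod_singleton,
      Finset.sum_singleton, Fin.default_eq_zero]
    have h1 := (volume_preserving_funUnique (Fin 1) E3).lintegral_comp
      (f := fun y => ENNReal.ofReal ‖e‖⁻¹ * ENNReal.ofReal ‖y‖⁻¹ *
        h (e + y) (‖e‖ + ‖y‖) (InnerProductGeometry.angle (e + y) e)) (by fun_prop)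
    refine h1.trans ?_
    -- Translation makes the sum `s = e + y` the variable, so that the second edge is `s - e`.
    rw [← lintegral_sub_right_eq_self _ e]
    simp only [add_sub_cancel, mul_assoc]
  simp_rw [e1]
  rw [lintegral_lintegral_swap (by fun_prop), ← lintegral_const_mul' _ _ hCt]
  refine lintegral_congr_ae ?_
  filter_upwards [compl_mem_ae_iff.2 (measure_singleton (0 : E3))] with s hs
  exact hC s hs (h s) (by fun_prop)

/-- Edge `i` is split off, the other edges enter only through their sum and length, and both are
translated to those of the whole chain. Any `i` can be split off, so the law holds for every edge
without a symmetry argument. -/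
theorem ChainAngleLaw.succ {k : ℕ} (H : ChainAngleLaw k) : ChainAngleLaw (k + 1) := by
  intro i
  obtain ⟨C, hC0, hCt, hC⟩ := H.sum_length
  obtain ⟨D, hD0, hDt, hD⟩ := lintegral_edge_coneWeight k
  refine ⟨C * D, mul_ne_zero hC0 hD0, ENNReal.mul_ne_top hCt hDt, fun h hh => ?_⟩
  have hang : Measurable fun p : E3 × E3 => InnerProductGeometry.angle p.1 p.2 :=
    measurable_angle measurable_fst measurable_snd
  have hang' : Measurable fun x : Fin (k + 3) → E3 =>
      InnerProductGeometry.angle (∑ j, x j) (x i) := measurable_angle (by fun_prop) (by fun_prop)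
  have hang1 : ∀ e : E3, Measurable fun y : E3 => InnerProductGeometry.angle (e + y) e := fun e =>
    measurable_angle (by fun_prop) (by fun_prop)
  have hcw := measurable_coneWeight k
  have hcw1 : Measurable fun p : E3 × ℝ => coneWeight k ‖p.1‖ p.2 :=
    Measurable.comp (f := fun p : E3 × ℝ => (‖p.1‖, p.2)) hcw (by fun_prop)
  have hcw2 : Measurable fun p : (E3 × E3) × ℝ => coneWeight k ‖p.1.2 - p.1.1‖ (p.2 - ‖p.1.1‖) :=
    Measurable.comp (f := fun p : (E3 × E3) × ℝ => (‖p.1.2 - p.1.1‖, p.2 - ‖p.1.1‖)) hcw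
      (by fun_prop)
  rw [lintegral_pi_insertNth i (by fun_prop)]
  have e1 : ∀ e : E3, ∫⁻ y : Fin (k + 2) → E3,
      (∏ j, ENNReal.ofReal ‖i.insertNth (α := fun _ => E3) e y j‖⁻¹) *
      h (∑ j, i.insertNth (α := fun _ => E3) e y j) (∑ j, ‖i.insertNth (α := fun _ => E3) e y j‖)
        (InnerProductGeometry.angle (∑ j, i.insertNth (α := fun _ => E3) e y j)
          (i.insertNth (α := fun _ => E3) e y i)) =
      C * ∫⁻ s, ∫⁻ L, ENNReal.ofReal ‖e‖⁻¹ * (coneWeight k ‖s - e‖ (L - ‖e‖) *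
        h s L (InnerProductGeometry.angle s e)) := by
    intro e
    simp only [Fin.prod_univ_succAbove _ i, Fin.sum_univ_succAbove _ i, Fin.insertNth_apply_same,
      Fin.insertNth_apply_succAbove, mul_assoc]
    rw [lintegral_const_mul' _ _ ENNReal.ofReal_ne_top, hC (fun s L => h (e + s) (‖e‖ + L)
      (InnerProductGeometry.angle (e + s) e)) (by fun_prop),
      ← lintegral_sub_right_eq_self _ e, mul_left_comm]
    congr 1
    simp_rw [lintegral_const_mul' _ _ (ENNReal.ofReal_ne_top (r := ‖e‖⁻¹))]
    congr 1
    refine lintegral_congr fun s => ?_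
    rw [← lintegral_sub_right_eq_self _ ‖e‖]
    simp only [add_sub_cancel]
  simp_rw [e1]
  rw [lintegral_const_mul' _ _ hCt, mul_assoc]
  congr 1
  have hm : Measurable fun p : (E3 × E3) × ℝ => ENNReal.ofReal ‖p.1.1‖⁻¹ *
      (coneWeight k ‖p.1.2 - p.1.1‖ (p.2 - ‖p.1.1‖) *
        h p.1.2 p.2 (InnerProductGeometry.angle p.1.2 p.1.1)) := by fun_prop
  rw [lintegral_lintegral_swap (Measurable.lintegral_prod_right' hm).aemeasurable,
    ← lintegral_const_mul' _ _ hDt]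
  refine lintegral_congr_ae ?_
  filter_upwards [compl_mem_ae_iff.2 (measure_singleton (0 : E3))] with s hs
  have hm' : Measurable (Function.uncurry fun (e : E3) (L : ℝ) => ENNReal.ofReal ‖e‖⁻¹ *
      (coneWeight k ‖s - e‖ (L - ‖e‖) * h s L (InnerProductGeometry.angle s e))) :=
    Measurable.comp (f := fun p : E3 × ℝ => ((p.1, s), p.2)) hm (by fun_prop)
  rw [lintegral_lintegral_swap hm'.aemeasurable, ← lintegral_const_mul' _ _ hDt]
  refine lintegral_congr fun L => ?_
  exact hD s hs L (h s L) (by fun_prop)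

theorem chainAngleLaw (k : ℕ) : ChainAngleLaw k := by
  induction k with
  | zero => exact chainAngleLaw_zero
  | succ k ih => exact ih.succ

/-! ### The expected turning angle for the closed chain -/

theorem lintegral_pow_mul_exp (p : ℕ) {b : ℝ} (hb : 0 < b) :
    ∫⁻ t in Set.Ioi (0 : ℝ), ENNReal.ofReal (t ^ p * Real.exp (-(b * t))) =
      ENNReal.ofReal (p.factorial * (1 / b) ^ (p + 1)) := by
  have h := Real.integral_rpow_mul_exp_neg_mul_Ioi (a := p + 1) (by positivity) hb
  have h' : ∫ t in Set.Ioi (0 : ℝ), t ^ p * Real.exp (-(b * t)) =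
      p.factorial * (1 / b) ^ (p + 1) := by
    rw [Real.Gamma_nat_eq_factorial] at h
    rw [mul_comm, ← Real.rpow_natCast (1 / b) (p + 1)]
    push_cast
    rw [← h]
    refine setIntegral_congr_fun measurableSet_Ioi fun t ht => ?_
    simp
  rw [← h', ofReal_integral_eq_lintegral_ofReal]
  -- A non-integrable function would have integral zero, whereas the known value is positive.
  · refine not_imp_comm.1 integral_undef ?_
    rw [h']
    positivity
  · refine (ae_restrict_iff' measurableSet_Ioi).2 (ae_of_all _ fun t ht => ?_)
    have ht : 0 < t := ht
    simp only [Pi.zero_apply]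
    positivity

theorem sqrt_boost {a y : ℝ} (ha : 0 < a) (hy : y ∈ Set.Ioo (0 : ℝ) 1) :
    √((a * (1 + y ^ 2) / (1 - y ^ 2) - a) / (a * (1 + y ^ 2) / (1 - y ^ 2) + a)) = y := by
  have : 0 < 1 - y ^ 2 := by nlinarith [hy.1, hy.2]
  have e : (a * (1 + y ^ 2) / (1 - y ^ 2) - a) / (a * (1 + y ^ 2) / (1 - y ^ 2) + a) = y ^ 2 := by
    rw [div_eq_iff (by positivity)]
    field_simp
    ring
  rw [e, Real.sqrt_sq hy.1.le]

/-- The inverse of `y = √((L-a)/(L+a))` is `L = a(1+y²)/(1-y²)`. It makes `(a+L)/2 = a/(1-y²)`, so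
the exponential becomes linear in `a` for fixed `y`. -/
theorem lintegral_Ioi_boost {a : ℝ} (ha : 0 < a) (F : ℝ → ℝ≥0∞) :
    ∫⁻ L in Set.Ioi a, F L = ∫⁻ y in Set.Ioo (0 : ℝ) 1,
      ENNReal.ofReal (4 * a * y / (1 - y ^ 2) ^ 2) * F (a * (1 + y ^ 2) / (1 - y ^ 2)) := by
  have hpos : ∀ y ∈ Set.Ioo (0 : ℝ) 1, 0 < 1 - y ^ 2 := fun y hy => by nlinarith [hy.1, hy.2]
  have him : (fun y => a * (1 + y ^ 2) / (1 - y ^ 2)) '' Set.Ioo 0 1 = Set.Ioi a := by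
    ext L
    constructor
    · rintro ⟨y, hy, rfl⟩
      have := hpos y hy
      show a < a * (1 + y ^ 2) / (1 - y ^ 2)
      rw [lt_div_iff₀ this]
      nlinarith [hy.1, mul_pos ha (pow_pos hy.1 2)]
    · intro hL
      have hL : a < L := hL
      have h1 : 0 < (L - a) / (L + a) := div_pos (by linarith) (by linarith)
      have h2 : (L - a) / (L + a) < 1 := by rw [div_lt_one (by linarith)]; linarith
      refine ⟨√((L - a) / (L + a)), ⟨Real.sqrt_pos.2 h1, ?_⟩, ?_⟩
      · rw [Real.sqrt_lt' one_pos]; simpa using h2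
      · simp only [Real.sq_sqrt h1.le]
        have : 0 < L + a := by linarith
        rw [div_eq_iff (by linarith)]
        field_simp
        ring
  rw [← him, lintegral_image_eq_lintegral_abs_deriv_mul measurableSet_Ioo
    (f' := fun y => 4 * a * y / (1 - y ^ 2) ^ 2) (fun y hy => ?_) (fun x hx y hy hxy => ?_)]
  · refine setLIntegral_congr_fun measurableSet_Ioo fun y hy => ?_
    have := hpos y hy
    have := hy.1
    rw [abs_of_nonneg (by positivity)]
  · have h0 := hpos y hy
    have h1 : HasDerivAt (fun y => a * (1 + y ^ 2)) (a * (2 * y)) y := by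
      simpa using ((hasDerivAt_pow 2 y).const_add 1).const_mul a
    have h2 : HasDerivAt (fun y => 1 - y ^ 2) (-(2 * y)) y := by
      simpa using (hasDerivAt_pow 2 y).const_sub 1
    refine ((h1.div h2 h0.ne').congr_deriv ?_).hasDerivWithinAt
    field_simp
    ring
  · have hxy : a * (1 + x ^ 2) / (1 - x ^ 2) = a * (1 + y ^ 2) / (1 - y ^ 2) := hxy
    rw [← sqrt_boost ha hx, hxy, sqrt_boost ha hy]

/-- In the variables `(a, y)` the integrand is `a^(2k+2) exp(-a/(1-y²))` times a function of `y`.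
The Gamma integral over `a` produces `(1-y²)^(2k+3)`, which all but cancels the denominator
`(1-y²)^(2k+2)`. -/
theorem lintegral_boost (k : ℕ) (g : ℝ → ℝ≥0∞) (hg : Measurable g) :
    ∫⁻ a in Set.Ioi (0 : ℝ), ENNReal.ofReal a * ∫⁻ L in Set.Ioi a,
      ENNReal.ofReal ((L ^ 2 - a ^ 2) ^ k) * (ENNReal.ofReal (Real.exp (-(a + L) / 2)) *
        g √((L - a) / (L + a))) =
    ENNReal.ofReal (4 ^ (k + 1) * (2 * k + 2).factorial) *
      ∫⁻ y in Set.Ioo (0 : ℝ) 1, ENNReal.ofReal ((1 - y ^ 2) * y ^ (2 * k + 1)) * g y := by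
  have hpos : ∀ y ∈ Set.Ioo (0 : ℝ) 1, 0 < 1 - y ^ 2 := fun y hy => by nlinarith [hy.1, hy.2]
  have e1 : ∀ a ∈ Set.Ioi (0 : ℝ), ENNReal.ofReal a * ∫⁻ L in Set.Ioi a,
      ENNReal.ofReal ((L ^ 2 - a ^ 2) ^ k) * (ENNReal.ofReal (Real.exp (-(a + L) / 2)) *
        g √((L - a) / (L + a))) =
      ∫⁻ y in Set.Ioo (0 : ℝ) 1, ENNReal.ofReal (a ^ (2 * k + 2) *
        Real.exp (-((1 - y ^ 2)⁻¹ * a))) *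
        (ENNReal.ofReal (4 ^ (k + 1) * y ^ (2 * k + 1) / (1 - y ^ 2) ^ (2 * k + 2)) * g y) := by
    intro a ha
    have ha : 0 < a := ha
    rw [lintegral_Ioi_boost ha, ← lintegral_const_mul' _ _ ENNReal.ofReal_ne_top]
    refine setLIntegral_congr_fun measurableSet_Ioo fun y hy => ?_
    have hy1 := hpos y hy
    have hy0 := hy.1
    have e2 : (a * (1 + y ^ 2) / (1 - y ^ 2)) ^ 2 - a ^ 2 = 4 * a ^ 2 * y ^ 2 / (1 - y ^ 2) ^ 2 := by
      field_simp
      ring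
    have e3 : -(a + a * (1 + y ^ 2) / (1 - y ^ 2)) / 2 = -((1 - y ^ 2)⁻¹ * a) := by
      field_simp
      ring
    rw [sqrt_boost ha hy, e2, e3]
    simp only [← mul_assoc]
    congr 1
    simp only [← ENNReal.ofReal_mul' (show 0 ≤ 4 * a * y / (1 - y ^ 2) ^ 2 by positivity),
      ← ENNReal.ofReal_mul' (show 0 ≤ (4 * a ^ 2 * y ^ 2 / (1 - y ^ 2) ^ 2) ^ k by positivity),
      ← ENNReal.ofReal_mul' (Real.exp_nonneg _),
      ← ENNReal.ofReal_mul' (show 0 ≤ 4 ^ (k + 1) * y ^ (2 * k + 1) / (1 - y ^ 2) ^ (2 * k + 2) by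
        positivity)]
    congr 1
    generalize Real.exp (-((1 - y ^ 2)⁻¹ * a)) = E
    generalize 1 - y ^ 2 = q at hy1 ⊢
    rw [div_pow, mul_pow, mul_pow, ← pow_mul, ← pow_mul, ← pow_mul]
    field_simp
    ring
  rw [setLIntegral_congr_fun measurableSet_Ioi e1, lintegral_lintegral_swap (by fun_prop),
    ← lintegral_const_mul' _ _ ENNReal.ofReal_ne_top]
  refine setLIntegral_congr_fun measurableSet_Ioo fun y hy => ?_
  have hy1 := hpos y hy
  have hy0 := hy.1
  rw [lintegral_mul_const _ (by fun_prop), lintegral_pow_mul_exp _ (by positivity), ← mul_assoc,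
    ← mul_assoc, ← ENNReal.ofReal_mul (by positivity), ← ENNReal.ofReal_mul (by positivity)]
  congr 2
  generalize 1 - y ^ 2 = q at hy1 ⊢
  rw [one_div, inv_inv]
  field_simp
  ring

theorem lintegral_beta (p : ℕ) :
    ∫⁻ y in Set.Ioo (0 : ℝ) 1, ENNReal.ofReal ((1 - y ^ 2) * y ^ p) =
      ENNReal.ofReal (2 / ((p + 1) * (p + 3))) := by
  have hc : Continuous fun y : ℝ => (1 - y ^ 2) * y ^ p := by fun_prop
  have hF : ∀ y : ℝ, HasDerivAt (fun y : ℝ => y ^ (p + 1) / (p + 1) - y ^ (p + 3) / (p + 3))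
      ((1 - y ^ 2) * y ^ p) y := by
    intro y
    have h1 := (hasDerivAt_pow (p + 1) y).div_const ((p : ℝ) + 1)
    have h2 := (hasDerivAt_pow (p + 3) y).div_const ((p : ℝ) + 3)
    refine (h1.sub h2).congr_deriv ?_
    have : (p : ℝ) + 1 ≠ 0 := by positivity
    have : (p : ℝ) + 3 ≠ 0 := by positivity
    simp only [Nat.add_sub_cancel, show p + 3 - 1 = p + 2 by omega]
    push_cast
    field_simp
    ring
  have hint := intervalIntegral.integral_eq_sub_of_hasDerivAt (a := 0) (b := 1)
    (fun r _ => hF r) (hc.intervalIntegrable _ _)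
  rw [intervalIntegral.integral_of_le zero_le_one, integral_Ioc_eq_integral_Ioo] at hint
  rw [← ofReal_integral_eq_lintegral_ofReal, hint]
  · congr 1
    have : (p : ℝ) + 1 ≠ 0 := by positivity
    have : (p : ℝ) + 3 ≠ 0 := by positivity
    simp only [one_pow, zero_pow (Nat.succ_ne_zero _)]
    field_simp
    ring
  · exact (hc.integrableOn_Icc).mono_set Set.Ioo_subset_Icc_self
  · refine (ae_restrict_iff' measurableSet_Ioo).2 (ae_of_all _ fun y hy => ?_)
    have h0 : 0 ≤ 1 - y ^ 2 := by nlinarith [hy.1, hy.2]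
    have := hy.1
    simp only [Pi.zero_apply]
    positivity

/-- Division by `1 + y` turns the weight `1 - y²` into `1 - y`, so the integrand is again a
polynomial. -/
theorem lintegral_beta_angle (p : ℕ) :
    ∫⁻ y in Set.Ioo (0 : ℝ) 1, ENNReal.ofReal ((1 - y ^ 2) * y ^ p) *
      ENNReal.ofReal (Real.pi / (1 + y)) = ENNReal.ofReal (Real.pi / ((p + 1) * (p + 2))) := by
  have hc : Continuous fun y : ℝ => Real.pi * ((1 - y) * y ^ p) := by fun_prop
  have hF : ∀ y : ℝ, HasDerivAt
      (fun y : ℝ => Real.pi * (y ^ (p + 1) / (p + 1) - y ^ (p + 2) / (p + 2)))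
      (Real.pi * ((1 - y) * y ^ p)) y := by
    intro y
    have h1 := (hasDerivAt_pow (p + 1) y).div_const ((p : ℝ) + 1)
    have h2 := (hasDerivAt_pow (p + 2) y).div_const ((p : ℝ) + 2)
    refine ((h1.sub h2).const_mul Real.pi).congr_deriv ?_
    have : (p : ℝ) + 1 ≠ 0 := by positivity
    have : (p : ℝ) + 2 ≠ 0 := by positivity
    simp only [Nat.add_sub_cancel, show p + 2 - 1 = p + 1 by omega]
    push_cast
    field_simp
    ring
  have hint := intervalIntegral.integral_eq_sub_of_hasDerivAt (a := 0) (b := 1)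
    (fun r _ => hF r) (hc.intervalIntegrable _ _)
  rw [intervalIntegral.integral_of_le zero_le_one, integral_Ioc_eq_integral_Ioo] at hint
  have e : ∀ y ∈ Set.Ioo (0 : ℝ) 1, ENNReal.ofReal ((1 - y ^ 2) * y ^ p) *
      ENNReal.ofReal (Real.pi / (1 + y)) = ENNReal.ofReal (Real.pi * ((1 - y) * y ^ p)) := by
    intro y hy
    have h0 : 0 ≤ 1 - y ^ 2 := by nlinarith [hy.1, hy.2]
    have := hy.1
    rw [← ENNReal.ofReal_mul (by positivity)]
    congr 1
    field_simp
    ring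
  rw [setLIntegral_congr_fun measurableSet_Ioo e, ← ofReal_integral_eq_lintegral_ofReal, hint]
  · congr 1
    have : (p : ℝ) + 1 ≠ 0 := by positivity
    have : (p : ℝ) + 2 ≠ 0 := by positivity
    simp only [one_pow, zero_pow (Nat.succ_ne_zero _)]
    field_simp
    ring
  · exact (hc.integrableOn_Icc).mono_set Set.Ioo_subset_Icc_self
  · refine (ae_restrict_iff' measurableSet_Ioo).2 (ae_of_all _ fun y hy => ?_)
    have h0 : 0 ≤ 1 - y := by linarith [hy.2]
    have := hy.1
    simp only [Pi.zero_apply]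
    positivity

/-! ### The closed chain with Yukawa edges -/

/-- The density of a single edge, up to a constant: the Yukawa potential. -/
def yukawa (e : E3) : ℝ≥0∞ := ENNReal.ofReal ‖e‖⁻¹ * ENNReal.ofReal (Real.exp (-‖e‖ / 2))

@[fun_prop]
theorem measurable_yukawa : Measurable yukawa := by unfold yukawa; fun_prop

theorem prod_yukawa {m : ℕ} (x : Fin m → E3) : ∏ j, yukawa (x j) =
    (∏ j, ENNReal.ofReal ‖x j‖⁻¹) * ENNReal.ofReal (Real.exp (-(∑ j, ‖x j‖) / 2)) := by
  simp only [yukawa]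
  rw [Finset.prod_mul_distrib, ← ENNReal.ofReal_prod_of_nonneg fun _ _ => (Real.exp_nonneg _),
    ← Real.exp_sum]
  simp only [neg_div, Finset.sum_div, Finset.sum_neg_distrib]

/-- The full law of the angle at the closing edge `-∑ x_j`: the chain law, the aberration formula
and the radial integral combined. Taking `F` constant gives the normalization and `F` the identity
gives the mean, with the same `C`. -/
theorem lintegral_closed_chain (k : ℕ) (i : Fin (k + 2)) : ∃ C : ℝ≥0∞, C ≠ 0 ∧ C ≠ ∞ ∧
    ∀ F : ℝ → ℝ≥0∞, Measurable F →
      ∫⁻ x : Fin (k + 2) → E3, yukawa (∑ j, x j) * (∏ j, yukawa (x j)) *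
        F (InnerProductGeometry.angle (-∑ j, x j) (x i)) =
      C * ∫⁻ y in Set.Ioo (0 : ℝ) 1, ENNReal.ofReal ((1 - y ^ 2) * y ^ (2 * k + 1)) *
        ∫⁻ t in Set.Ioi (0 : ℝ), ENNReal.ofReal (2 * t / (1 + t ^ 2) ^ 2) *
          F (2 * Real.arctan (t / y)) := by
  obtain ⟨C, hC0, hCt, hC⟩ := chainAngleLaw k i
  obtain ⟨D, hD0, hDt, hD⟩ := lintegral_fun_norm (volume : Measure E3)
  have h4 : (0 : ℝ) < 4 ^ (k + 1) * (2 * k + 2).factorial := by positivity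
  refine ⟨C * (D * (2 * ENNReal.ofReal (4 ^ (k + 1) * (2 * k + 2).factorial))), ?_, ?_,
    fun F hF => ?_⟩
  · exact mul_ne_zero hC0 (mul_ne_zero hD0 (mul_ne_zero two_ne_zero (ENNReal.ofReal_pos.2 h4).ne'))
  · exact ENNReal.mul_ne_top hCt (ENNReal.mul_ne_top hDt (ENNReal.mul_ne_top (by simp)
      ENNReal.ofReal_ne_top))
  set g : ℝ → ℝ≥0∞ := fun y => ∫⁻ t in Set.Ioi (0 : ℝ), ENNReal.ofReal (2 * t / (1 + t ^ 2) ^ 2) *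
    F (2 * Real.arctan (t / y)) with hgdef
  have hg : Measurable g := by
    have : Measurable Real.arctan := Real.continuous_arctan.measurable
    exact Measurable.lintegral_prod_right' (f := fun p : ℝ × ℝ =>
      ENNReal.ofReal (2 * p.2 / (1 + p.2 ^ 2) ^ 2) * F (2 * Real.arctan (p.2 / p.1))) (by fun_prop)
  -- Reversing the sum replaces its angle with an edge by the supplement, and the exponentials of
  -- all edges combine into `exp(-(a+L)/2)`.
  have h1 : ∀ x : Fin (k + 2) → E3, yukawa (∑ j, x j) * (∏ j, yukawa (x j)) *
      F (InnerProductGeometry.angle (-∑ j, x j) (x i)) =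
      (∏ j, ENNReal.ofReal ‖x j‖⁻¹) * (ENNReal.ofReal ‖∑ j, x j‖⁻¹ *
        (ENNReal.ofReal (Real.exp (-(‖∑ j, x j‖ + ∑ j, ‖x j‖) / 2)) *
        F (Real.pi - InnerProductGeometry.angle (∑ j, x j) (x i)))) := by
    intro x
    rw [prod_yukawa, InnerProductGeometry.angle_neg_left, yukawa, neg_add, add_div, Real.exp_add,
      ENNReal.ofReal_mul (Real.exp_nonneg _)]
    ring
  simp_rw [h1]
  rw [hC (fun s L φ => ENNReal.ofReal ‖s‖⁻¹ * (ENNReal.ofReal (Real.exp (-(‖s‖ + L) / 2)) *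
    F (Real.pi - φ))) (by fun_prop), mul_assoc]
  congr 1
  have h2 : ∀ s : E3, ∫⁻ L, coneWeight (k + 1) ‖s‖ L * aberration ‖s‖ L (fun φ =>
      ENNReal.ofReal ‖s‖⁻¹ * (ENNReal.ofReal (Real.exp (-(‖s‖ + L) / 2)) * F (Real.pi - φ))) =
      2 * (ENNReal.ofReal ‖s‖⁻¹ * ∫⁻ L in Set.Ioi ‖s‖, ENNReal.ofReal ((L ^ 2 - ‖s‖ ^ 2) ^ k) *
        (ENNReal.ofReal (Real.exp (-(‖s‖ + L) / 2)) * g √((L - ‖s‖) / (L + ‖s‖)))) := by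
    intro s
    rw [lintegral_coneWeight_mul, ← lintegral_const_mul' _ _ ENNReal.ofReal_ne_top,
      ← lintegral_const_mul' _ _ (by simp)]
    refine setLIntegral_congr_fun measurableSet_Ioi fun L hL => ?_
    have hL : ‖s‖ < L := hL
    have hn := norm_nonneg s
    have hD : 0 < L ^ 2 - ‖s‖ ^ 2 := by nlinarith
    rw [aberration, lintegral_sin_div_sq hn hL (fun θ => ENNReal.ofReal ‖s‖⁻¹ *
      (ENNReal.ofReal (Real.exp (-(‖s‖ + L) / 2)) * F θ))]
    have h0 : ∀ t : ℝ, ENNReal.ofReal (2 * t / (1 + t ^ 2) ^ 2) * (ENNReal.ofReal ‖s‖⁻¹ *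
        (ENNReal.ofReal (Real.exp (-(‖s‖ + L) / 2)) *
          F (2 * Real.arctan (t / √((L - ‖s‖) / (L + ‖s‖)))))) =
        ENNReal.ofReal ‖s‖⁻¹ * ENNReal.ofReal (Real.exp (-(‖s‖ + L) / 2)) *
          (ENNReal.ofReal (2 * t / (1 + t ^ 2) ^ 2) *
            F (2 * Real.arctan (t / √((L - ‖s‖) / (L + ‖s‖))))) := fun t => by ring
    rw [lintegral_congr h0, lintegral_const_mul' _ _
      (ENNReal.mul_ne_top ENNReal.ofReal_ne_top ENNReal.ofReal_ne_top)]
    have h3 : ENNReal.ofReal ((L ^ 2 - ‖s‖ ^ 2) ^ (k + 1)) * ENNReal.ofReal (2 / (L ^ 2 - ‖s‖ ^ 2))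
        = 2 * ENNReal.ofReal ((L ^ 2 - ‖s‖ ^ 2) ^ k) := by
      generalize L ^ 2 - ‖s‖ ^ 2 = q at hD
      rw [← ENNReal.ofReal_ofNat 2, ← ENNReal.ofReal_mul (by positivity),
        ← ENNReal.ofReal_mul (by positivity)]
      congr 1
      field_simp
      ring
    calc _ = ENNReal.ofReal ‖s‖⁻¹ * ENNReal.ofReal (Real.exp (-(‖s‖ + L) / 2)) *
          (ENNReal.ofReal ((L ^ 2 - ‖s‖ ^ 2) ^ (k + 1)) *
            ENNReal.ofReal (2 / (L ^ 2 - ‖s‖ ^ 2))) * g √((L - ‖s‖) / (L + ‖s‖)) := by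
            simp only [hgdef]; ring
      _ = _ := by rw [h3]; ring
  simp_rw [h2]
  rw [lintegral_const_mul' _ _ (by simp)]
  set G : ℝ → ℝ≥0∞ := fun a => ENNReal.ofReal a⁻¹ * ∫⁻ L in Set.Ioi a,
    ENNReal.ofReal ((L ^ 2 - a ^ 2) ^ k) *
        (ENNReal.ofReal (Real.exp (-(a + L) / 2)) * g √((L - a) / (L + a))) with hG
  have hGm : Measurable G := by
    have hcw := measurable_coneWeight k
    simp_rw [hG, ← lintegral_coneWeight_mul]
    refine Measurable.mul (by fun_prop) (Measurable.lintegral_prod_right' (f := fun p : ℝ × ℝ =>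
      coneWeight k p.1 p.2 * (ENNReal.ofReal (Real.exp (-(p.1 + p.2) / 2)) *
        g √((p.2 - p.1) / (p.2 + p.1)))) (by fun_prop))
  have h5 := hD G hGm
  rw [h5]
  -- The spherical Jacobian `r²` and the factor `1/r` of the closing edge leave the weight `r` of
  -- `lintegral_boost`.
  have h6 : ∫⁻ r in Set.Ioi (0 : ℝ), ENNReal.ofReal (r ^ (Module.finrank ℝ E3 - 1)) * G r =
      ENNReal.ofReal (4 ^ (k + 1) * (2 * k + 2).factorial) *
      ∫⁻ y in Set.Ioo (0 : ℝ) 1, ENNReal.ofReal ((1 - y ^ 2) * y ^ (2 * k + 1)) * g y := by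
    rw [← lintegral_boost k g hg]
    refine setLIntegral_congr_fun measurableSet_Ioi fun r hr => ?_
    have hr : 0 < r := hr
    simp only [hG]
    rw [← mul_assoc, ← ENNReal.ofReal_mul (by positivity)]
    congr 2
    simp
    field_simp
  rw [h6]
  ring

/-- The expected turning angle at the closing edge. -/
theorem lintegral_closed_chain_angle (k : ℕ) (i : Fin (k + 2)) : ∃ Z : ℝ≥0∞, Z ≠ 0 ∧ Z ≠ ∞ ∧
    ∫⁻ x : Fin (k + 2) → E3, yukawa (∑ j, x j) * (∏ j, yukawa (x j)) = Z ∧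
    ∫⁻ x : Fin (k + 2) → E3, yukawa (∑ j, x j) * (∏ j, yukawa (x j)) *
        ENNReal.ofReal (InnerProductGeometry.angle (-∑ j, x j) (x i)) =
      Z * ENNReal.ofReal (Real.pi * (k + 2) / (2 * k + 3)) := by
  obtain ⟨C, hC0, hCt, hC⟩ := lintegral_closed_chain k i
  have h1 := hC (fun _ => 1) measurable_const
  have h2 := hC ENNReal.ofReal ENNReal.measurable_ofReal
  simp only [mul_one, lintegral_two_mul_div_sq] at h1
  rw [lintegral_beta] at h1
  rw [setLIntegral_congr_fun measurableSet_Ioo fun y hy => by rw [lintegral_arctan_div hy.1],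
    lintegral_beta_angle] at h2
  refine ⟨_, ?_, ?_, h1, ?_⟩
  · refine mul_ne_zero hC0 ?_
    rw [Ne, ENNReal.ofReal_eq_zero, not_le]
    positivity
  · exact ENNReal.mul_ne_top hCt ENNReal.ofReal_ne_top
  · rw [h2, mul_assoc, ← ENNReal.ofReal_mul (by positivity)]
    congr 2
    push_cast
    field_simp
    ring

/-! ### The Hopf map and Lebesgue measure -/

/-- The identification `(a, b) ↦ a + b 𝐣` of `ℂ²` with the quaternions. -/
def quatFrameEquiv : (ℂ × ℂ) ≃ₗ[ℝ] ℍ[ℝ] where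
  toFun p := ⟨p.1.re, p.1.im, p.2.re, p.2.im⟩
  map_add' p q := rfl
  map_smul' c p := by
    ext <;> simp only [Prod.smul_fst, Prod.smul_snd, Complex.real_smul, Complex.re_ofReal_mul,
      Complex.im_ofReal_mul] <;> rfl
  invFun q := (⟨q.re, q.imI⟩, ⟨q.imJ, q.imK⟩)
  left_inv p := rfl
  right_inv q := rfl

theorem quatFrameEquiv_apply (p : ℂ × ℂ) :
    quatFrameEquiv p = (p.1 : ℍ[ℝ]) + (p.2 : ℍ[ℝ]) * quatJ := by
  have j0 : quatJ.re = 0 := rfl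
  have j1 : quatJ.imI = 0 := rfl
  have j2 : quatJ.imJ = 1 := rfl
  have j3 : quatJ.imK = 0 := rfl
  have e (p : ℂ × ℂ) : quatFrameEquiv p = ⟨p.1.re, p.1.im, p.2.re, p.2.im⟩ := rfl
  ext <;> simp [e, j0, j1, j2, j3]

theorem hopf_quatFrameEquiv (p : ℂ × ℂ) : hopf (quatFrameEquiv p) =
    prodComplexEquiv (‖p.1‖ ^ 2 - ‖p.2‖ ^ 2, 2 * (p.1 * star p.2)) := by
  rw [quatFrameEquiv_apply, hopf_frame, prodComplexEquiv_apply]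
  simp

theorem continuous_hopf : Continuous hopf := by
  have h : hopf = fun q => prodComplexEquiv (‖(quatFrameEquiv.symm q).1‖ ^ 2 -
      ‖(quatFrameEquiv.symm q).2‖ ^ 2,
      2 * ((quatFrameEquiv.symm q).1 * star (quatFrameEquiv.symm q).2)) := by
    ext1 q
    rw [← hopf_quatFrameEquiv, LinearEquiv.apply_symm_apply]
  have h1 : Continuous prodComplexEquiv := prodComplexEquiv.toContinuousLinearEquiv.continuous
  have h2 : Continuous quatFrameEquiv.symm := quatFrameEquiv.symm.toContinuousLinearEquiv.continuous
  rw [h]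
  fun_prop

theorem norm_hopf (q : ℍ[ℝ]) : ‖hopf q‖ = ‖q‖ ^ 2 := by
  obtain ⟨p, rfl⟩ := quatFrameEquiv.surjective q
  have h : ‖quatFrameEquiv p‖ ^ 2 = ‖p.1‖ ^ 2 + ‖p.2‖ ^ 2 := by
    rw [sq, ← Quaternion.normSq_eq_norm_mul_self, Quaternion.normSq_def', Complex.sq_norm,
      Complex.sq_norm, Complex.normSq_apply, Complex.normSq_apply]
    have e (p : ℂ × ℂ) : quatFrameEquiv p = ⟨p.1.re, p.1.im, p.2.re, p.2.im⟩ := rfl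
    simp only [e]
    ring
  rw [h, quatFrameEquiv_apply, norm_hopf_frame]

/-- Conjugation is an isometry, and multiplication by `z` on the real plane has determinant `|z|²`.
-/
theorem lintegral_complex_mul_star {z : ℂ} (hz : z ≠ 0) (F : ℂ → ℝ≥0∞) (hF : Measurable F) :
    ∫⁻ b, F (z * star b) = ENNReal.ofReal (‖z‖ ^ 2)⁻¹ * ∫⁻ ζ, F ζ := by
  have hdet : LinearMap.det (LinearMap.mulLeft ℝ z) = ‖z‖ ^ 2 := by
    have := Algebra.norm_complex_apply z
    rw [Algebra.norm_apply] at this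
    rw [Complex.sq_norm, ← this]
    rfl
  have h := Measure.map_linearMap_addHaar_eq_smul_addHaar (volume : Measure ℂ)
    (f := LinearMap.mulLeft ℝ z) (by rw [hdet]; simpa using hz)
  have h1 : ∫⁻ b, F (z * star b) = ∫⁻ b, F (z * b) :=
    (LinearIsometryEquiv.measurePreserving Complex.conjLIE).lintegral_comp
      (f := fun b => F (z * b)) (by fun_prop)
  have h2 : ∫⁻ b, F (z * b) = ∫⁻ ζ, F ζ ∂(volume.map (LinearMap.mulLeft ℝ z)) :=
    (lintegral_map hF (by
      have : Measurable fun b => z * b := by fun_prop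
      exact this)).symm
  rw [h1, h2, h, lintegral_smul_measure, hdet, abs_of_nonneg (by positivity)]
  rfl

/-- With `ρ = |a|` and `t = |2 a b̄|` fixed, `x = |a|²-|b|²` and `√(x²+t²) = |a|²+|b|²`;
differentiating gives `dx/√(x²+t²) = 2 dρ/ρ`. -/
theorem lintegral_hyperbola {t : ℝ} (ht : 0 < t) (F : ℝ → ℝ≥0∞) :
    ∫⁻ ρ in Set.Ioi (0 : ℝ), ENNReal.ofReal (2 / ρ) * F (ρ ^ 2 - t ^ 2 / (4 * ρ ^ 2)) =
      ∫⁻ x, ENNReal.ofReal (√(x ^ 2 + t ^ 2))⁻¹ * F x := by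
  have hr : ∀ ρ : ℝ, 0 < ρ → √((ρ ^ 2 - t ^ 2 / (4 * ρ ^ 2)) ^ 2 + t ^ 2) =
      ρ ^ 2 + t ^ 2 / (4 * ρ ^ 2) := by
    intro ρ hρ
    rw [← Real.sqrt_sq (x := ρ ^ 2 + t ^ 2 / (4 * ρ ^ 2)) (by positivity)]
    congr 1
    field_simp
    ring
  have him : (fun ρ => ρ ^ 2 - t ^ 2 / (4 * ρ ^ 2)) '' Set.Ioi 0 = Set.univ := by
    refine Set.eq_univ_of_forall fun x => ?_
    have hs : |x| < √(x ^ 2 + t ^ 2) := Real.lt_sqrt_of_sq_lt (by rw [sq_abs]; nlinarith)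
    have hs2 := Real.sq_sqrt (show 0 ≤ x ^ 2 + t ^ 2 by positivity)
    set r := √(x ^ 2 + t ^ 2)
    have hx : 0 < (x + r) / 2 := by linarith [neg_abs_le x]
    refine ⟨√((x + r) / 2), Real.sqrt_pos.2 hx, ?_⟩
    simp only [Real.sq_sqrt hx.le]
    have : 0 < x + r := by linarith
    field_simp
    nlinarith
  rw [← setLIntegral_univ (fun x => ENNReal.ofReal (√(x ^ 2 + t ^ 2))⁻¹ * F x), ← him,
    lintegral_image_eq_lintegral_abs_deriv_mul measurableSet_Ioi
    (f' := fun ρ => 2 * (ρ ^ 2 + t ^ 2 / (4 * ρ ^ 2)) / ρ) (fun ρ hρ => ?_)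
    (fun x hx y hy hxy => ?_)]
  · refine setLIntegral_congr_fun measurableSet_Ioi fun ρ hρ => ?_
    have hρ : 0 < ρ := hρ
    rw [hr ρ hρ, ← mul_assoc, ← ENNReal.ofReal_mul (abs_nonneg _), abs_of_pos (by positivity)]
    congr 2
    field_simp
  · have hρ : 0 < ρ := hρ
    have h1 := (hasDerivAt_pow 2 ρ)
    have h2 := (h1.const_mul 4).inv (by positivity)
    refine ((h1.sub (h2.const_mul (t ^ 2))).congr_deriv ?_).hasDerivWithinAt
    simp only [Nat.cast_ofNat]
    field_simp
    ring
  · have hx : 0 < x := hx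
    have hy : 0 < y := hy
    have hxy : x ^ 2 - t ^ 2 / (4 * x ^ 2) = y ^ 2 - t ^ 2 / (4 * y ^ 2) := hxy
    have h1 := hr x hx
    rw [hxy, hr y hy] at h1
    have h2 : x ^ 2 = y ^ 2 := by linarith
    exact (pow_left_inj₀ hx.le hy.le two_ne_zero).1 h2

/-- The Hopf map takes Lebesgue measure to a multiple of `de / |e|`. -/
theorem lintegral_hopf : ∃ C : ℝ≥0∞, C ≠ 0 ∧ C ≠ ∞ ∧ ∀ G : E3 → ℝ≥0∞, Measurable G →
    ∫⁻ q : ℍ[ℝ], G (hopf q) = C * ∫⁻ e, ENNReal.ofReal ‖e‖⁻¹ * G e := by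
  obtain ⟨c, hc0, hct, hc⟩ := exists_map_linearEquiv_eq_smul quatFrameEquiv
    ((volume : Measure ℂ).prod (volume : Measure ℂ)) (volume : Measure ℍ[ℝ])
  obtain ⟨d, hd0, hdt, hd⟩ := exists_map_linearEquiv_eq_smul prodComplexEquiv.symm
    (volume : Measure E3) ((volume : Measure ℝ).prod (volume : Measure ℂ))
  obtain ⟨f, hf0, hft, hf⟩ := lintegral_fun_norm (volume : Measure ℂ)
  have h8 : ENNReal.ofReal (1 / 8) ≠ 0 := by simp
  refine ⟨c * (f * ENNReal.ofReal (1 / 8) * d), mul_ne_zero hc0 (mul_ne_zero (mul_ne_zero hf0 h8) hd0),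
    ENNReal.mul_ne_top hct (ENNReal.mul_ne_top (ENNReal.mul_ne_top hft ENNReal.ofReal_ne_top) hdt),
    fun G hG => ?_⟩
  have hp : Measurable prodComplexEquiv :=
    prodComplexEquiv.toContinuousLinearEquiv.continuous.measurable
  have hh := continuous_hopf.measurable
  rw [hc _ (by fun_prop)]
  simp_rw [hopf_quatFrameEquiv]
  rw [lintegral_prod _ (by fun_prop), mul_assoc]
  congr 1
  -- For fixed `a ≠ 0`, pass from `b` to `ζ = 2 a b̄`, the complex component of the Hopf vector.
  have e1 : ∀ᵐ a : ℂ, ∫⁻ b : ℂ, G (prodComplexEquiv (‖a‖ ^ 2 - ‖b‖ ^ 2, 2 * (a * star b))) =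
      ∫⁻ ζ : ℂ, ENNReal.ofReal (4 * ‖a‖ ^ 2)⁻¹ *
        G (prodComplexEquiv (‖a‖ ^ 2 - ‖ζ‖ ^ 2 / (4 * ‖a‖ ^ 2), ζ)) := by
    filter_upwards [compl_mem_ae_iff.2 (measure_singleton (0 : ℂ))] with a ha
    have ha' : a ≠ 0 := ha
    have hn : 0 < ‖a‖ := norm_pos_iff.2 ha
    have h := lintegral_complex_mul_star (z := 2 * a) (by simpa using ha')
      (fun ζ => G (prodComplexEquiv (‖a‖ ^ 2 - ‖ζ‖ ^ 2 / (4 * ‖a‖ ^ 2), ζ))) (by fun_prop)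
    rw [← lintegral_const_mul' _ _ ENNReal.ofReal_ne_top] at h
    refine Eq.trans (lintegral_congr fun b => ?_) (h.trans (lintegral_congr fun ζ => ?_))
    · congr 2
      simp only [norm_mul, norm_star, Prod.mk.injEq, mul_assoc, and_true]
      norm_num
      field_simp
      norm_num
    · congr 3
      rw [norm_mul]
      norm_num
      ring
  rw [lintegral_congr_ae e1, lintegral_lintegral_swap (by fun_prop)]
  -- For fixed `ζ` only `|a|` matters and moves the real component along `ℝ`. The constant is `ρ ·
  -- 1/(4ρ²) = (1/8) · (2/ρ)`.
  have e2 : ∀ᵐ ζ : ℂ, ∫⁻ a : ℂ, ENNReal.ofReal (4 * ‖a‖ ^ 2)⁻¹ *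
        G (prodComplexEquiv (‖a‖ ^ 2 - ‖ζ‖ ^ 2 / (4 * ‖a‖ ^ 2), ζ)) =
      f * ENNReal.ofReal (1 / 8) * ∫⁻ x, ENNReal.ofReal ‖prodComplexEquiv (x, ζ)‖⁻¹ *
        G (prodComplexEquiv (x, ζ)) := by
    filter_upwards [compl_mem_ae_iff.2 (measure_singleton (0 : ℂ))] with ζ hζ
    have hn : 0 < ‖ζ‖ := norm_pos_iff.2 hζ
    rw [hf (fun ρ => ENNReal.ofReal (4 * ρ ^ 2)⁻¹ *
        G (prodComplexEquiv (ρ ^ 2 - ‖ζ‖ ^ 2 / (4 * ρ ^ 2), ζ))) (by fun_prop), mul_assoc]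
    simp_rw [norm_prodComplexEquiv]
    rw [← lintegral_hyperbola hn (fun x => G (prodComplexEquiv (x, ζ))),
      ← lintegral_const_mul' _ _ ENNReal.ofReal_ne_top]
    congr 1
    refine setLIntegral_congr_fun measurableSet_Ioi fun ρ hρ => ?_
    have hρ : 0 < ρ := hρ
    rw [← mul_assoc, ← mul_assoc, ← ENNReal.ofReal_mul (by positivity),
      ← ENNReal.ofReal_mul (by positivity)]
    congr 2
    rw [Complex.finrank_real_complex]
    field_simp
    norm_num
    ring
  rw [lintegral_congr_ae e2, lintegral_const_mul' _ _
    (ENNReal.mul_ne_top hft ENNReal.ofReal_ne_top), mul_assoc _ d]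
  congr 1
  have h := hd (fun p => ENNReal.ofReal ‖prodComplexEquiv p‖⁻¹ * G (prodComplexEquiv p))
    (by fun_prop)
  simp only [LinearEquiv.apply_symm_apply] at h
  rw [← h, lintegral_prod_symm _ (by fun_prop)]

/-! ### The density of the Hopf-Gaussian measure -/

theorem lintegral_stdGaussian_euclideanSpace (d : ℕ) : ∃ C : ℝ≥0∞, C ≠ 0 ∧ C ≠ ∞ ∧
    ∀ F : EuclideanSpace ℝ (Fin d) → ℝ≥0∞, Measurable F →
      ∫⁻ x, F x ∂ProbabilityTheory.stdGaussian (EuclideanSpace ℝ (Fin d)) =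
        C * ∫⁻ x, ENNReal.ofReal (Real.exp (-‖x‖ ^ 2 / 2)) * F x := by
  have h2pi : (0 : ℝ) < (√(2 * Real.pi))⁻¹ := by positivity
  refine ⟨ENNReal.ofReal (√(2 * Real.pi))⁻¹ ^ d, pow_ne_zero _ (ENNReal.ofReal_pos.2 h2pi).ne',
    ENNReal.pow_ne_top ENNReal.ofReal_ne_top, fun F hF => ?_⟩
  have hg : ProbabilityTheory.gaussianReal 0 1 =
      (volume : Measure ℝ).withDensity (ProbabilityTheory.gaussianPDF 0 1) :=
    ProbabilityTheory.gaussianReal_of_var_ne_zero 0 one_ne_zero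
  have : SigmaFinite ((volume : Measure ℝ).withDensity (ProbabilityTheory.gaussianPDF 0 1)) := by
    rw [← hg]; infer_instance
  have hm : Measurable fun x : Fin d → ℝ => ∏ i, ProbabilityTheory.gaussianPDF 0 1 (x i) :=
    Finset.measurable_prod _ fun i _ =>
      (ProbabilityTheory.measurable_gaussianPDF 0 1).comp (measurable_pi_apply i)
  rw [← ProbabilityTheory.map_pi_eq_stdGaussian, hg,
    pi_withDensity _ fun _ => ProbabilityTheory.measurable_gaussianPDF 0 1,
    lintegral_map hF (by fun_prop), lintegral_withDensity_eq_lintegral_mul _ hm (by fun_prop),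
    ← (PiLp.volume_preserving_toLp (Fin d)).lintegral_comp (by fun_prop),
    ← lintegral_const_mul' _ _ (ENNReal.pow_ne_top ENNReal.ofReal_ne_top)]
  refine lintegral_congr fun x => ?_
  simp only [Pi.mul_apply]
  rw [← mul_assoc]
  congr 1
  simp only [ProbabilityTheory.gaussianPDF, ProbabilityTheory.gaussianPDFReal]
  rw [EuclideanSpace.norm_sq_eq, ← ENNReal.ofReal_pow (by positivity),
    ← ENNReal.ofReal_prod_of_nonneg fun _ _ => by positivity, ← ENNReal.ofReal_mul (by positivity),
    Finset.prod_mul_distrib, ← Real.exp_sum]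
  simp [neg_div, Finset.sum_div]

theorem lintegral_stdGaussian (E : Type*) [NormedAddCommGroup E] [InnerProductSpace ℝ E]
    [FiniteDimensional ℝ E] [MeasurableSpace E] [BorelSpace E] : ∃ C : ℝ≥0∞, C ≠ 0 ∧ C ≠ ∞ ∧
    ∀ F : E → ℝ≥0∞, Measurable F → ∫⁻ x, F x ∂ProbabilityTheory.stdGaussian E =
        C * ∫⁻ x, ENNReal.ofReal (Real.exp (-‖x‖ ^ 2 / 2)) * F x := by
  obtain ⟨C, hC0, hCt, hC⟩ := lintegral_stdGaussian_euclideanSpace (Module.finrank ℝ E)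
  refine ⟨C, hC0, hCt, fun F hF => ?_⟩
  set R := (stdOrthonormalBasis ℝ E).repr
  have hR : Measurable R.symm := R.symm.continuous.measurable
  rw [← ProbabilityTheory.stdGaussian_map R.symm, lintegral_map hF hR,
    hC (fun x => F (R.symm x)) (by fun_prop), ← R.symm.measurePreserving.lintegral_comp (by fun_prop)]
  simp

theorem lintegral_piLp {E : Type*} [NormedAddCommGroup E] [InnerProductSpace ℝ E]
    [FiniteDimensional ℝ E] [MeasurableSpace E] [BorelSpace E] (n : ℕ) :
    ∃ C : ℝ≥0∞, C ≠ 0 ∧ C ≠ ∞ ∧ ∀ F : PiLp 2 (fun _ : Fin n => E) → ℝ≥0∞, Measurable F →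
      ∫⁻ x, F x = C * ∫⁻ x : Fin n → E, F (WithLp.toLp 2 x) :=
  exists_map_linearEquiv_eq_smul (WithLp.linearEquiv 2 ℝ (Fin n → E)).symm
    (volume : Measure (Fin n → E)) (volume : Measure (PiLp 2 (fun _ : Fin n => E)))

theorem lintegral_pi_hopf (n : ℕ) : ∃ C : ℝ≥0∞, C ≠ 0 ∧ C ≠ ∞ ∧
    ∀ F : (Fin n → E3) → ℝ≥0∞, Measurable F → ∫⁻ q : Fin n → ℍ[ℝ], F (fun i => hopf (q i)) =
      C * ∫⁻ e : Fin n → E3, (∏ i, ENNReal.ofReal ‖e i‖⁻¹) * F e := by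
  obtain ⟨C, hC0, hCt, hC⟩ := lintegral_hopf
  refine ⟨C ^ n, pow_ne_zero _ hC0, ENNReal.pow_ne_top hCt, fun F hF => ?_⟩
  have hh := continuous_hopf.measurable
  have hd : Measurable fun e : E3 => C * ENNReal.ofReal ‖e‖⁻¹ := by fun_prop
  have hmap : (volume : Measure ℍ[ℝ]).map hopf =
      (volume : Measure E3).withDensity (fun e => C * ENNReal.ofReal ‖e‖⁻¹) := by
    refine Measure.ext_of_lintegral _ fun f hf => ?_
    rw [lintegral_map hf hh, hC f hf, lintegral_withDensity_eq_lintegral_mul _ hd hf,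
      ← lintegral_const_mul' _ _ hCt]
    simp [mul_assoc]
  have hsf : SigmaFinite ((volume : Measure E3).withDensity
      (fun e => C * ENNReal.ofReal ‖e‖⁻¹)) :=
    SigmaFinite.withDensity_of_ne_top (ae_of_all _ fun e =>
      ENNReal.mul_ne_top hCt ENNReal.ofReal_ne_top)
  have hsf' : SigmaFinite ((volume : Measure ℍ[ℝ]).map hopf) := by
    rw [hmap]; exact hsf
  have hpi := Measure.pi_map_pi (μ := fun _ : Fin n => (volume : Measure ℍ[ℝ]))
    (f := fun _ => hopf) (fun _ => hh.aemeasurable)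
  rw [← lintegral_map (μ := volume) (g := fun (q : Fin n → ℍ[ℝ]) i => hopf (q i)) hF (by fun_prop),
    volume_pi, hpi]
  simp_rw [hmap]
  rw [pi_withDensity _ fun _ => hd, lintegral_withDensity_eq_lintegral_mul _ (by fun_prop) hF,
    ← lintegral_const_mul' _ _ (ENNReal.pow_ne_top hCt)]
  refine lintegral_congr fun e => ?_
  simp only [Pi.mul_apply]
  rw [Finset.prod_mul_distrib, Finset.prod_const, Finset.card_univ, Fintype.card_fin, mul_assoc]

theorem measurable_hopfArm (n : ℕ) : Measurable (hopfArm (n := n)) := by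
  have hh := continuous_hopf.measurable
  unfold hopfArm
  fun_prop

/-- Since `|q|² = |hopf q|`, the weight `exp(-|q|²/2)` is a function of the edge lengths and passes
through the Hopf map, while Lebesgue measure contributes the factors `1/|e_i|`. -/
theorem hopfGaussianArm_eq_withDensity (n : ℕ) : ∃ C : ℝ≥0∞, C ≠ 0 ∧ C ≠ ∞ ∧
    hopfGaussianArm n = volume.withDensity fun e : Arm n => C * ∏ i, yukawa (e i) := by
  obtain ⟨C₁, hC0, hCt, hC⟩ := lintegral_stdGaussian (QuatSpace n)
  obtain ⟨C₂, hD0, hDt, hD⟩ := lintegral_piLp (E := ℍ[ℝ]) n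
  obtain ⟨C₃, hF0, hFt, hF⟩ := lintegral_pi_hopf n
  obtain ⟨C₄, hG0, hGt, hG⟩ := lintegral_piLp (E := E3) n
  refine ⟨C₁ * (C₂ * (C₃ * C₄⁻¹)), ?_, ?_, ?_⟩
  · exact mul_ne_zero hC0 (mul_ne_zero hD0 (mul_ne_zero hF0 (ENNReal.inv_ne_zero.2 hGt)))
  · exact ENNReal.mul_ne_top hCt (ENNReal.mul_ne_top hDt (ENNReal.mul_ne_top hFt
      (ENNReal.inv_ne_top.2 hG0)))
  refine Measure.ext_of_lintegral _ fun f hf => ?_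
  have hh := continuous_hopf.measurable
  have hm := measurable_hopfArm n
  have hy : Measurable fun e : Arm n => ∏ i, yukawa (e i) := by fun_prop
  rw [hopfGaussianArm, lintegral_map hf hm, hC (fun q => f (hopfArm q)) (hf.comp hm),
    hD _ (by fun_prop)]
  have e1 := hF (fun e => ENNReal.ofReal (Real.exp (-(∑ i, ‖e i‖) / 2)) * f (WithLp.toLp 2 e))
    (by fun_prop)
  simp only [hopfArm, PiLp.norm_sq_eq_of_L2, ← norm_hopf]
  rw [e1, lintegral_withDensity_eq_lintegral_mul _ (by fun_prop) hf, hG _ (by fun_prop)]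
  simp only [Pi.mul_apply, prod_yukawa]
  have e2 : ∀ x : Fin n → E3, C₁ * (C₂ * (C₃ * C₄⁻¹)) * ((∏ j, ENNReal.ofReal ‖x j‖⁻¹) *
      ENNReal.ofReal (Real.exp (-(∑ j, ‖x j‖) / 2))) * f (WithLp.toLp 2 x) =
      C₁ * (C₂ * (C₃ * C₄⁻¹)) * ((∏ j, ENNReal.ofReal ‖x j‖⁻¹) *
      (ENNReal.ofReal (Real.exp (-(∑ j, ‖x j‖) / 2)) * f (WithLp.toLp 2 x))) := fun x => by ring
  simp_rw [e2]
  rw [lintegral_const_mul' _ _ (ENNReal.mul_ne_top hCt (ENNReal.mul_ne_top hDt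
    (ENNReal.mul_ne_top hFt (ENNReal.inv_ne_top.2 hG0))))]
  rw [← mul_assoc C₄, mul_left_comm C₄, mul_left_comm C₄, mul_left_comm C₄,
    ENNReal.mul_inv_cancel hG0 hGt]
  ring

/-! ### The density at a point of continuity -/

/-- The quotient is the mean of `f` over the ball, squeezed between bounds on `f` near `x`. Hence
the limit exists and the upper limit in the definition equals it. -/
theorem pointDensity_withDensity {E : Type*} [NormedAddCommGroup E] [InnerProductSpace ℝ E]
    [FiniteDimensional ℝ E] [MeasurableSpace E] [BorelSpace E] {f : E → ℝ≥0∞} {x : E}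
    (hf : ContinuousAt f x) : pointDensity (volume.withDensity f) x = f x := by
  refine Tendsto.limsup_eq ?_
  have hball : ∀ U ∈ 𝓝 x, ∀ᶠ r in 𝓝[>] (0 : ℝ), Metric.closedBall x r ⊆ U ∧ 0 < r := by
    intro U hU
    obtain ⟨ε, hε, hεU⟩ := Metric.mem_nhds_iff.1 hU
    filter_upwards [Ioo_mem_nhdsGT hε] with r hr
    exact ⟨(Metric.closedBall_subset_ball hr.2).trans hεU, hr.1⟩
  have hv : ∀ r : ℝ, 0 < r → volume (Metric.closedBall x r) ≠ 0 ∧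
      volume (Metric.closedBall x r) ≠ ∞ := fun r hr =>
    ⟨(Metric.measure_closedBall_pos _ _ hr).ne', measure_closedBall_lt_top.ne⟩
  refine tendsto_order.2 ⟨fun a ha => ?_, fun b hb => ?_⟩
  · obtain ⟨a', ha, ha'⟩ := exists_between ha
    filter_upwards [hball _ (hf.eventually (lt_mem_nhds ha'))] with r hr
    obtain ⟨h0, ht⟩ := hv r hr.2
    refine ha.trans_le ?_
    rw [ENNReal.le_div_iff_mul_le (Or.inl h0) (Or.inl ht), ← setLIntegral_const,
      withDensity_apply _ Metric.isClosed_closedBall.measurableSet]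
    exact setLIntegral_mono' Metric.isClosed_closedBall.measurableSet fun y hy => (hr.1 hy).le
  · obtain ⟨b', hb', hb⟩ := exists_between hb
    filter_upwards [hball _ (hf.eventually (gt_mem_nhds hb'))] with r hr
    obtain ⟨h0, ht⟩ := hv r hr.2
    refine lt_of_le_of_lt ?_ hb
    rw [ENNReal.div_le_iff h0 ht, ← setLIntegral_const,
      withDensity_apply _ Metric.isClosed_closedBall.measurableSet]
    exact setLIntegral_mono' Metric.isClosed_closedBall.measurableSet fun y hy => (hr.1 hy).le

/-- Nonvanishing edges are needed: the true density blows up at a zero edge, where `‖0‖⁻¹ = 0` makes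
`yukawa` vanish instead. -/
theorem continuousAt_prod_yukawa {n : ℕ} {C : ℝ≥0∞} (hC : C ≠ ∞) {e : Arm n} (he : ∀ i, e i ≠ 0) :
    ContinuousAt (fun e : Arm n => C * ∏ i, yukawa (e i)) e := by
  have h : (fun e : Arm n => C * ∏ i, yukawa (e i)) = fun e : Arm n =>
      C * ENNReal.ofReal (∏ i, (‖e i‖⁻¹ * Real.exp (-‖e i‖ / 2))) := by
    ext e
    rw [ENNReal.ofReal_prod_of_nonneg fun _ _ => by positivity]
    congr 2
    ext i
    rw [yukawa, ENNReal.ofReal_mul (by positivity)]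
  rw [h]
  refine (ENNReal.continuous_const_mul hC).continuousAt.comp
    (ENNReal.continuous_ofReal.continuousAt.comp ?_)
  refine tendsto_finsetProd _ fun i _ => ?_
  have hc : ContinuousAt (fun e : Arm n => ‖e i‖) e := by fun_prop
  exact (hc.inv₀ (norm_ne_zero_iff.2 (he i))).mul (by fun_prop)

/-! ### The expected total curvature from the expected turning angles -/

theorem measurable_turningAngle {n : ℕ} (i j : Fin n) :
    Measurable fun e : Arm n => InnerProductGeometry.angle (e i) (e j) :=
  by
  have h : Measurable fun e : Arm n => ((e i : E3), (e j : E3)) := by fun_prop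
  exact measurable_angle h.fst h.snd

/-- Angles are bounded by `π`, so integrability is automatic under a probability measure, and the
mean is the sum of the `n` equal means. -/
theorem integrable_totalCurvature {X : Type*} [MeasurableSpace X] (μ : Measure X)
    [IsProbabilityMeasure μ] {n : ℕ} {φ : X → Arm n} (hφ : Measurable φ) {a : ℝ} (ha : 0 ≤ a)
    (h : ∀ i, ∫⁻ x, ENNReal.ofReal
      (InnerProductGeometry.angle (φ x i) (φ x (finRotate n i))) ∂μ = ENNReal.ofReal a) :
    Integrable (fun x => totalCurvature (φ x)) μ ∧ ∫ x, totalCurvature (φ x) ∂μ = n * a := by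
  have hm : ∀ i, Measurable fun x =>
      InnerProductGeometry.angle (φ x i) (φ x (finRotate n i)) := fun i =>
    (measurable_turningAngle i (finRotate n i)).comp hφ
  have hi : ∀ i, Integrable (fun x =>
      InnerProductGeometry.angle (φ x i) (φ x (finRotate n i))) μ := fun i =>
    Integrable.of_bound (hm i).aestronglyMeasurable Real.pi (ae_of_all _ fun x => by
      rw [Real.norm_of_nonneg (InnerProductGeometry.angle_nonneg _ _)]
      exact InnerProductGeometry.angle_le_pi _ _)
  refine ⟨integrable_finsetSum _ fun i _ => hi i, ?_⟩
  simp only [totalCurvature]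
  rw [integral_finsetSum _ fun i _ => hi i]
  have : ∀ i, ∫ x, InnerProductGeometry.angle (φ x i) (φ x (finRotate n i)) ∂μ = a := fun i => by
    rw [integral_eq_lintegral_of_nonneg_ae (ae_of_all _ fun x =>
      InnerProductGeometry.angle_nonneg _ _) (hm i).aestronglyMeasurable, h i, ENNReal.toReal_ofReal ha]
  rw [Finset.sum_congr rfl fun i _ => this i]
  simp

/-! ### The Hopf-Gaussian measure on closed polygons -/

theorem mem_closedPolygons {n : ℕ} {e : Arm n} : e ∈ closedPolygons n ↔ ∑ i, e i = 0 := Iff.rfl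

theorem sum_insertNth_neg_sum {m : ℕ} (i : Fin (m + 1)) (x : Fin m → E3) :
    ∑ j, (i.insertNth (-∑ j, x j) x : Fin (m + 1) → E3) j = 0 := by
  rw [Fin.sum_univ_succAbove _ i]
  simp

/-- A closed polygon is determined by all of its edges but one. -/
def closedPolygonsEquiv {m : ℕ} (i : Fin (m + 1)) : (Fin m → E3) ≃ₗ[ℝ] closedPolygons (m + 1) where
  toFun x := ⟨WithLp.toLp 2 (i.insertNth (-∑ j, x j) x), sum_insertNth_neg_sum i x⟩
  map_add' x y := by
    refine Subtype.ext (PiLp.ext fun j => ?_)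
    change (i.insertNth _ _ : Fin (m + 1) → E3) j =
      (i.insertNth _ _ : Fin (m + 1) → E3) j + (i.insertNth _ _ : Fin (m + 1) → E3) j
    refine Fin.succAboveCases i ?_ (fun j => ?_) j
    · simp only [Fin.insertNth_apply_same, Pi.add_apply, Finset.sum_add_distrib, neg_add]
    · simp only [Fin.insertNth_apply_succAbove, Pi.add_apply]
  map_smul' c x := by
    refine Subtype.ext (PiLp.ext fun j => ?_)
    change (i.insertNth _ _ : Fin (m + 1) → E3) j = c • (i.insertNth _ _ : Fin (m + 1) → E3) j
    refine Fin.succAboveCases i ?_ (fun j => ?_) j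
    · simp only [Fin.insertNth_apply_same, Pi.smul_apply, ← Finset.smul_sum, smul_neg]
    · simp only [Fin.insertNth_apply_succAbove, Pi.smul_apply]
  invFun e j := (e : Arm (m + 1)) (i.succAbove j)
  left_inv x := funext fun j => Fin.insertNth_apply_succAbove (α := fun _ => E3) i _ x j
  right_inv e := by
    have h := mem_closedPolygons.1 e.2
    rw [Fin.sum_univ_succAbove _ i] at h
    refine Subtype.ext (PiLp.ext fun j => ?_)
    change (i.insertNth (-∑ j, (e : Arm (m + 1)) (i.succAbove j))
      (fun j => (e : Arm (m + 1)) (i.succAbove j)) : Fin (m + 1) → E3) j = (e : Arm (m + 1)) j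
    refine Fin.succAboveCases i ?_ (fun j => ?_) j
    · rw [Fin.insertNth_apply_same, ← eq_neg_of_add_eq_zero_left h]
    · rw [Fin.insertNth_apply_succAbove]

theorem closedPolygonsEquiv_apply {m : ℕ} (i : Fin (m + 1)) (x : Fin m → E3) :
    (closedPolygonsEquiv i x : Arm (m + 1)) = WithLp.toLp 2 (i.insertNth (-∑ j, x j) x) := rfl

/-- Lebesgue measure on a linear subspace. -/
abbrev submoduleVolume {E : Type*} [NormedAddCommGroup E] [InnerProductSpace ℝ E]
    [FiniteDimensional ℝ E] [MeasurableSpace E] [BorelSpace E] (P : Submodule ℝ E) : Measure P :=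
  volume

/-- Closed polygons with a vanishing `i`-th edge form a linear subspace, which is proper once there
are two edges, hence null. -/
theorem ae_closedPolygons_ne_zero (m : ℕ) :
    ∀ᵐ e : closedPolygons (m + 2) ∂submoduleVolume (closedPolygons (m + 2)), ∀ i, (e : Arm (m + 2)) i ≠ 0 := by
  rw [ae_all_iff]
  intro i
  set K : Submodule ℝ (closedPolygons (m + 2)) := LinearMap.ker
    (((LinearMap.proj i).comp (WithLp.linearEquiv 2 ℝ (Fin (m + 2) → E3)).toLinearMap).comp
      (closedPolygons (m + 2)).subtype) with hK
  have hmem : ∀ e : closedPolygons (m + 2), e ∈ K ↔ (e : Arm (m + 2)) i = 0 := fun e => by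
    simp [hK]
  have htop : K ≠ ⊤ := by
    intro h
    obtain ⟨v, hv⟩ := exists_ne (0 : E3)
    -- A polygon with one free edge `v` has `i`-th edge `-v ≠ 0`.
    have h1 : closedPolygonsEquiv i (Pi.single 0 v) ∈ K := h ▸ Submodule.mem_top
    rw [hmem, closedPolygonsEquiv_apply] at h1
    simp [hv] at h1
  have := Measure.addHaar_submodule (submoduleVolume (closedPolygons (m + 2))) K htop
  filter_upwards [measure_eq_zero_iff_ae_notMem.1 this] with e he h
  exact he ((hmem e).2 h)

/-- The pointwise density is the explicit product wherever no edge vanishes, which is almost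
everywhere on the subspace itself. -/
theorem restrictedDensityMeasure_hopfGaussianArm (m : ℕ) : ∃ C : ℝ≥0∞, C ≠ 0 ∧ C ≠ ∞ ∧
    restrictedDensityMeasure (hopfGaussianArm (m + 2)) (closedPolygons (m + 2)) =
      (submoduleVolume _).withDensity fun e => C * ∏ i, yukawa ((e : Arm (m + 2)) i) := by
  obtain ⟨C, hC0, hCt, hC⟩ := hopfGaussianArm_eq_withDensity (m + 2)
  refine ⟨C, hC0, hCt, withDensity_congr_ae ?_⟩
  filter_upwards [ae_closedPolygons_ne_zero m] with e he
  rw [hC, pointDensity_withDensity (continuousAt_prod_yukawa hCt he)]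

theorem yukawa_neg (e : E3) : yukawa (-e) = yukawa e := by simp [yukawa]

theorem finRotate_ne_self {n : ℕ} (hn : 2 ≤ n) (i : Fin n) : finRotate n i ≠ i := by
  obtain ⟨m, rfl⟩ := Nat.exists_eq_add_of_le' hn
  rw [finRotate_apply]
  simp

/-- Closed polygons are parametrized by all edges except `i`, so that edge `i` is minus the sum of a
free chain and its successor is an edge of that chain; `lintegral_closed_chain_angle` then applies.
-/
theorem hopfGaussianClosed_turningAngle (k : ℕ) (i : Fin (k + 3)) :
    IsProbabilityMeasure (hopfGaussianClosed (k + 3)) ∧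
    ∫⁻ e, ENNReal.ofReal (InnerProductGeometry.angle ((e : Arm (k + 3)) i)
        ((e : Arm (k + 3)) (finRotate (k + 3) i))) ∂hopfGaussianClosed (k + 3) =
      ENNReal.ofReal (Real.pi * (k + 2) / (2 * k + 3)) := by
  obtain ⟨C, hC0, hCt, hC⟩ := restrictedDensityMeasure_hopfGaussianArm (k + 1)
  -- The position of the successor of edge `i` among the edges left after deleting `i`.
  obtain ⟨j, hj⟩ := Fin.exists_succAbove_eq (finRotate_ne_self (by omega) i)
  obtain ⟨c, hc0, hct, hc⟩ := exists_map_linearEquiv_eq_smul (closedPolygonsEquiv i)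
    (volume : Measure (Fin (k + 2) → E3)) (submoduleVolume (closedPolygons (k + 3)))
  obtain ⟨Z, hZ0, hZt, hZ, hZa⟩ := lintegral_closed_chain_angle k j
  have hy : Measurable fun e : closedPolygons (k + 3) => ∏ i, yukawa ((e : Arm (k + 3)) i) := by
    have := measurable_yukawa
    fun_prop
  have key : ∀ f : closedPolygons (k + 3) → ℝ≥0∞, Measurable f →
      ∫⁻ e, f e ∂restrictedDensityMeasure (hopfGaussianArm (k + 3)) (closedPolygons (k + 3)) =
        C * c * ∫⁻ x : Fin (k + 2) → E3, yukawa (∑ j, x j) * (∏ j, yukawa (x j)) *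
          f (closedPolygonsEquiv i x) := by
    intro f hf
    rw [hC, lintegral_withDensity_eq_lintegral_mul _ (hy.const_mul C) hf,
      hc _ ((hy.const_mul C).mul hf), mul_comm C c, mul_assoc, ← lintegral_const_mul' _ _ hCt]
    congr 1
    refine lintegral_congr fun x => ?_
    simp only [Pi.mul_apply, closedPolygonsEquiv_apply]
    rw [Fin.prod_univ_succAbove _ i]
    simp only [Fin.insertNth_apply_same, Fin.insertNth_apply_succAbove, yukawa_neg]
    ring
  have hD0 : C * c * Z ≠ 0 := mul_ne_zero (mul_ne_zero hC0 hc0) hZ0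
  have hDt : C * c * Z ≠ ∞ := ENNReal.mul_ne_top (ENNReal.mul_ne_top hCt hct) hZt
  have huniv : restrictedDensityMeasure (hopfGaussianArm (k + 3)) (closedPolygons (k + 3)) Set.univ =
      C * c * Z := by
    rw [← lintegral_one, key _ measurable_const]
    simp [hZ]
  refine ⟨⟨?_⟩, ?_⟩
  · rw [hopfGaussianClosed, subspaceMeasure, Measure.smul_apply, huniv, smul_eq_mul,
      ENNReal.inv_mul_cancel hD0 hDt]
  · rw [hopfGaussianClosed, subspaceMeasure, lintegral_smul_measure, huniv,
      key (fun e => ENNReal.ofReal (InnerProductGeometry.angle ((e : Arm (k + 3)) i)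
        ((e : Arm (k + 3)) (finRotate (k + 3) i))))
      ((measurable_turningAngle i _).comp measurable_subtype_coe).ennreal_ofReal]
    simp only [closedPolygonsEquiv_apply, ← hj, Fin.insertNth_apply_same,
      Fin.insertNth_apply_succAbove]
    rw [hZa, smul_eq_mul, ← mul_assoc (C * c), ← mul_assoc, ENNReal.inv_mul_cancel hD0 hDt, one_mul]

/-! ### The volume of the Stiefel manifold -/

theorem finrank_ker_of_range_eq_top {E F : Type*} [NormedAddCommGroup E] [NormedSpace ℝ E]
    [FiniteDimensional ℝ E] [NormedAddCommGroup F] [NormedSpace ℝ F] {f' : E →L[ℝ] F} {d : ℕ} (hf' : f'.range = ⊤)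
    (hd : Module.finrank ℝ E = Module.finrank ℝ F + d) : Module.finrank ℝ f'.ker = d := by
  have h := f'.toLinearMap.finrank_range_add_finrank_ker
  rw [show f'.toLinearMap.range = ⊤ from hf', finrank_top] at h
  exact Nat.add_left_cancel (h.trans hd)

section LevelSet

variable {E F : Type*} [NormedAddCommGroup E] [NormedSpace ℝ E] [FiniteDimensional ℝ E]
  [MeasurableSpace E] [BorelSpace E] [NormedAddCommGroup F] [NormedSpace ℝ F] [FiniteDimensional ℝ F]
  {f : E → F} {f' : E →L[ℝ] F} {a : E}

/-- A level set through a point at which the derivative is onto has, near this point, finite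
Hausdorff measure in the dimension of the kernel. -/
theorem hausdorffMeasure_finiteAtFilter_levelSet {d : ℕ} (hf : HasStrictFDerivAt f f' a)
    (hf' : f'.range = ⊤) (hd : Module.finrank ℝ E = Module.finrank ℝ F + d) :
    (μH[d] : Measure E).FiniteAtFilter (𝓝[f ⁻¹' {f a}] a) := by
  have hk := finrank_ker_of_range_eq_top hf' hd
  obtain ⟨K, s, hs, hK⟩ := (hf.to_implicitFunction hf').exists_lipschitzOnWith
  have hbs : s ∩ Metric.ball 0 1 ∈ 𝓝 (0 : f'.ker) := inter_mem hs (Metric.ball_mem_nhds _ one_pos)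
  have hfin : μH[d] (s ∩ Metric.ball (0 : f'.ker) 1) < ∞ := by
    rw [← hk]
    exact (measure_mono Set.inter_subset_right).trans_lt measure_ball_lt_top
  have hpre : ∀ᶠ x in 𝓝 a, (hf.implicitToOpenPartialHomeomorph f f' hf' x).snd ∈
      s ∩ Metric.ball 0 1 := by
    have hc : ContinuousAt (fun x => (hf.implicitToOpenPartialHomeomorph f f' hf' x).snd) a :=
      continuousAt_snd.comp ((hf.implicitToOpenPartialHomeomorph f f' hf').continuousAt
        (hf.mem_implicitToOpenPartialHomeomorph_source hf'))
    exact hc (by simpa using hbs)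
  -- Near `a` the level set is the image of a bounded piece of the kernel under the implicit
  -- function, which is Lipschitz there.
  refine ⟨hf.implicitFunction f f' hf' (f a) '' (s ∩ Metric.ball 0 1), ?_, ?_⟩
  · filter_upwards [nhdsWithin_le_nhds (hf.eq_implicitFunction hf'), nhdsWithin_le_nhds hpre,
      self_mem_nhdsWithin] with x hx hxs hxa
    rw [Set.mem_preimage, Set.mem_singleton_iff] at hxa
    exact ⟨_, hxs, by rw [← hxa]; exact hx⟩
  · refine ((hK.mono Set.inter_subset_left).hausdorffMeasure_image_le d.cast_nonneg).trans_lt ?_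
    exact ENNReal.mul_lt_top (ENNReal.rpow_lt_top_of_nonneg d.cast_nonneg ENNReal.coe_ne_top) hfin

/-- A level set through a point at which the derivative is onto has positive Hausdorff measure in the
dimension of the kernel. -/
theorem hausdorffMeasure_levelSet_pos {d : ℕ} (hf : HasStrictFDerivAt f f' a)
    (hf' : f'.range = ⊤) (hd : Module.finrank ℝ E = Module.finrank ℝ F + d) :
    0 < μH[d] (f ⁻¹' {f a}) := by
  have hk := finrank_ker_of_range_eq_top hf' hd
  obtain ⟨p, hp⟩ := f'.ker_closedComplemented_of_finiteDimensional_range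
  set φ := hf.implicitFunction f f' hf' (f a)
  have hφ : HasStrictFDerivAt φ f'.ker.subtypeL 0 := hf.to_implicitFunction hf'
  have hpφ : HasStrictFDerivAt (p ∘ φ) (p.comp f'.ker.subtypeL) 0 :=
    p.hasStrictFDerivAt.comp 0 hφ
  have hsurj : (p.comp f'.ker.subtypeL).range = ⊤ :=
    LinearMap.range_eq_top.2 fun y => ⟨y, hp y⟩
  have hmap := hpφ.map_nhds_eq_of_surj hsurj
  have hmem : {k : f'.ker | f (φ k) = f a} ∈ 𝓝 (0 : f'.ker) := by
    have hc : Tendsto (fun k : f'.ker => (f a, k)) (𝓝 0) (𝓝 (f a, 0)) :=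
      (Continuous.prodMk_right (f a)).tendsto 0
    exact hc.eventually (hf.map_implicitFunction_eq hf')
  -- A linear projection to the kernel is Lipschitz and maps the level set onto a neighbourhood, so
  -- the level set cannot be null.
  have himg : p '' (f ⁻¹' {f a}) ∈ 𝓝 ((p ∘ φ) 0) := by
    rw [← hmap, mem_map]
    filter_upwards [hmem] with k hk
    exact ⟨φ k, hk, rfl⟩
  have hpos : 0 < μH[d] (p '' (f ⁻¹' {f a})) := by
    rw [← hk]
    exact Measure.measure_pos_of_mem_nhds _ himg
  by_contra h
  rw [not_lt, nonpos_iff_eq_zero] at h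
  have := p.lipschitz.hausdorffMeasure_image_le d.cast_nonneg (f ⁻¹' {f a})
  rw [h, mul_zero] at this
  exact hpos.not_ge this

end LevelSet

/-! ### The Stiefel manifold as a level set of the Gram matrix -/

abbrev FramePair (n : ℕ) : Type := WithLp 2 (EuclideanSpace ℂ (Fin n) × EuclideanSpace ℂ (Fin n))

/-- The Gram matrix of a pair of vectors. -/
def gram {n : ℕ} (p : FramePair n) : ℝ × ℝ × ℂ :=
  ((inner ℂ p.fst p.fst).re, (inner ℂ p.snd p.snd).re, inner ℂ p.fst p.snd)

theorem mem_stiefel_iff_gram {n : ℕ} (p : FramePair n) : p ∈ stiefel n ↔ gram p = (1, 1, 0) := by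
  have h : ∀ x : EuclideanSpace ℂ (Fin n), (inner ℂ x x).re = 1 ↔ ‖x‖ = 1 := fun x => by
    rw [show (inner ℂ x x).re = ‖x‖ ^ 2 from inner_self_eq_norm_sq (𝕜 := ℂ) x,
      pow_eq_one_iff_of_nonneg (norm_nonneg _) two_ne_zero]
  simp only [gram, stiefel, Prod.ext_iff, h, Set.mem_ofPred_eq]

theorem exists_hasStrictFDerivAt_gram {n : ℕ} {p : FramePair n} (hp : p ∈ stiefel n) :
    ∃ g : FramePair n →L[ℝ] ℝ × ℝ × ℂ, HasStrictFDerivAt gram g p ∧ g.range = ⊤ := by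
  set π₁ : FramePair n →L[ℝ] EuclideanSpace ℂ (Fin n) := WithLp.fstL 2 ℝ _ _
  set π₂ : FramePair n →L[ℝ] EuclideanSpace ℂ (Fin n) := WithLp.sndL 2 ℝ _ _
  have h₁ : HasStrictFDerivAt (fun p : FramePair n => p.fst) π₁ p := π₁.hasStrictFDerivAt
  have h₂ : HasStrictFDerivAt (fun p : FramePair n => p.snd) π₂ p := π₂.hasStrictFDerivAt
  refine ⟨_, (Complex.reCLM.hasStrictFDerivAt.comp p (h₁.inner ℂ h₁)).prodMk
    ((Complex.reCLM.hasStrictFDerivAt.comp p (h₂.inner ℂ h₂)).prodMk (h₁.inner ℂ h₂)), ?_⟩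
  obtain ⟨hu, hv, huv⟩ := hp
  have hvu : inner ℂ p.snd p.fst = (0 : ℂ) := inner_eq_zero_symm.1 huv
  refine LinearMap.range_eq_top.2 fun y => ?_
  obtain ⟨s, t, z⟩ := y
  -- Moving `u` by `(s/2)u` and `v` by `(t/2)v + z u` changes `|u|²`, `|v|²` and `⟨u,v⟩` to first
  -- order by exactly `s`, `t` and `z`, because the frame is orthonormal.
  refine ⟨WithLp.toLp 2 ((s / 2 : ℂ) • p.fst, (t / 2 : ℂ) • p.snd + z • p.fst), ?_⟩
  simp [π₁, π₂, inner_add_right, inner_add_left, inner_smul_left, inner_smul_right, huv, hvu,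
    hu, hv, map_ofNat]

theorem finrank_framePair (n : ℕ) : Module.finrank ℝ (FramePair n) = 4 * n := by
  rw [(WithLp.linearEquiv 2 ℝ (EuclideanSpace ℂ (Fin n) × EuclideanSpace ℂ (Fin n))).finrank_eq,
    Module.finrank_prod, (WithLp.linearEquiv 2 ℝ (Fin n → ℂ)).finrank_eq,
    Module.finrank_pi_fintype]
  simp only [Complex.finrank_real_complex, Finset.sum_const, Finset.card_univ, Fintype.card_fin,
    smul_eq_mul]
  omega

theorem isCompact_stiefel (n : ℕ) : IsCompact (stiefel n) := by
  refine Metric.isCompact_of_isClosed_isBounded ?_ ?_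
  · have : stiefel n = gram ⁻¹' {(1, 1, 0)} := Set.ext mem_stiefel_iff_gram
    rw [this]
    refine isClosed_singleton.preimage ?_
    unfold gram
    fun_prop
  · refine (Metric.isBounded_closedBall (x := (0 : FramePair n)) (r := 2)).subset fun p hp => ?_
    rw [mem_closedBall_zero_iff, WithLp.prod_norm_eq_of_L2, hp.1, hp.2.1, Real.sqrt_le_left two_pos.le]
    norm_num

theorem nonempty_stiefel {n : ℕ} (hn : 2 ≤ n) : (stiefel n).Nonempty := by
  have h01 : (⟨0, by omega⟩ : Fin n) ≠ ⟨1, by omega⟩ := by simp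
  exact ⟨WithLp.toLp 2 (EuclideanSpace.single ⟨0, by omega⟩ 1, EuclideanSpace.single ⟨1, by omega⟩ 1),
    by simp, by simp, by
      change inner ℂ (EuclideanSpace.single _ (1 : ℂ)) (EuclideanSpace.single _ (1 : ℂ)) = 0
      rw [EuclideanSpace.inner_single_left]
      simp [h01]⟩

/-- The Gram map takes values in a space of real dimension four, whence `4n - 4`. Local finiteness
and compactness give finiteness; a single point gives positivity. -/
theorem hausdorffMeasure_stiefel {n : ℕ} (hn : 2 ≤ n) :
    0 < μH[(4 * n - 4 : ℕ)] (stiefel n) ∧ μH[(4 * n - 4 : ℕ)] (stiefel n) < ∞ := by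
  have hd : Module.finrank ℝ (FramePair n) = Module.finrank ℝ (ℝ × ℝ × ℂ) + (4 * n - 4) := by
    rw [finrank_framePair]
    simp
    omega
  have hpre : ∀ p ∈ stiefel n, gram ⁻¹' {gram p} = stiefel n := fun p hp => by
    ext q
    rw [(mem_stiefel_iff_gram p).1 hp, mem_stiefel_iff_gram]
    rfl
  constructor
  · obtain ⟨p, hp⟩ := nonempty_stiefel hn
    obtain ⟨g, hg, hr⟩ := exists_hasStrictFDerivAt_gram hp
    exact hpre p hp ▸ hausdorffMeasure_levelSet_pos hg hr hd
  · refine (isCompact_stiefel n).measure_lt_top_of_nhdsWithin fun p hp => ?_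
    obtain ⟨g, hg, hr⟩ := exists_hasStrictFDerivAt_gram hp
    exact hpre p hp ▸ hausdorffMeasure_finiteAtFilter_levelSet hg hr hd

theorem stiefelVolume_univ {n : ℕ} (hn : 2 ≤ n) :
    stiefelVolume n Set.univ ≠ 0 ∧ stiefelVolume n Set.univ ≠ ∞ := by
  obtain ⟨h0, ht⟩ := hausdorffMeasure_stiefel hn
  have h : stiefelVolume n Set.univ = Measure.euclideanHausdorffMeasure (4 * n - 4) (stiefel n) := by
    rw [stiefelVolume, ← isometry_subtype_coe.euclideanHausdorffMeasure_image, Set.image_univ,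
      Subtype.range_coe]
  rw [h, Measure.euclideanHausdorffMeasure_def, Measure.smul_apply, ENNReal.smul_def, smul_eq_mul]
  exact ⟨mul_ne_zero (ENNReal.coe_ne_zero.2
    (Measure.addHaarScalarFactor_volume_hausdorffMeasure_ne_zero _)) h0.ne',
    ENNReal.mul_ne_top ENNReal.coe_ne_top ht.ne⟩

/-! ### Gaussian vectors in complex space -/

abbrev CVec (n : ℕ) : Type := EuclideanSpace ℂ (Fin n)

/-- A unitarily invariant Lebesgue measure on `ℂⁿ`. -/
def cVolume (n : ℕ) : Measure (CVec n) := μH[Module.finrank ℝ (CVec n)]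

instance (n : ℕ) : (cVolume n).IsAddHaarMeasure := by
  unfold cVolume; infer_instance

theorem lintegral_cVolume_comp {n : ℕ} (g : CVec n ≃ₗᵢ[ℂ] CVec n) {f : CVec n → ℝ≥0∞}
    (hf : Measurable f) : ∫⁻ z, f (g z) ∂cVolume n = ∫⁻ z, f z ∂cVolume n :=
  (g.toIsometryEquiv.measurePreserving_hausdorffMeasure _).lintegral_comp hf

/-- The unnormalized standard Gaussian measure on `ℂⁿ`. -/
def complexGaussian (n : ℕ) : Measure (CVec n) :=
  (cVolume n).withDensity fun z => ENNReal.ofReal (Real.exp (-‖z‖ ^ 2))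

theorem measurable_exp_neg_norm_sq {n : ℕ} :
    Measurable fun z : CVec n => ENNReal.ofReal (Real.exp (-‖z‖ ^ 2)) := by fun_prop

theorem lintegral_complexGaussian {n : ℕ} {f : CVec n → ℝ≥0∞} (hf : Measurable f) :
    ∫⁻ z, f z ∂complexGaussian n =
      ∫⁻ z, ENNReal.ofReal (Real.exp (-‖z‖ ^ 2)) * f z ∂cVolume n := by
  rw [complexGaussian, lintegral_withDensity_eq_lintegral_mul _ measurable_exp_neg_norm_sq hf]
  rfl

theorem lintegral_complexGaussian_comp {n : ℕ} (g : CVec n ≃ₗᵢ[ℂ] CVec n) {f : CVec n → ℝ≥0∞}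
    (hf : Measurable f) : ∫⁻ z, f (g z) ∂complexGaussian n = ∫⁻ z, f z ∂complexGaussian n := by
  have hg : Measurable g := g.continuous.measurable
  rw [lintegral_complexGaussian hf, lintegral_complexGaussian (f := fun z => f (g z)) (hf.comp hg),
    ← lintegral_cVolume_comp g (f := fun z => ENNReal.ofReal (Real.exp (-‖z‖ ^ 2)) * f z)
      (measurable_exp_neg_norm_sq.mul hf)]
  simp only [g.norm_map]

theorem lintegral_cVolume_norm (n : ℕ) : ∃ c : ℝ≥0∞, c ≠ 0 ∧ c ≠ ∞ ∧ ∀ f : ℝ → ℝ≥0∞,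
    Measurable f → ∫⁻ z, f ‖z‖ ∂cVolume (n + 1) =
      c * ∫⁻ r in Set.Ioi (0 : ℝ), ENNReal.ofReal (r ^ (2 * n + 1)) * f r := by
  have h : Module.finrank ℝ (CVec (n + 1)) - 1 = 2 * n + 1 := by
    rw [(WithLp.linearEquiv 2 ℝ (Fin (n + 1) → ℂ)).finrank_eq, Module.finrank_pi_fintype]
    simp only [Complex.finrank_real_complex, Finset.sum_const, Finset.card_univ, Fintype.card_fin,
      smul_eq_mul]
    omega
  rw [← h]
  exact lintegral_fun_norm (cVolume (n + 1))

/-- The first two coordinates and the others. -/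
def splitEquiv (m : ℕ) : CVec (2 + m) ≃ₗ[ℝ] CVec 2 × CVec m :=
  (EuclideanSpace.finAddEquivProd (𝕜 := ℂ) (n := 2) (m := m)).toLinearEquiv.restrictScalars ℝ

theorem splitEquiv_fst {m : ℕ} (z : CVec (2 + m)) (i : Fin 2) :
    (splitEquiv m z).1 i = z (Fin.castAdd m i) := rfl

theorem splitEquiv_snd {m : ℕ} (z : CVec (2 + m)) (i : Fin m) :
    (splitEquiv m z).2 i = z (Fin.natAdd 2 i) := rfl

theorem norm_sq_splitEquiv {m : ℕ} (z : CVec (2 + m)) :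
    ‖z‖ ^ 2 = ‖(splitEquiv m z).1‖ ^ 2 + ‖(splitEquiv m z).2‖ ^ 2 := by
  simp only [EuclideanSpace.norm_sq_eq, splitEquiv_fst, splitEquiv_snd, Fin.sum_univ_add]

theorem measurable_splitEquiv (m : ℕ) : Measurable (splitEquiv m) :=
  (splitEquiv m).toContinuousLinearEquiv.continuous.measurable

/-- `exp(-|z|²)` factors over blocks of coordinates; `c` only compares normalizations of the
Lebesgue measures. -/
theorem lintegral_complexGaussian_split (m : ℕ) : ∃ c : ℝ≥0∞, c ≠ 0 ∧ c ≠ ∞ ∧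
    ∀ F : CVec 2 × CVec m → ℝ≥0∞, Measurable F →
      ∫⁻ z, F (splitEquiv m z) ∂complexGaussian (2 + m) =
        c * ∫⁻ x, ∫⁻ y, F (x, y) ∂complexGaussian m ∂complexGaussian 2 := by
  have := Measure.prod.instIsAddHaarMeasure (cVolume 2) (cVolume m)
  obtain ⟨c, hc0, hct, hc⟩ := exists_map_linearEquiv_eq_smul (splitEquiv m).symm
    ((cVolume 2).prod (cVolume m)) (cVolume (2 + m))
  have hL := measurable_splitEquiv m
  refine ⟨c, hc0, hct, fun F hF => ?_⟩
  have hF' : Measurable fun x => ∫⁻ y, F (x, y) ∂complexGaussian m := by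
    have : SFinite (complexGaussian m) := by unfold complexGaussian; infer_instance
    exact hF.lintegral_prod_right'
  rw [lintegral_complexGaussian (f := fun z => F (splitEquiv m z)) (hF.comp hL),
    hc (fun z => ENNReal.ofReal (Real.exp (-‖z‖ ^ 2)) * F (splitEquiv m z))
      (measurable_exp_neg_norm_sq.mul (hF.comp hL)), lintegral_complexGaussian hF']
  have hw : ∀ p : CVec 2 × CVec m, ENNReal.ofReal (Real.exp (-‖(splitEquiv m).symm p‖ ^ 2)) *
      F (splitEquiv m ((splitEquiv m).symm p)) = ENNReal.ofReal (Real.exp (-‖p.1‖ ^ 2)) *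
        (ENNReal.ofReal (Real.exp (-‖p.2‖ ^ 2)) * F p) := fun p => by
    rw [norm_sq_splitEquiv, LinearEquiv.apply_symm_apply, neg_add, Real.exp_add,
      ENNReal.ofReal_mul (Real.exp_pos _).le, mul_assoc]
  rw [lintegral_congr hw, lintegral_prod _ (by fun_prop)]
  congr 1
  refine lintegral_congr fun x => ?_
  rw [lintegral_complexGaussian (by fun_prop), ← lintegral_const_mul' _ _ ENNReal.ofReal_ne_top]

theorem complexGaussian_univ (n : ℕ) :
    complexGaussian (n + 1) Set.univ ≠ 0 ∧ complexGaussian (n + 1) Set.univ ≠ ∞ := by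
  have h : complexGaussian (n + 1) Set.univ =
      ∫⁻ z, ENNReal.ofReal (Real.exp (-‖z‖ ^ 2)) ∂cVolume (n + 1) := by
    rw [← lintegral_one, lintegral_complexGaussian measurable_const]
    simp
  constructor
  · rw [h, Ne, lintegral_eq_zero_iff measurable_exp_neg_norm_sq]
    intro h0
    have : ∀ᵐ z ∂cVolume (n + 1), False := by
      filter_upwards [h0] with z hz
      exact absurd hz (ENNReal.ofReal_pos.2 (Real.exp_pos _)).ne'
    simp only [Filter.eventually_false_iff_eq_bot, ae_eq_bot] at this
    exact NeZero.ne (cVolume (n + 1)) this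
  · obtain ⟨c, hc0, hct, hc⟩ := lintegral_cVolume_norm n
    rw [h, hc (fun r => ENNReal.ofReal (Real.exp (-r ^ 2))) (by fun_prop)]
    refine ENNReal.mul_ne_top hct ?_
    have hi := integrableOn_rpow_mul_exp_neg_mul_sq one_pos
      (show (-1 : ℝ) < ((2 * n + 1 : ℕ) : ℝ) from by
        have : (0 : ℝ) ≤ ((2 * n + 1 : ℕ) : ℝ) := Nat.cast_nonneg _
        linarith)
    refine ne_of_lt ((setLIntegral_congr_fun measurableSet_Ioi fun r hr => ?_).trans_lt
      hi.lintegral_lt_top)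
    have hr : 0 < r := hr
    rw [← ENNReal.ofReal_mul (by positivity), Real.rpow_natCast]
    simp

/-! ### Moduli of complex Gaussian vectors -/

/-- `∫ r³ exp(-b r²) dr = 1 / (2b²)`. -/
theorem lintegral_cube_mul_exp {b : ℝ} (hb : 0 < b) :
    ∫⁻ r in Set.Ioi (0 : ℝ), ENNReal.ofReal (r ^ 3 * Real.exp (-(b * r ^ 2))) =
      ENNReal.ofReal (1 / (2 * b ^ 2)) := by
  have h := lintegral_Ioi_of_hasDerivAt
    (g := fun r => -((1 + b * r ^ 2) * Real.exp (-(b * r ^ 2)) / (2 * b ^ 2)))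
    (g' := fun r => r ^ 3 * Real.exp (-(b * r ^ 2))) (a := 0) (l := 0) (fun r _ => ?_)
    (fun r hr => ?_) ?_
  · rw [h]; simp
  · have h2 : HasDerivAt (fun r => b * r ^ 2) (b * (2 * r)) r := by
      simpa using (hasDerivAt_pow 2 r).const_mul b
    have h3 : HasDerivAt (fun r => Real.exp (-(b * r ^ 2)))
        (Real.exp (-(b * r ^ 2)) * -(b * (2 * r))) r := h2.neg.exp
    refine ((((h2.const_add 1).mul h3).div_const (2 * b ^ 2)).neg).congr_deriv ?_
    field_simp
    ring
  · have : 0 < r := hr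
    positivity
  · have h0 : Tendsto (fun x : ℝ => (1 + x) * Real.exp (-x)) atTop (𝓝 0) := by
      have h1 := Real.tendsto_pow_mul_exp_neg_atTop_nhds_zero 0
      have h2 := Real.tendsto_pow_mul_exp_neg_atTop_nhds_zero 1
      simpa [add_mul] using h1.add h2
    have h3 : Tendsto (fun r : ℝ => b * r ^ 2) atTop atTop :=
      (tendsto_pow_atTop two_ne_zero).const_mul_atTop hb
    simpa using ((h0.comp h3).div_const (2 * b ^ 2)).neg

theorem lintegral_Ioi_mul_left {a : ℝ} (ha : 0 < a) (f : ℝ → ℝ≥0∞) :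
    ∫⁻ x in Set.Ioi (0 : ℝ), f x = ENNReal.ofReal a * ∫⁻ t in Set.Ioi (0 : ℝ), f (a * t) := by
  have him : (fun t => a * t) '' Set.Ioi 0 = Set.Ioi 0 := by
    rw [Set.image_mul_left_Ioi ha, mul_zero]
  rw [← lintegral_const_mul' _ _ ENNReal.ofReal_ne_top]
  conv_lhs => rw [← him]
  rw [lintegral_image_eq_lintegral_abs_deriv_mul measurableSet_Ioi
    (fun t _ => (hasDerivAt_const_mul a).hasDerivWithinAt)
    (mul_right_injective₀ ha.ne').injOn]
  simp [abs_of_pos ha]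

theorem lintegral_cVolume_two : ∃ c : ℝ≥0∞, c ≠ 0 ∧ c ≠ ∞ ∧ ∀ F : ℂ → ℂ → ℝ≥0∞,
    Measurable (fun p : ℂ × ℂ => F p.1 p.2) →
      ∫⁻ x, F (x 0) (x 1) ∂cVolume 2 = c * ∫⁻ a : ℂ, ∫⁻ b : ℂ, F a b := by
  have := Measure.prod.instIsAddHaarMeasure (volume : Measure ℂ) (volume : Measure ℂ)
  obtain ⟨c, hc0, hct, hc⟩ := exists_map_linearEquiv_eq_smul
    ((LinearEquiv.finTwoArrow ℝ ℂ).symm.trans (WithLp.linearEquiv 2 ℝ (Fin 2 → ℂ)).symm)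
    ((volume : Measure ℂ).prod volume) (cVolume 2)
  refine ⟨c, hc0, hct, fun F hF => ?_⟩
  have h : Measurable fun x : CVec 2 => (x 0, x 1) := by fun_prop
  rw [hc (fun x => F (x 0) (x 1)) (hF.comp h), ← lintegral_prod (fun p : ℂ × ℂ => F p.1 p.2) hF.aemeasurable]
  rfl

/-- The ratio of the moduli of two independent complex Gaussians has density `2ρ / (1 + ρ²)²`. -/
theorem lintegral_gaussian_ratio : ∃ c : ℝ≥0∞, c ≠ ∞ ∧ ∀ G : ℝ → ℝ≥0∞, Measurable G →
    ∫⁻ x, G (‖x 1‖ / ‖x 0‖) ∂complexGaussian 2 =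
      c * ∫⁻ t in Set.Ioi (0 : ℝ), ENNReal.ofReal (2 * t / (1 + t ^ 2) ^ 2) * G t := by
  obtain ⟨c, hc0, hct, hc⟩ := lintegral_cVolume_two
  obtain ⟨k, hk0, hkt, hk⟩ := lintegral_fun_norm (volume : Measure ℂ)
  rw [Complex.finrank_real_complex] at hk
  simp only [Nat.add_one_sub_one, pow_one] at hk
  refine ⟨c * k * k * ENNReal.ofReal (1 / 4), ENNReal.mul_ne_top (ENNReal.mul_ne_top
    (ENNReal.mul_ne_top hct hkt) hkt) ENNReal.ofReal_ne_top, fun G hG => ?_⟩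
  have hE : Measurable fun p : ℝ × ℝ => ENNReal.ofReal (Real.exp (-(p.1 ^ 2 + p.2 ^ 2))) *
    G (p.2 / p.1) := by fun_prop
  have hI : Measurable fun r : ℝ => ∫⁻ t in Set.Ioi (0 : ℝ), ENNReal.ofReal t *
      (ENNReal.ofReal (Real.exp (-(r ^ 2 + t ^ 2))) * G (t / r)) :=
    Measurable.lintegral_prod_right' (f := fun p : ℝ × ℝ => ENNReal.ofReal p.2 *
      (ENNReal.ofReal (Real.exp (-(p.1 ^ 2 + p.2 ^ 2))) * G (p.2 / p.1))) (by fun_prop)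
  calc ∫⁻ x, G (‖x 1‖ / ‖x 0‖) ∂complexGaussian 2
      = c * ∫⁻ a : ℂ, ∫⁻ b : ℂ, ENNReal.ofReal (Real.exp (-(‖a‖ ^ 2 + ‖b‖ ^ 2))) *
          G (‖b‖ / ‖a‖) := by
        rw [lintegral_complexGaussian (by fun_prop), ← hc (fun a b =>
          ENNReal.ofReal (Real.exp (-(‖a‖ ^ 2 + ‖b‖ ^ 2))) * G (‖b‖ / ‖a‖)) (by fun_prop)]
        simp only [EuclideanSpace.norm_sq_eq, Fin.sum_univ_two]
    _ = c * (k * ∫⁻ r in Set.Ioi (0 : ℝ), ENNReal.ofReal r * (k * ∫⁻ t in Set.Ioi (0 : ℝ),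
          ENNReal.ofReal t * (ENNReal.ofReal (Real.exp (-(r ^ 2 + t ^ 2))) * G (t / r)))) := by
        rw [← hk _ (hI.const_mul k)]
        congr 1
        refine lintegral_congr fun a => ?_
        exact hk (fun t => ENNReal.ofReal (Real.exp (-(‖a‖ ^ 2 + t ^ 2))) * G (t / ‖a‖))
          (by fun_prop)
    -- The second modulus is rescaled as `r t`, so that `t` is the ratio; `r³` collects the two
    -- polar Jacobians and the scaling.
    _ = c * k * k * ∫⁻ r in Set.Ioi (0 : ℝ), ∫⁻ t in Set.Ioi (0 : ℝ),
          ENNReal.ofReal (r ^ 3 * Real.exp (-((1 + t ^ 2) * r ^ 2))) * (ENNReal.ofReal t * G t) := by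
        rw [mul_assoc c, mul_assoc c, mul_assoc k, ← lintegral_const_mul' k (fun r => ∫⁻ t in Set.Ioi (0 : ℝ),
          ENNReal.ofReal (r ^ 3 * Real.exp (-((1 + t ^ 2) * r ^ 2))) * (ENNReal.ofReal t * G t)) hkt]
        refine congrArg (fun x => c * (k * x)) ?_
        refine setLIntegral_congr_fun measurableSet_Ioi fun r hr => ?_
        have hr : 0 < r := hr
        rw [lintegral_Ioi_mul_left hr]
        rw [← mul_assoc, mul_comm _ k, mul_assoc k, ← mul_assoc (ENNReal.ofReal r) (ENNReal.ofReal r),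
          ← lintegral_const_mul' _ _ (ENNReal.mul_ne_top ENNReal.ofReal_ne_top ENNReal.ofReal_ne_top)]
        congr 1
        refine setLIntegral_congr_fun measurableSet_Ioi fun t ht => ?_
        have ht : 0 < t := ht
        rw [mul_div_cancel_left₀ _ hr.ne', ← mul_assoc (ENNReal.ofReal (r * t)), ← mul_assoc,
          ← mul_assoc _ _ (G t), ← ENNReal.ofReal_mul hr.le, ← ENNReal.ofReal_mul (by positivity),
          ← ENNReal.ofReal_mul (by positivity), ← ENNReal.ofReal_mul (by positivity)]
        congr 2
        rw [show r ^ 2 + (r * t) ^ 2 = (1 + t ^ 2) * r ^ 2 by ring]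
        ring
    _ = c * k * k * ∫⁻ t in Set.Ioi (0 : ℝ), ENNReal.ofReal (1 / 4) *
          (ENNReal.ofReal (2 * t / (1 + t ^ 2) ^ 2) * G t) := by
        rw [lintegral_lintegral_swap (by fun_prop)]
        congr 1
        refine setLIntegral_congr_fun measurableSet_Ioi fun t ht => ?_
        have ht : 0 < t := ht
        rw [lintegral_mul_const _ (by fun_prop), lintegral_cube_mul_exp (by positivity),
          ← mul_assoc, ← mul_assoc, ← ENNReal.ofReal_mul (by positivity),
          ← ENNReal.ofReal_mul (by positivity)]
        congr 2
        field_simp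
        norm_num
    _ = _ := by
        rw [lintegral_const_mul' _ _ ENNReal.ofReal_ne_top, ← mul_assoc]

/-- Only the first two coordinates matter, and the unknown constant is identified as the total mass
by testing on `1`. -/
theorem lintegral_complexGaussian_ratio (m : ℕ) {G : ℝ → ℝ≥0∞} (hG : Measurable G) :
    ∫⁻ z, G (‖z (Fin.castAdd m 1)‖ / ‖z (Fin.castAdd m 0)‖) ∂complexGaussian (2 + m) =
      complexGaussian (2 + m) Set.univ *
        ∫⁻ t in Set.Ioi (0 : ℝ), ENNReal.ofReal (2 * t / (1 + t ^ 2) ^ 2) * G t := by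
  obtain ⟨c, -, hct, hc⟩ := lintegral_complexGaussian_split m
  obtain ⟨k, hkt, hk⟩ := lintegral_gaussian_ratio
  have key : ∀ G : ℝ → ℝ≥0∞, Measurable G →
      ∫⁻ z, G (‖z (Fin.castAdd m 1)‖ / ‖z (Fin.castAdd m 0)‖) ∂complexGaussian (2 + m) =
        c * complexGaussian m Set.univ * k *
          ∫⁻ t in Set.Ioi (0 : ℝ), ENNReal.ofReal (2 * t / (1 + t ^ 2) ^ 2) * G t := by
    intro G hG
    have h := hc (fun p => G (‖p.1 1‖ / ‖p.1 0‖)) (by fun_prop)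
    simp only [splitEquiv_fst, lintegral_const] at h
    rw [h, lintegral_mul_const _ (by fun_prop), hk G hG]
    ring
  have h1 := key (fun _ => 1) measurable_const
  simp only [lintegral_one, mul_one, lintegral_two_mul_div_sq] at h1
  rw [key G hG, h1]

/-- The substitution `y = t/√(r²+t²)`, that is `r = t√(y⁻²-1)`, which makes the relative length of
the second block the variable. -/
theorem lintegral_cube_hypot {t : ℝ} (ht : 0 < t) (F : ℝ → ℝ≥0∞) :
    ∫⁻ r in Set.Ioi (0 : ℝ), ENNReal.ofReal (r ^ 3) * F (√(r ^ 2 + t ^ 2)) =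
      ∫⁻ y in Set.Ioo (0 : ℝ) 1, ENNReal.ofReal (t ^ 4 * (1 - y ^ 2) / y ^ 5) * F (t / y) := by
  have hpos : ∀ y ∈ Set.Ioo (0 : ℝ) 1, 0 < (y ^ 2)⁻¹ - 1 := fun y hy => by
    have : y ^ 2 < 1 := pow_lt_one₀ hy.1.le hy.2 two_ne_zero
    have := (one_lt_inv₀ (pow_pos hy.1 2)).2 this
    linarith
  have hinv : ∀ y ∈ Set.Ioo (0 : ℝ) 1,
      √((t * √((y ^ 2)⁻¹ - 1)) ^ 2 + t ^ 2) = t / y := fun y hy => by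
    rw [mul_pow, Real.sq_sqrt (hpos y hy).le,
      show t ^ 2 * ((y ^ 2)⁻¹ - 1) + t ^ 2 = (t / y) ^ 2 by rw [div_pow]; ring]
    exact Real.sqrt_sq (div_nonneg ht.le hy.1.le)
  have him : (fun y => t * √((y ^ 2)⁻¹ - 1)) '' Set.Ioo 0 1 = Set.Ioi 0 := by
    ext r
    constructor
    · rintro ⟨y, hy, rfl⟩
      exact mul_pos ht (Real.sqrt_pos.2 (hpos y hy))
    · intro hr
      have hr : 0 < r := hr
      have hs : t < √(r ^ 2 + t ^ 2) := Real.lt_sqrt_of_sq_lt (by nlinarith)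
      refine ⟨t / √(r ^ 2 + t ^ 2), ⟨by positivity, (div_lt_one (by positivity)).2 hs⟩, ?_⟩
      have h2 : ((t / √(r ^ 2 + t ^ 2)) ^ 2)⁻¹ - 1 = (r / t) ^ 2 := by
        rw [div_pow, Real.sq_sqrt (by positivity)]
        field_simp
        ring
      simp only [h2, Real.sqrt_sq (div_nonneg hr.le ht.le)]
      field_simp
  have hinj : Set.InjOn (fun y => t * √((y ^ 2)⁻¹ - 1)) (Set.Ioo 0 1) := by
    intro y hy y' hy' h
    have h' : t * √((y ^ 2)⁻¹ - 1) = t * √((y' ^ 2)⁻¹ - 1) := h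
    have h1 := hinv y hy
    rw [h', hinv y' hy', div_eq_div_iff hy'.1.ne' hy.1.ne'] at h1
    exact mul_left_cancel₀ ht.ne' h1
  have hd : ∀ y ∈ Set.Ioo (0 : ℝ) 1, HasDerivWithinAt (fun y => t * √((y ^ 2)⁻¹ - 1))
      (-(t / (y ^ 3 * √((y ^ 2)⁻¹ - 1)))) (Set.Ioo 0 1) y := fun y hy => by
    have hs := Real.sqrt_pos.2 (hpos y hy)
    have h1 := ((hasDerivAt_pow 2 y).inv (pow_ne_zero 2 hy.1.ne')).sub_const 1
    refine ((h1.sqrt (hpos y hy).ne').const_mul t).hasDerivWithinAt.congr_deriv ?_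
    have := hy.1
    simp only [Pi.inv_apply]
    field_simp
    norm_num [mul_comm]
  rw [← him, lintegral_image_eq_lintegral_abs_deriv_mul measurableSet_Ioo hd hinj]
  refine setLIntegral_congr_fun measurableSet_Ioo fun y hy => ?_
  have hs := Real.sqrt_pos.2 (hpos y hy)
  have hy0 := hy.1
  have hsq := Real.sq_sqrt (hpos y hy).le
  rw [hinv y hy, ← mul_assoc, ← ENNReal.ofReal_mul (abs_nonneg _), abs_neg,
    abs_of_pos (by positivity)]
  congr 2
  set s := √((y ^ 2)⁻¹ - 1)
  have hs' : y ^ 2 * s ^ 2 = 1 - y ^ 2 := by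
    rw [hsq, mul_sub, mul_inv_cancel₀ (by positivity), mul_one]
  rw [← hs']
  field_simp

/-- The square of the relative length of the last `m` coordinates of a complex Gaussian vector in
`ℂ^(2 + m)` has a beta distribution. -/
theorem lintegral_complexGaussian_beta (k : ℕ) : ∃ c : ℝ≥0∞, ∀ H : ℝ → ℝ≥0∞, Measurable H →
    ∫⁻ z, H (‖(splitEquiv (k + 1) z).2‖ / ‖z‖) ∂complexGaussian (2 + (k + 1)) =
      c * ∫⁻ y in Set.Ioo (0 : ℝ) 1, ENNReal.ofReal ((1 - y ^ 2) * y ^ (2 * k + 1)) * H y := by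
  obtain ⟨c, -, hct, hc⟩ := lintegral_complexGaussian_split (k + 1)
  obtain ⟨c₁, -, hc₁t, hc₁⟩ := lintegral_cVolume_norm 1
  obtain ⟨c₂, -, hc₂t, hc₂⟩ := lintegral_cVolume_norm k
  set I : ℝ≥0∞ := ∫⁻ τ in Set.Ioi (0 : ℝ), ENNReal.ofReal (τ ^ (2 * k + 5) * Real.exp (-τ ^ 2))
  refine ⟨c * c₁ * c₂ * I, fun H hH => ?_⟩
  have hJ : Measurable fun r : ℝ => ∫⁻ t in Set.Ioi (0 : ℝ), ENNReal.ofReal (t ^ (2 * k + 1)) *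
      (ENNReal.ofReal (Real.exp (-(√(r ^ 2 + t ^ 2)) ^ 2)) * H (t / √(r ^ 2 + t ^ 2))) :=
    Measurable.lintegral_prod_right' (f := fun p : ℝ × ℝ => ENNReal.ofReal (p.2 ^ (2 * k + 1)) *
      (ENNReal.ofReal (Real.exp (-(√(p.1 ^ 2 + p.2 ^ 2)) ^ 2)) * H (p.2 / √(p.1 ^ 2 + p.2 ^ 2))))
      (by fun_prop)
  calc ∫⁻ z, H (‖(splitEquiv (k + 1) z).2‖ / ‖z‖) ∂complexGaussian (2 + (k + 1))
      = c * ∫⁻ x, ∫⁻ y, ENNReal.ofReal (Real.exp (-(√(‖x‖ ^ 2 + ‖y‖ ^ 2)) ^ 2)) *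
          H (‖y‖ / √(‖x‖ ^ 2 + ‖y‖ ^ 2)) ∂cVolume (k + 1) ∂cVolume 2 := by
        have h := hc (fun p => H (‖p.2‖ / √(‖p.1‖ ^ 2 + ‖p.2‖ ^ 2))) (by fun_prop)
        have hm : Measurable fun x : CVec 2 => ∫⁻ y : CVec (k + 1),
            H (‖y‖ / √(‖x‖ ^ 2 + ‖y‖ ^ 2)) ∂complexGaussian (k + 1) := by
          have : SFinite (complexGaussian (k + 1)) := by unfold complexGaussian; infer_instance
          exact Measurable.lintegral_prod_right' (f := fun p : CVec 2 × CVec (k + 1) =>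
            H (‖p.2‖ / √(‖p.1‖ ^ 2 + ‖p.2‖ ^ 2))) (by fun_prop)
        simp only [← norm_sq_splitEquiv, Real.sqrt_sq (norm_nonneg _)] at h
        rw [h, lintegral_complexGaussian hm]
        congr 1
        refine lintegral_congr fun x => ?_
        rw [lintegral_complexGaussian (by fun_prop),
          ← lintegral_const_mul' _ _ ENNReal.ofReal_ne_top]
        refine lintegral_congr fun y => ?_
        rw [Real.sq_sqrt (by positivity), neg_add, Real.exp_add,
          ENNReal.ofReal_mul (Real.exp_pos _).le, mul_assoc]
    _ = c * (c₁ * ∫⁻ r in Set.Ioi (0 : ℝ), ENNReal.ofReal (r ^ 3) * (c₂ *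
          ∫⁻ t in Set.Ioi (0 : ℝ), ENNReal.ofReal (t ^ (2 * k + 1)) *
          (ENNReal.ofReal (Real.exp (-(√(r ^ 2 + t ^ 2)) ^ 2)) * H (t / √(r ^ 2 + t ^ 2))))) := by
        rw [← hc₁ _ (hJ.const_mul c₂)]
        congr 1
        refine lintegral_congr fun x => ?_
        exact hc₂ (fun t => ENNReal.ofReal (Real.exp (-(√(‖x‖ ^ 2 + t ^ 2)) ^ 2)) *
          H (t / √(‖x‖ ^ 2 + t ^ 2))) (by fun_prop)
    _ = c * c₁ * c₂ * ∫⁻ t in Set.Ioi (0 : ℝ), ∫⁻ y in Set.Ioo (0 : ℝ) 1,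
          ENNReal.ofReal (t ^ (2 * k + 5) * Real.exp (-(t / y) ^ 2)) *
            (ENNReal.ofReal ((1 - y ^ 2) / y ^ 5) * H y) := by
        rw [mul_assoc c, mul_assoc c, mul_assoc c₁]
        refine congrArg (fun x => c * (c₁ * x)) ?_
        rw [← lintegral_const_mul' c₂ _ hc₂t]
        simp_rw [mul_left_comm _ c₂]
        rw [lintegral_const_mul' _ _ hc₂t, lintegral_const_mul' _ _ hc₂t]
        congr 1
        simp_rw [← lintegral_const_mul' _ _ ENNReal.ofReal_ne_top]
        rw [lintegral_lintegral_swap (by fun_prop)]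
        refine setLIntegral_congr_fun measurableSet_Ioi fun t ht => ?_
        have ht : 0 < t := ht
        have h := lintegral_cube_hypot ht fun R => ENNReal.ofReal (t ^ (2 * k + 1)) *
          (ENNReal.ofReal (Real.exp (-R ^ 2)) * H (t / R))
        rw [h]
        refine setLIntegral_congr_fun measurableSet_Ioo fun y hy => ?_
        have hy0 := hy.1
        have hy1 : 0 ≤ 1 - y ^ 2 := sub_nonneg.2 (pow_le_one₀ hy.1.le hy.2.le)
        rw [div_div_cancel₀ ht.ne', ← mul_assoc, ← mul_assoc, ← mul_assoc,
          ← ENNReal.ofReal_mul (by positivity), ← ENNReal.ofReal_mul (by positivity),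
          ← ENNReal.ofReal_mul (by positivity)]
        congr 2
        ring
    -- Rescaling `t = yτ` frees the exponential from `y`, so the `τ`-integral is the constant `I`;
    -- the powers collect to `y · y^(2k+5) · y⁻⁵ = y^(2k+1)`.
    _ = c * c₁ * c₂ * ∫⁻ y in Set.Ioo (0 : ℝ) 1, I *
          (ENNReal.ofReal ((1 - y ^ 2) * y ^ (2 * k + 1)) * H y) := by
        rw [lintegral_lintegral_swap (by fun_prop)]
        congr 1
        refine setLIntegral_congr_fun measurableSet_Ioo fun y hy => ?_
        have hy0 := hy.1
        have hy1 : 0 ≤ 1 - y ^ 2 := sub_nonneg.2 (pow_le_one₀ hy.1.le hy.2.le)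
        rw [lintegral_mul_const _ (by fun_prop), lintegral_Ioi_mul_left hy0]
        have e : ∀ τ : ℝ, ENNReal.ofReal ((y * τ) ^ (2 * k + 5) * Real.exp (-(y * τ / y) ^ 2)) =
            ENNReal.ofReal (y ^ (2 * k + 5)) *
              ENNReal.ofReal (τ ^ (2 * k + 5) * Real.exp (-τ ^ 2)) := fun τ => by
          rw [mul_div_cancel_left₀ _ hy0.ne', mul_pow, mul_assoc, ENNReal.ofReal_mul (by positivity)]
        simp_rw [e]
        rw [lintegral_const_mul' _ _ ENNReal.ofReal_ne_top]
        have e' : ENNReal.ofReal ((1 - y ^ 2) * y ^ (2 * k + 1)) = ENNReal.ofReal y *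
            (ENNReal.ofReal (y ^ (2 * k + 5)) * ENNReal.ofReal ((1 - y ^ 2) / y ^ 5)) := by
          rw [← ENNReal.ofReal_mul (by positivity), ← ENNReal.ofReal_mul hy0.le]
          congr 1
          field_simp
          ring
        rw [e']
        ring
    _ = _ := by
        rw [lintegral_const_mul _ (by fun_prop), ← mul_assoc]

/-- The same quotient of beta integrals as for closed chains; this is where the two expectations are
seen to agree. -/
theorem lintegral_complexGaussian_pi_div (k : ℕ) :
    ∫⁻ z, ENNReal.ofReal (Real.pi / (1 + ‖(splitEquiv (k + 1) z).2‖ / ‖z‖))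
        ∂complexGaussian (2 + (k + 1)) =
      complexGaussian (2 + (k + 1)) Set.univ * ENNReal.ofReal (Real.pi * (k + 2) / (2 * k + 3)) := by
  obtain ⟨c, hc⟩ := lintegral_complexGaussian_beta k
  have h1 := hc (fun _ => 1) measurable_const
  simp only [lintegral_one, mul_one, lintegral_beta] at h1
  rw [hc (fun y => ENNReal.ofReal (Real.pi / (1 + y))) (by fun_prop), lintegral_beta_angle, h1,
    mul_assoc, ← ENNReal.ofReal_mul (by positivity)]
  congr 2
  push_cast
  have := Real.pi_pos
  field_simp
  ring

/-! ### Turning angles in complex coordinates -/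

/-- The turning angle between the edges with quaternionic coordinates `a + b 𝐣` and `c + d 𝐣`. -/
def complexAngle (a b c d : ℂ) : ℝ :=
  Real.arccos ((‖star a * c + star b * d‖ ^ 2 - ‖a * d - b * c‖ ^ 2) /
    (‖star a * c + star b * d‖ ^ 2 + ‖a * d - b * c‖ ^ 2))

theorem lagrange_identity (a b c d : ℂ) :
    (‖a‖ ^ 2 + ‖b‖ ^ 2) * (‖c‖ ^ 2 + ‖d‖ ^ 2) =
      ‖star a * c + star b * d‖ ^ 2 + ‖a * d - b * c‖ ^ 2 := by
  simp only [Complex.sq_norm, Complex.normSq_apply, Complex.add_re, Complex.add_im, Complex.mul_re,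
    Complex.mul_im, Complex.sub_re, Complex.sub_im, Complex.star_def, Complex.conj_re,
    Complex.conj_im]
  ring

/-- The inner product of the Hopf vectors is `|⟨p,q⟩|² - |det(p,q)|²` for `p = (a,b)`, `q = (c,d)`,
and by Lagrange's identity the product of their norms is the corresponding sum. So the tangent of
half the angle is `|det|/|⟨p,q⟩|`. -/
theorem angle_hopf_frame (a b c d : ℂ) :
    InnerProductGeometry.angle (hopf ((a : ℍ[ℝ]) + (b : ℍ[ℝ]) * quatJ))
      (hopf ((c : ℍ[ℝ]) + (d : ℍ[ℝ]) * quatJ)) = complexAngle a b c d := by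
  rw [InnerProductGeometry.angle, norm_hopf_frame, norm_hopf_frame, lagrange_identity, complexAngle]
  congr 2
  simp only [hopf_frame, PiLp.inner_apply, Fin.sum_univ_three, Complex.sq_norm, Complex.normSq_apply]
  simp
  ring

theorem complexAngle_star (a b c d : ℂ) :
    complexAngle (star a) (star b) (star c) (star d) = complexAngle a b c d := by
  have h1 : ‖star (star a) * star c + star (star b) * star d‖ = ‖star a * c + star b * d‖ := by
    rw [← norm_star]; simp
  have h2 : ‖star a * star d - star b * star c‖ = ‖a * d - b * c‖ := by
    rw [← norm_star]; simp
  rw [complexAngle, complexAngle, h1, h2]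

theorem complexAngle_mul {l m : ℝ} (hl : l ≠ 0) (hm : m ≠ 0) (a b c d : ℂ) :
    complexAngle (l * a) (l * b) (m * c) (m * d) = complexAngle a b c d := by
  have h1 : ‖star (l * a : ℂ) * (m * c) + star (l * b : ℂ) * (m * d)‖ ^ 2 =
      (l * m) ^ 2 * ‖star a * c + star b * d‖ ^ 2 := by
    rw [show star (l * a : ℂ) * (m * c) + star (l * b : ℂ) * (m * d) =
      ((l * m : ℝ) : ℂ) * (star a * c + star b * d) by simp; ring, norm_mul, mul_pow,
      Complex.norm_real, Real.norm_eq_abs, sq_abs]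
  have h2 : ‖(l * a : ℂ) * (m * d) - (l * b : ℂ) * (m * c)‖ ^ 2 =
      (l * m) ^ 2 * ‖a * d - b * c‖ ^ 2 := by
    rw [show (l * a : ℂ) * (m * d) - (l * b : ℂ) * (m * c) =
      ((l * m : ℝ) : ℂ) * (a * d - b * c) by push_cast; ring, norm_mul, mul_pow,
      Complex.norm_real, Real.norm_eq_abs, sq_abs]
  rw [complexAngle, complexAngle, h1, h2, ← mul_sub, ← mul_add, mul_div_mul_left _ _ (by positivity)]

theorem arccos_eq_two_mul_arctan {p q : ℝ} (hp : 0 < p) (hq : 0 ≤ q) :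
    Real.arccos ((p ^ 2 - q ^ 2) / (p ^ 2 + q ^ 2)) = 2 * Real.arctan (q / p) := by
  rw [← Real.arccos_cos (x := 2 * Real.arctan (q / p)), cos_two_mul_arctan]
  · congr 1
    field_simp
  · have := Real.arctan_nonneg.2 (div_nonneg hq hp.le)
    linarith
  · have := Real.arctan_lt_pi_div_two (q / p)
    linarith

theorem measurable_complexAngle {α : Type*} [MeasurableSpace α] {a b c d : α → ℂ} (ha : Measurable a)
    (hb : Measurable b) (hc : Measurable c) (hd : Measurable d) :
    Measurable fun x => complexAngle (a x) (b x) (c x) (d x) := by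
  have h1 : Measurable fun x => ‖star (a x) * c x + star (b x) * d x‖ ^ 2 :=
    (((continuous_star.measurable.comp ha).mul hc).add
      ((continuous_star.measurable.comp hb).mul hd)).norm.pow_const 2
  have h2 : Measurable fun x => ‖a x * d x - b x * c x‖ ^ 2 :=
    ((ha.mul hd).sub (hb.mul hc)).norm.pow_const 2
  exact Real.continuous_arccos.measurable.comp ((h1.sub h2).div (h1.add h2))

/-! ### Orthonormal pairs -/

/-- An orthonormal pair extends to an orthonormal basis, whose coordinates give the isometry. -/
theorem exists_linearIsometryEquiv_single {n : ℕ} {s t : Fin n} (hst : s ≠ t) {u v : CVec n}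
    (hu : ‖u‖ = 1) (hv : ‖v‖ = 1) (huv : inner ℂ u v = (0 : ℂ)) :
    ∃ U : CVec n ≃ₗᵢ[ℂ] CVec n, U (EuclideanSpace.single s 1) = u ∧
      U (EuclideanSpace.single t 1) = v := by
  set w : Fin n → CVec n := fun i => if i = s then u else v
  have hw : Orthonormal ℂ (({s, t} : Set (Fin n)).domRestrict w) := by
    have hvu : inner ℂ v u = (0 : ℂ) := inner_eq_zero_symm.1 huv
    constructor
    · rintro ⟨i, hi⟩
      by_cases h : i = s <;> simp [w, h, hu, hv, Set.domRestrict]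
    · rintro ⟨i, hi⟩ ⟨j, hj⟩ hij
      have hij : i ≠ j := fun h => hij (Subtype.ext h)
      rcases hi with rfl | rfl <;> rcases hj with rfl | rfl
      · exact absurd rfl hij
      · change inner ℂ (w i) (w j) = 0
        rw [show w i = u from if_pos rfl, show w j = v from if_neg hst.symm, huv]
      · change inner ℂ (w i) (w j) = 0
        rw [show w i = v from if_neg hst.symm, show w j = u from if_pos rfl, hvu]
      · exact absurd rfl hij
  obtain ⟨b, hb⟩ := hw.exists_orthonormalBasis_extension_of_card_eq (by simp)
  refine ⟨b.repr.symm, ?_, ?_⟩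
  · rw [b.repr_symm_single, hb s (by simp)]
    simp [w]
  · rw [b.repr_symm_single, hb t (by simp)]
    simp [w, hst.symm]

theorem inner_eq_splitEquiv {m : ℕ} (z w : CVec (2 + m)) : inner ℂ z w =
    inner ℂ (splitEquiv m z).1 (splitEquiv m w).1 + inner ℂ (splitEquiv m z).2 (splitEquiv m w).2 := by
  simp only [PiLp.inner_apply, splitEquiv_fst, splitEquiv_snd, Fin.sum_univ_add]

theorem ae_coordinate_ne_zero {n : ℕ} (i : Fin n) : ∀ᵐ z ∂complexGaussian n, z i ≠ 0 := by
  set K : Submodule ℝ (CVec n) := LinearMap.ker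
    ((LinearMap.proj i).comp (WithLp.linearEquiv 2 ℝ (Fin n → ℂ)).toLinearMap)
  have hmem : ∀ z : CVec n, z ∈ K ↔ z i = 0 := fun z => by simp [K]
  have htop : K ≠ ⊤ := fun h => by
    have h1 : EuclideanSpace.single i (1 : ℂ) ∈ K := h ▸ Submodule.mem_top
    rw [hmem] at h1
    simp at h1
  have h : ∀ᵐ z ∂cVolume n, z i ≠ 0 := by
    filter_upwards [measure_eq_zero_iff_ae_notMem.1
      (Measure.addHaar_submodule (cVolume n) K htop)] with z hz h
    exact hz ((hmem z).2 h)
  exact (withDensity_absolutelyContinuous _ _).ae_le h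

/-! ### The turning angle of a Gaussian frame -/

/-- A positive multiple of the component of `y` orthogonal to `x`. -/
def orthComponent {n : ℕ} (x y : CVec n) : CVec n := ((‖x‖ ^ 2 : ℝ) : ℂ) • y - inner ℂ x y • x

/-- For fixed `x`, both `⟨·,·⟩` and `det` of the first two coordinates of `x` and `orthComponent x
y` are linear in `y`, represented by orthogonal vectors. Unitary invariance moves these onto two
coordinate axes, and the half-angle tangent becomes a rescaled ratio of two Gaussian moduli. -/
theorem lintegral_complexAngle_orthComponent {m : ℕ} {x : CVec (2 + m)}
    (hx₁ : (splitEquiv m x).1 ≠ 0) (hx₂ : (splitEquiv m x).2 ≠ 0) :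
    ∫⁻ y, ENNReal.ofReal (complexAngle (x (Fin.castAdd m 0)) (x (Fin.castAdd m 1))
        (orthComponent x y (Fin.castAdd m 0)) (orthComponent x y (Fin.castAdd m 1)))
        ∂complexGaussian (2 + m) = complexGaussian (2 + m) Set.univ *
      ENNReal.ofReal (Real.pi / (1 + ‖(splitEquiv m x).2‖ / ‖x‖)) := by
  set x₁ := (splitEquiv m x).1 with hx₁'
  set x₂ := (splitEquiv m x).2 with hx₂'
  have hp : 0 < ‖x₁‖ := norm_pos_iff.2 hx₁
  have hq : 0 < ‖x₂‖ := norm_pos_iff.2 hx₂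
  have hn : ‖x‖ ^ 2 = ‖x₁‖ ^ 2 + ‖x₂‖ ^ 2 := norm_sq_splitEquiv x
  have hr : 0 < ‖x‖ := by
    by_contra h
    have : ‖x‖ = 0 := le_antisymm (not_lt.1 h) (norm_nonneg _)
    rw [this] at hn
    nlinarith [pow_pos hp 2, pow_pos hq 2]
  -- Write `x = (x₁, x₂)`. Expanding `⟨x₁, ·⟩` on `orthComponent x y` gives `⟨a₀, y⟩`; in the
  -- determinant the multiple of `x` drops out and leaves `|x|²⟨b₀, y⟩`, with `b₀` orthogonal to
  -- `x₁`.
  set a₀ : CVec (2 + m) := (splitEquiv m).symm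
    (((‖x₂‖ ^ 2 : ℝ) : ℂ) • x₁, -((‖x₁‖ ^ 2 : ℝ) : ℂ) • x₂) with ha₀
  set b₀ : CVec (2 + m) := (splitEquiv m).symm (!₂[-star (x₁ 1), star (x₁ 0)], 0) with hb₀
  have hx₁n : ‖x₁‖ ^ 2 = ‖x₁ 0‖ ^ 2 + ‖x₁ 1‖ ^ 2 := by
    rw [EuclideanSpace.norm_sq_eq, Fin.sum_univ_two]
  have hna : ‖a₀‖ = ‖x₁‖ * ‖x₂‖ * ‖x‖ := by
    rw [← sq_eq_sq₀ (norm_nonneg _) (by positivity), norm_sq_splitEquiv, ha₀,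
      LinearEquiv.apply_symm_apply]
    simp only [norm_smul, norm_neg, Complex.norm_real, norm_pow, norm_norm]
    rw [mul_pow _ ‖x‖, hn]
    ring
  have hnb : ‖b₀‖ = ‖x₁‖ := by
    rw [← sq_eq_sq₀ (norm_nonneg _) (by positivity), norm_sq_splitEquiv, hb₀,
      LinearEquiv.apply_symm_apply, hx₁n, EuclideanSpace.norm_sq_eq, Fin.sum_univ_two]
    simp [add_comm]
  have hab : inner ℂ a₀ b₀ = (0 : ℂ) := by
    rw [inner_eq_splitEquiv, ha₀, hb₀, LinearEquiv.apply_symm_apply, LinearEquiv.apply_symm_apply]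
    simp only [inner_zero_right, add_zero, inner_smul_left, PiLp.inner_apply, Fin.sum_univ_two]
    refine mul_eq_zero_of_right _ ?_
    simp
    ring
  have hA : 0 < ‖a₀‖ := hna ▸ by positivity
  have hB : 0 < ‖b₀‖ := hnb ▸ hp
  have hst : Fin.castAdd m (0 : Fin 2) ≠ Fin.castAdd m 1 := by simp
  obtain ⟨U, hU₁, hU₂⟩ := exists_linearIsometryEquiv_single hst
    (u := ((‖a₀‖⁻¹ : ℝ) : ℂ) • a₀) (v := ((‖b₀‖⁻¹ : ℝ) : ℂ) • b₀)
    (by rw [norm_smul, Complex.norm_real, norm_inv, norm_norm, inv_mul_cancel₀ hA.ne'])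
    (by rw [norm_smul, Complex.norm_real, norm_inv, norm_norm, inv_mul_cancel₀ hB.ne'])
    (by rw [inner_smul_left, inner_smul_right, hab, mul_zero, mul_zero])
  have hU : ∀ z i, inner ℂ (U (EuclideanSpace.single i 1)) (U z) = z i := fun z i => by
    rw [U.inner_map_map, EuclideanSpace.inner_single_left]; simp
  have hUa : ∀ z, inner ℂ a₀ (U z) = ‖a₀‖ * z (Fin.castAdd m 0) := fun z => by
    rw [← hU z, hU₁, inner_smul_left, Complex.conj_ofReal, ← mul_assoc, ← Complex.ofReal_mul,
      mul_inv_cancel₀ hA.ne', Complex.ofReal_one, one_mul]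
  have hUb : ∀ z, inner ℂ b₀ (U z) = ‖b₀‖ * z (Fin.castAdd m 1) := fun z => by
    rw [← hU z, hU₂, inner_smul_left, Complex.conj_ofReal, ← mul_assoc, ← Complex.ofReal_mul,
      mul_inv_cancel₀ hB.ne', Complex.ofReal_one, one_mul]
  have hin : ∀ y, star (x (Fin.castAdd m 0)) * orthComponent x y (Fin.castAdd m 0) +
      star (x (Fin.castAdd m 1)) * orthComponent x y (Fin.castAdd m 1) = inner ℂ a₀ y := fun y => by
    rw [inner_eq_splitEquiv, ha₀, LinearEquiv.apply_symm_apply, orthComponent, inner_eq_splitEquiv x y,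
      ← hx₁', ← hx₂', hn]
    simp only [inner_smul_left]
    have h1 : inner ℂ x₁ (splitEquiv m y).1 = star (x₁ 0) * y (Fin.castAdd m 0) +
        star (x₁ 1) * y (Fin.castAdd m 1) := by
      simp [PiLp.inner_apply, splitEquiv_fst, mul_comm]
    have h2 : star (x₁ 0) * x₁ 0 + star (x₁ 1) * x₁ 1 = ((‖x₁‖ ^ 2 : ℝ) : ℂ) := by
      rw [hx₁n]
      simp [Complex.conj_mul']
    have h3 : x (Fin.castAdd m 0) = x₁ 0 := rfl
    have h4 : x (Fin.castAdd m 1) = x₁ 1 := rfl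
    simp only [PiLp.sub_apply, PiLp.smul_apply, smul_eq_mul, h1, h3, h4, map_neg, Complex.conj_ofReal,
      Complex.ofReal_add]
    linear_combination (-(inner ℂ x₂ (splitEquiv m y).2) - star (x₁ 0) * y (Fin.castAdd m 0) -
      star (x₁ 1) * y (Fin.castAdd m 1)) * h2
  have hdet : ∀ y, x (Fin.castAdd m 0) * orthComponent x y (Fin.castAdd m 1) -
      x (Fin.castAdd m 1) * orthComponent x y (Fin.castAdd m 0) =
        ((‖x‖ ^ 2 : ℝ) : ℂ) * inner ℂ b₀ y := fun y => by
    rw [inner_eq_splitEquiv, hb₀, LinearEquiv.apply_symm_apply, orthComponent]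
    have h3 : x (Fin.castAdd m 0) = x₁ 0 := rfl
    have h4 : x (Fin.castAdd m 1) = x₁ 1 := rfl
    simp [PiLp.inner_apply, splitEquiv_fst, h3, h4]
    ring
  have hm : Measurable fun y => ENNReal.ofReal (complexAngle (x (Fin.castAdd m 0))
      (x (Fin.castAdd m 1)) (orthComponent x y (Fin.castAdd m 0))
      (orthComponent x y (Fin.castAdd m 1))) := by
    unfold orthComponent
    exact (measurable_complexAngle (by fun_prop) (by fun_prop) (by fun_prop)
      (by fun_prop)).ennreal_ofReal
  have hk : 0 < ‖x₂‖ / ‖x‖ := div_pos hq hr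
  rw [← lintegral_complexGaussian_comp U hm, ← lintegral_arctan_div hk,
    ← lintegral_complexGaussian_ratio m
      (G := fun t => ENNReal.ofReal (2 * Real.arctan (t / (‖x₂‖ / ‖x‖)))) (by
        have := Real.continuous_arctan.measurable
        fun_prop)]
  -- The scale is `|a₀|/(|x|²|b₀|) = |x₂|/|x|`. A nonzero first coordinate keeps the half-angle
  -- formula valid.
  refine lintegral_congr_ae ?_
  filter_upwards [ae_coordinate_ne_zero (Fin.castAdd m (0 : Fin 2))] with z hz
  have hz : 0 < ‖z (Fin.castAdd m 0)‖ := norm_pos_iff.2 hz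
  rw [complexAngle, hin, hdet, hUa, hUb]
  simp only [norm_mul, Complex.norm_real, norm_norm, norm_pow]
  rw [arccos_eq_two_mul_arctan (by positivity) (by positivity), hna, hnb]
  congr 3
  field_simp

/-! ### The unitary group -/

theorem continuousStar_continuousLinearMap (H : Type*) [NormedAddCommGroup H] [InnerProductSpace ℂ H]
    [CompleteSpace H] : ContinuousStar (H →L[ℂ] H) := inferInstance

/-- The group of unitary operators of `ℂⁿ`. -/
abbrev UnitaryGroup (n : ℕ) : Type := unitary (CVec n →L[ℂ] CVec n)

instance (n : ℕ) : ContinuousStar (CVec n →L[ℂ] CVec n) := continuousStar_continuousLinearMap _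

instance (n : ℕ) : IsTopologicalGroup (UnitaryGroup n) :=
  instIsTopologicalGroupSubtypeMemSubmonoidUnitaryOfContinuousMulOfContinuousStar

instance (n : ℕ) : SecondCountableTopology (UnitaryGroup n) :=
  TopologicalSpace.Subtype.secondCountableTopology _

instance (n : ℕ) : BorelSpace (UnitaryGroup n) := Subtype.borelSpace _

theorem UnitaryGroup.norm_apply {n : ℕ} (g : UnitaryGroup n) (x : CVec n) :
    ‖(g : CVec n →L[ℂ] CVec n) x‖ = ‖x‖ :=
  (Unitary.linearIsometryEquiv g).norm_map x

theorem UnitaryGroup.inner_apply {n : ℕ} (g : UnitaryGroup n) (x y : CVec n) :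
    inner ℂ ((g : CVec n →L[ℂ] CVec n) x) ((g : CVec n →L[ℂ] CVec n) y) = inner ℂ x y :=
  (Unitary.linearIsometryEquiv g).inner_map_map x y

instance (n : ℕ) : CompactSpace (UnitaryGroup n) := by
  refine isCompact_iff_compactSpace.1 (Metric.isCompact_of_isClosed_isBounded isClosed_unitary
    ((Metric.isBounded_closedBall (x := (0 : CVec n →L[ℂ] CVec n)) (r := 1)).subset fun g hg => ?_))
  rw [mem_closedBall_zero_iff]
  exact ContinuousLinearMap.opNorm_le_bound _ zero_le_one fun x => by
    rw [one_mul]; exact (UnitaryGroup.norm_apply ⟨g, hg⟩ x).le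

/-- The inverse is the adjoint; in matrix entries, inversion is conjugate transposition. -/
theorem UnitaryGroup.inner_inv_apply {n : ℕ} (g : UnitaryGroup n) (x y : CVec n) :
    inner ℂ x (((g⁻¹ : UnitaryGroup n) : CVec n →L[ℂ] CVec n) y) =
      inner ℂ ((g : CVec n →L[ℂ] CVec n) x) y := by
  rw [← UnitaryGroup.inner_apply g, ← mul_apply_eq_comp, ← Submonoid.coe_mul,
    mul_inv_cancel]
  rfl

theorem UnitaryGroup.exists_single {n : ℕ} {s t : Fin n} (hst : s ≠ t) {u v : CVec n}
    (hu : ‖u‖ = 1) (hv : ‖v‖ = 1) (huv : inner ℂ u v = (0 : ℂ)) :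
    ∃ g : UnitaryGroup n, (g : CVec n →L[ℂ] CVec n) (EuclideanSpace.single s 1) = u ∧
      (g : CVec n →L[ℂ] CVec n) (EuclideanSpace.single t 1) = v := by
  obtain ⟨U, h₁, h₂⟩ := exists_linearIsometryEquiv_single hst hu hv huv
  exact ⟨Unitary.linearIsometryEquiv.symm U, h₁, h₂⟩

theorem UnitaryGroup.lintegral_comp {n : ℕ} (g : UnitaryGroup n) {f : CVec n → ℝ≥0∞}
    (hf : Measurable f) : ∫⁻ z, f ((g : CVec n →L[ℂ] CVec n) z) ∂complexGaussian n =
      ∫⁻ z, f z ∂complexGaussian n :=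
  lintegral_complexGaussian_comp (Unitary.linearIsometryEquiv g) hf

/-! ### The action of the unitary group on the Stiefel manifold -/

instance stiefelSMul (n : ℕ) : SMul (UnitaryGroup n) (stiefel n) where
  smul g p := ⟨WithLp.toLp 2 ((g : CVec n →L[ℂ] CVec n) p.1.fst, (g : CVec n →L[ℂ] CVec n) p.1.snd),
    (g.norm_apply _).trans p.2.1, (g.norm_apply _).trans p.2.2.1, (g.inner_apply _ _).trans p.2.2.2⟩

instance stiefelMulAction (n : ℕ) : MulAction (UnitaryGroup n) (stiefel n) where
  one_smul _ := rfl
  mul_smul _ _ _ := rfl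

theorem smul_fst {n : ℕ} (g : UnitaryGroup n) (p : stiefel n) :
    (g • p).1.fst = (g : CVec n →L[ℂ] CVec n) p.1.fst := rfl

theorem smul_snd {n : ℕ} (g : UnitaryGroup n) (p : stiefel n) :
    (g • p).1.snd = (g : CVec n →L[ℂ] CVec n) p.1.snd := rfl

/-- The orthonormal pair of two standard basis vectors. -/
def standardFrame {n : ℕ} {s t : Fin n} (hst : s ≠ t) : stiefel n :=
  ⟨WithLp.toLp 2 (EuclideanSpace.single s 1, EuclideanSpace.single t 1), by simp, by simp, by
    change inner ℂ (EuclideanSpace.single _ (1 : ℂ)) (EuclideanSpace.single _ (1 : ℂ)) = 0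
    rw [EuclideanSpace.inner_single_left]
    simp [hst]⟩

theorem exists_smul_standardFrame {n : ℕ} {s t : Fin n} (hst : s ≠ t) (p : stiefel n) :
    ∃ g : UnitaryGroup n, g • standardFrame hst = p := by
  obtain ⟨g, h₁, h₂⟩ := UnitaryGroup.exists_single hst p.2.1 p.2.2.1 p.2.2.2
  refine ⟨g, Subtype.ext ((WithLp.ofLp_injective 2) (Prod.ext (x := (_, _)) h₁ h₂))⟩

theorem isPretransitive_stiefel {n : ℕ} {s t : Fin n} (hst : s ≠ t) :
    MulAction.IsPretransitive (UnitaryGroup n) (stiefel n) :=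
  ⟨fun p q => by
    obtain ⟨g, hg⟩ := exists_smul_standardFrame hst p
    obtain ⟨h, hh⟩ := exists_smul_standardFrame hst q
    exact ⟨h * g⁻¹, by rw [mul_smul, ← hg, inv_smul_smul, hh]⟩⟩

instance (n : ℕ) : MeasurableSMul₂ (UnitaryGroup n) (stiefel n) := by
  have h : Continuous fun q : UnitaryGroup n × stiefel n => q.1 • q.2 := by
    refine Continuous.subtype_mk ?_ _
    have h1 : Continuous fun q : UnitaryGroup n × stiefel n => (q.1 : CVec n →L[ℂ] CVec n) :=
      continuous_subtype_val.comp continuous_fst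
    have h2 : Continuous fun q : UnitaryGroup n × stiefel n => (q.2 : FramePair n) :=
      continuous_subtype_val.comp continuous_snd
    have h3 : Continuous fun q : UnitaryGroup n × stiefel n => (q.2 : FramePair n).fst := by fun_prop
    have h4 : Continuous fun q : UnitaryGroup n × stiefel n => (q.2 : FramePair n).snd := by fun_prop
    exact (WithLp.prod_continuous_toLp 2 _ _).comp ((h1.clm_apply h3).prodMk (h1.clm_apply h4))
  exact ⟨h.measurable⟩

theorem isometry_smul_stiefel {n : ℕ} (g : UnitaryGroup n) :
    Isometry fun p : stiefel n => g • p := by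
  refine Isometry.of_dist_eq fun p q => ?_
  rw [Subtype.dist_eq, Subtype.dist_eq, WithLp.prod_dist_eq_of_L2, WithLp.prod_dist_eq_of_L2]
  simp only [smul_fst, smul_snd, dist_eq_norm, ← map_sub, UnitaryGroup.norm_apply]

instance (n : ℕ) : SMulInvariantMeasure (UnitaryGroup n) (stiefel n) (stiefelVolume n) where
  measure_preimage_smul g s hs := by
    have h := (isometry_smul_stiefel g).euclideanHausdorffMeasure_preimage (d := 4 * n - 4) s
    rw [(MulAction.surjective g).range_eq, Set.inter_univ] at h
    exact h

/-! ### The expected turning angle for the symmetric measure -/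

instance (n : ℕ) : SFinite (complexGaussian n) := by
  unfold complexGaussian; infer_instance

theorem orthComponent_apply {n : ℕ} (g : UnitaryGroup n) (x y : CVec n) :
    orthComponent ((g : CVec n →L[ℂ] CVec n) x) ((g : CVec n →L[ℂ] CVec n) y) =
      (g : CVec n →L[ℂ] CVec n) (orthComponent x y) := by
  simp only [orthComponent, UnitaryGroup.norm_apply, UnitaryGroup.inner_apply, map_sub, map_smul]

theorem inner_orthComponent {n : ℕ} (x y : CVec n) : inner ℂ x (orthComponent x y) = (0 : ℂ) := by
  rw [orthComponent, inner_sub_right, inner_smul_right, inner_smul_right, inner_self_eq_norm_sq_to_K,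
    Complex.ofReal_pow]
  exact sub_eq_zero.2 (mul_comm _ _)

/-- If the orthogonal part vanishes, `y` is proportional to `x` and the minor `x_s y_t - x_t y_s` is
zero. This confines `y` to a proper subspace, since `x_s ≠ 0`. -/
theorem ae_orthComponent_ne_zero {n : ℕ} {s t : Fin n} (hst : s ≠ t) {x : CVec n} (hx : x s ≠ 0) :
    ∀ᵐ y ∂complexGaussian n, orthComponent x y ≠ 0 := by
  set K : Submodule ℝ (CVec n) := LinearMap.ker ((LinearMap.mulLeft ℝ (x s)).comp
    ((LinearMap.proj t).comp (WithLp.linearEquiv 2 ℝ (Fin n → ℂ)).toLinearMap) -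
      (LinearMap.mulLeft ℝ (x t)).comp
    ((LinearMap.proj s).comp (WithLp.linearEquiv 2 ℝ (Fin n → ℂ)).toLinearMap)) with hK
  have hmem : ∀ z : CVec n, z ∈ K ↔ x s * z t - x t * z s = 0 := fun z => by simp [hK]
  have htop : K ≠ ⊤ := fun h => by
    have h1 : EuclideanSpace.single t (1 : ℂ) ∈ K := h ▸ Submodule.mem_top
    rw [hmem] at h1
    simp [hst, hx] at h1
  have h : ∀ᵐ y ∂cVolume n, orthComponent x y ≠ 0 := by
    filter_upwards [measure_eq_zero_iff_ae_notMem.1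
      (Measure.addHaar_submodule (cVolume n) K htop)] with y hy h
    refine hy ((hmem y).2 ?_)
    have hs := congrArg (fun v : CVec n => v s) h
    have ht := congrArg (fun v : CVec n => v t) h
    simp only [orthComponent, PiLp.sub_apply, PiLp.smul_apply, smul_eq_mul, PiLp.zero_apply] at hs ht
    have hx0 : ((‖x‖ ^ 2 : ℝ) : ℂ) ≠ 0 := by
      have : x ≠ 0 := fun h => hx (by simp [h])
      exact_mod_cast pow_ne_zero 2 (norm_ne_zero_iff.2 this)
    refine (mul_eq_zero.1 ?_).resolve_left hx0
    linear_combination x s * ht - x t * hs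
  exact (withDensity_absolutelyContinuous _ _).ae_le h

section Average

variable {n : ℕ} (μ : Measure (UnitaryGroup n)) [IsProbabilityMeasure μ] [μ.IsMulLeftInvariant]

/-- The volume is replaced by the Haar average over an orbit, and inversion then turns rows `i`, `j`
of the frame into coordinates `s`, `t` of the images of the basis vectors `i`, `j`. The conjugates
this introduces do not affect the angle. -/
theorem lintegral_stiefel_complexAngle (hn : 2 ≤ n) {s t i j : Fin n} (hst : s ≠ t) :
    ∫⁻ p : stiefel n, ENNReal.ofReal (complexAngle (p.1.fst i) (p.1.snd i) (p.1.fst j) (p.1.snd j))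
        ∂stiefelVolume n = stiefelVolume n Set.univ * ∫⁻ g, ENNReal.ofReal (complexAngle
      ((g : CVec n →L[ℂ] CVec n) (EuclideanSpace.single i 1) s)
      ((g : CVec n →L[ℂ] CVec n) (EuclideanSpace.single i 1) t)
      ((g : CVec n →L[ℂ] CVec n) (EuclideanSpace.single j 1) s)
      ((g : CVec n →L[ℂ] CVec n) (EuclideanSpace.single j 1) t)) ∂μ := by
  have := isInvInvariant_of_isProbabilityMeasure μ
  have := isPretransitive_stiefel hst
  have hfin : IsFiniteMeasure (stiefelVolume n) := ⟨(stiefelVolume_univ hn).2.lt_top⟩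
  have hf : Measurable fun p : stiefel n => ENNReal.ofReal
      (complexAngle (p.1.fst i) (p.1.snd i) (p.1.fst j) (p.1.snd j)) := by
    have h1 : Measurable fun p : stiefel n => p.1.fst := by
      have : Continuous fun p : stiefel n => p.1.fst := by fun_prop
      exact this.measurable
    have h2 : Measurable fun p : stiefel n => p.1.snd := by
      have : Continuous fun p : stiefel n => p.1.snd := by fun_prop
      exact this.measurable
    exact (measurable_complexAngle (by fun_prop) (by fun_prop) (by fun_prop)
      (by fun_prop)).ennreal_ofReal
  rw [lintegral_eq_lintegral_smul_of_isPretransitive μ (stiefelVolume n) _ hf (standardFrame hst),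
    ← lintegral_inv_eq_self]
  congr 1
  refine lintegral_congr fun g => ?_
  have h : ∀ a b : Fin n, ((g⁻¹ : UnitaryGroup n) : CVec n →L[ℂ] CVec n)
      (EuclideanSpace.single a 1) b = star ((g : CVec n →L[ℂ] CVec n)
        (EuclideanSpace.single b 1) a) := fun a b => by
    have h1 := g.inner_inv_apply (EuclideanSpace.single b 1) (EuclideanSpace.single a 1)
    rw [EuclideanSpace.inner_single_left, EuclideanSpace.inner_single_right] at h1
    simpa using h1
  rw [smul_fst, smul_snd]
  change ENNReal.ofReal (complexAngle
    (((g⁻¹ : UnitaryGroup n) : CVec n →L[ℂ] CVec n) (EuclideanSpace.single s 1) i)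
    (((g⁻¹ : UnitaryGroup n) : CVec n →L[ℂ] CVec n) (EuclideanSpace.single t 1) i)
    (((g⁻¹ : UnitaryGroup n) : CVec n →L[ℂ] CVec n) (EuclideanSpace.single s 1) j)
    (((g⁻¹ : UnitaryGroup n) : CVec n →L[ℂ] CVec n) (EuclideanSpace.single t 1) j)) = _
  rw [h, h, h, h, complexAngle_star]

/-- A unitary `h` carries the basis vectors `i`, `j` to the normalizations of `x`, `z` and is
absorbed by right invariance; the lengths drop out because the angle is invariant under real
scaling. -/
theorem lintegral_unitary_complexAngle {s t i j : Fin n} (hij : i ≠ j) {x z : CVec n} (hx : x ≠ 0)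
    (hz : z ≠ 0) (hxz : inner ℂ x z = (0 : ℂ)) :
    ∫⁻ g, ENNReal.ofReal (complexAngle
      ((g : CVec n →L[ℂ] CVec n) x s) ((g : CVec n →L[ℂ] CVec n) x t)
      ((g : CVec n →L[ℂ] CVec n) z s) ((g : CVec n →L[ℂ] CVec n) z t)) ∂μ =
    ∫⁻ g, ENNReal.ofReal (complexAngle
      ((g : CVec n →L[ℂ] CVec n) (EuclideanSpace.single i 1) s)
      ((g : CVec n →L[ℂ] CVec n) (EuclideanSpace.single i 1) t)
      ((g : CVec n →L[ℂ] CVec n) (EuclideanSpace.single j 1) s)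
      ((g : CVec n →L[ℂ] CVec n) (EuclideanSpace.single j 1) t)) ∂μ := by
  have hinv := isInvInvariant_of_isProbabilityMeasure μ
  have : μ.IsMulRightInvariant := by
    rw [← Measure.inv_eq_self μ]; infer_instance
  have hx' : 0 < ‖x‖ := norm_pos_iff.2 hx
  have hz' : 0 < ‖z‖ := norm_pos_iff.2 hz
  obtain ⟨h, h₁, h₂⟩ := UnitaryGroup.exists_single hij
    (u := ((‖x‖⁻¹ : ℝ) : ℂ) • x) (v := ((‖z‖⁻¹ : ℝ) : ℂ) • z)
    (by rw [norm_smul, Complex.norm_real, norm_inv, norm_norm, inv_mul_cancel₀ hx'.ne'])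
    (by rw [norm_smul, Complex.norm_real, norm_inv, norm_norm, inv_mul_cancel₀ hz'.ne'])
    (by rw [inner_smul_left, inner_smul_right, hxz, mul_zero, mul_zero])
  symm
  rw [← lintegral_mul_right_eq_self _ h]
  refine lintegral_congr fun g => ?_
  have e : ∀ v : CVec n, ((g * h : UnitaryGroup n) : CVec n →L[ℂ] CVec n) v =
    (g : CVec n →L[ℂ] CVec n) ((h : CVec n →L[ℂ] CVec n) v) := fun _ => rfl
  simp only [e, h₁, h₂, map_smul, PiLp.smul_apply, smul_eq_mul]
  rw [complexAngle_mul (inv_ne_zero hx'.ne') (inv_ne_zero hz'.ne')]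

end Average

theorem exists_isMulLeftInvariant_unitaryGroup (n : ℕ) : ∃ μ : Measure (UnitaryGroup n),
    IsProbabilityMeasure μ ∧ μ.IsMulLeftInvariant :=
  ⟨Measure.haarMeasure ⊤, ⟨by
    rw [← TopologicalSpace.PositiveCompacts.coe_top]; exact Measure.haarMeasure_self⟩, inferInstance⟩

/-- Condition on `x`: the inner integral is `π/(1+y)` up to mass, with `y = |x₂|/|x|`, and `y` has
the beta-type law. The exceptional `x` lie in null coordinate subspaces. -/
theorem lintegral_gaussian_frame (k : ℕ) :
    ∫⁻ x, ∫⁻ y, ENNReal.ofReal (complexAngle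
        (x (Fin.castAdd (k + 1) 0)) (x (Fin.castAdd (k + 1) 1))
        (orthComponent x y (Fin.castAdd (k + 1) 0)) (orthComponent x y (Fin.castAdd (k + 1) 1)))
        ∂complexGaussian (2 + (k + 1)) ∂complexGaussian (2 + (k + 1)) =
      complexGaussian (2 + (k + 1)) Set.univ * complexGaussian (2 + (k + 1)) Set.univ *
        ENNReal.ofReal (Real.pi * (k + 2) / (2 * k + 3)) := by
  rw [mul_assoc, ← lintegral_complexGaussian_pi_div, ← lintegral_const_mul _ (by
    have := measurable_splitEquiv (k + 1)
    fun_prop)]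
  refine lintegral_congr_ae ?_
  filter_upwards [ae_coordinate_ne_zero (Fin.castAdd (k + 1) (0 : Fin 2)),
    ae_coordinate_ne_zero (Fin.natAdd 2 (0 : Fin (k + 1)))] with x h₁ h₂
  refine lintegral_complexAngle_orthComponent (fun h => h₁ ?_) (fun h => h₂ ?_)
  · rw [← splitEquiv_fst, h]; rfl
  · rw [← splitEquiv_snd, h]; rfl

theorem lintegral_complexGaussian_pair_comp {n : ℕ} (g : UnitaryGroup n)
    {F : CVec n × CVec n → ℝ≥0∞} (hF : Measurable F) :
    ∫⁻ x, ∫⁻ y, F ((g : CVec n →L[ℂ] CVec n) x, (g : CVec n →L[ℂ] CVec n) y)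
      ∂complexGaussian n ∂complexGaussian n =
        ∫⁻ x, ∫⁻ y, F (x, y) ∂complexGaussian n ∂complexGaussian n := by
  rw [← g.lintegral_comp (f := fun x => ∫⁻ y, F (x, y) ∂complexGaussian n)
    hF.lintegral_prod_right']
  exact lintegral_congr fun x => g.lintegral_comp
    (f := fun y => F ((g : CVec n →L[ℂ] CVec n) x, y)) (by fun_prop)

theorem sFinite_of_isProbabilityMeasure {α : Type*} [MeasurableSpace α] (μ : Measure α)
    [IsProbabilityMeasure μ] : SFinite μ := inferInstance

/-- The angle of `g x` and `g (orthComponent x y)` is integrated over the group and over Gaussian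
`x`, `y` in both orders. For fixed `g`, invariance of the Gaussian removes `g` (`h2`); for fixed
`x`, `y`, the group average is the constant `c` (`h3`). The Gaussian masses cancel. -/
theorem lintegral_unitary_eq (k : ℕ) {i j : Fin (2 + (k + 1))} (hij : i ≠ j)
    (μ : Measure (UnitaryGroup (2 + (k + 1)))) [IsProbabilityMeasure μ] [μ.IsMulLeftInvariant] :
    ∫⁻ g, ENNReal.ofReal (complexAngle
      ((g : CVec (2 + (k + 1)) →L[ℂ] CVec (2 + (k + 1))) (EuclideanSpace.single i 1) (Fin.castAdd (k + 1) 0))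
      ((g : CVec (2 + (k + 1)) →L[ℂ] CVec (2 + (k + 1))) (EuclideanSpace.single i 1) (Fin.castAdd (k + 1) 1))
      ((g : CVec (2 + (k + 1)) →L[ℂ] CVec (2 + (k + 1))) (EuclideanSpace.single j 1) (Fin.castAdd (k + 1) 0))
      ((g : CVec (2 + (k + 1)) →L[ℂ] CVec (2 + (k + 1))) (EuclideanSpace.single j 1) (Fin.castAdd (k + 1) 1))) ∂μ =
    ENNReal.ofReal (Real.pi * (k + 2) / (2 * k + 3)) := by
  have hμ := sFinite_of_isProbabilityMeasure μ
  set γ := complexGaussian (2 + (k + 1)) with hγ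
  set s : Fin (2 + (k + 1)) := Fin.castAdd (k + 1) 0
  set t : Fin (2 + (k + 1)) := Fin.castAdd (k + 1) 1
  have hst : s ≠ t := by simp [s, t]
  set c := ∫⁻ g, ENNReal.ofReal (complexAngle
      ((g : CVec (2 + (k + 1)) →L[ℂ] CVec (2 + (k + 1))) (EuclideanSpace.single i 1) s)
      ((g : CVec (2 + (k + 1)) →L[ℂ] CVec (2 + (k + 1))) (EuclideanSpace.single i 1) t)
      ((g : CVec (2 + (k + 1)) →L[ℂ] CVec (2 + (k + 1))) (EuclideanSpace.single j 1) s)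
      ((g : CVec (2 + (k + 1)) →L[ℂ] CVec (2 + (k + 1))) (EuclideanSpace.single j 1) t)) ∂μ with hc
  obtain ⟨hW0, hWt⟩ : γ Set.univ ≠ 0 ∧ γ Set.univ ≠ ∞ := by
    rw [hγ, show 2 + (k + 1) = (k + 2) + 1 by ring]
    exact complexGaussian_univ (k + 2)
  set Θ : CVec (2 + (k + 1)) × CVec (2 + (k + 1)) → ℝ≥0∞ := fun p =>
    ENNReal.ofReal (complexAngle (p.1 s) (p.1 t) (orthComponent p.1 p.2 s)
      (orthComponent p.1 p.2 t)) with hΘ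
  have hΘm : Measurable Θ := by
    have : Measurable fun p : CVec (2 + (k + 1)) × CVec (2 + (k + 1)) =>
      orthComponent p.1 p.2 := by unfold orthComponent; fun_prop
    exact (measurable_complexAngle (by fun_prop) (by fun_prop) (by fun_prop)
      (by fun_prop)).ennreal_ofReal
  have happ : Measurable fun q : UnitaryGroup (2 + (k + 1)) × (CVec (2 + (k + 1)) × CVec (2 + (k + 1))) =>
      (((q.1 : CVec (2 + (k + 1)) →L[ℂ] CVec (2 + (k + 1))) q.2.1, (q.1 : CVec (2 + (k + 1)) →L[ℂ] CVec (2 + (k + 1))) q.2.2) : CVec (2 + (k + 1)) × CVec (2 + (k + 1))) := by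
    have h1 : Continuous fun q : UnitaryGroup (2 + (k + 1)) ×
        (CVec (2 + (k + 1)) × CVec (2 + (k + 1))) => (q.1 : CVec (2 + (k + 1)) →L[ℂ] CVec (2 + (k + 1))) :=
      continuous_subtype_val.comp continuous_fst
    exact ((h1.clm_apply (continuous_fst.comp continuous_snd)).prodMk
      (h1.clm_apply (continuous_snd.comp continuous_snd))).measurable
  have hI := lintegral_gaussian_frame k
  have h1 : ∫⁻ p, Θ p ∂γ.prod γ = γ Set.univ * γ Set.univ *
      ENNReal.ofReal (Real.pi * (k + 2) / (2 * k + 3)) := by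
    rw [lintegral_prod _ hΘm.aemeasurable]
    exact hI
  have h2 : ∫⁻ p, Θ p ∂γ.prod γ = ∫⁻ g, ∫⁻ p, Θ ((g : CVec (2 + (k + 1)) →L[ℂ] CVec (2 + (k + 1))) p.1,
      (g : CVec (2 + (k + 1)) →L[ℂ] CVec (2 + (k + 1))) p.2) ∂γ.prod γ ∂μ := by
    have : ∀ g : UnitaryGroup (2 + (k + 1)), ∫⁻ p, Θ ((g : CVec (2 + (k + 1)) →L[ℂ] CVec (2 + (k + 1))) p.1,
        (g : CVec (2 + (k + 1)) →L[ℂ] CVec (2 + (k + 1))) p.2) ∂γ.prod γ = ∫⁻ p, Θ p ∂γ.prod γ := fun g => by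
      rw [lintegral_prod _ (by fun_prop), lintegral_prod _ hΘm.aemeasurable]
      exact lintegral_complexGaussian_pair_comp g hΘm
    rw [lintegral_congr this, lintegral_const, measure_univ, mul_one]
  have h3 : ∫⁻ g, ∫⁻ p, Θ ((g : CVec (2 + (k + 1)) →L[ℂ] CVec (2 + (k + 1))) p.1,
      (g : CVec (2 + (k + 1)) →L[ℂ] CVec (2 + (k + 1))) p.2) ∂γ.prod γ ∂μ = γ Set.univ * γ Set.univ * c := by
    have hm : Measurable fun q : UnitaryGroup (2 + (k + 1)) ×
        (CVec (2 + (k + 1)) × CVec (2 + (k + 1))) =>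
          Θ ((q.1 : CVec (2 + (k + 1)) →L[ℂ] CVec (2 + (k + 1))) q.2.1, (q.1 : CVec (2 + (k + 1)) →L[ℂ] CVec (2 + (k + 1))) q.2.2) :=
      hΘm.comp happ
    rw [lintegral_lintegral_swap hm.aemeasurable, lintegral_prod _
      (hm.lintegral_prod_left').aemeasurable]
    have : ∀ᵐ x ∂γ, ∫⁻ y, ∫⁻ g, Θ ((g : CVec (2 + (k + 1)) →L[ℂ] CVec (2 + (k + 1))) x,
        (g : CVec (2 + (k + 1)) →L[ℂ] CVec (2 + (k + 1))) y) ∂μ ∂γ = c * γ Set.univ := by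
      filter_upwards [ae_coordinate_ne_zero s] with x hx
      rw [← lintegral_const]
      refine lintegral_congr_ae ?_
      filter_upwards [ae_orthComponent_ne_zero hst hx] with y hy
      simp only [hΘ, orthComponent_apply]
      exact lintegral_unitary_complexAngle μ hij (fun h => hx (by simp [h])) hy
        (inner_orthComponent x y)
    rw [lintegral_congr_ae this, lintegral_const]
    ring
  rw [h2, h3] at h1
  exact (ENNReal.mul_right_inj (mul_ne_zero hW0 hW0) (ENNReal.mul_ne_top hWt hWt)).1 h1

theorem measurable_hopfPol (n : ℕ) : Measurable (hopfPol (n := n)) := by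
  have h : Continuous fun p : stiefel n => frameToQuat (p : FramePair n) := by
    refine (PiLp.continuous_toLp 2 _).comp (continuous_pi fun i => ?_)
    have h1 : Continuous fun p : stiefel n => ((p : FramePair n).fst i, (p : FramePair n).snd i) := by
      fun_prop
    exact (quatFrameEquiv.toContinuousLinearEquiv.continuous.comp h1).congr fun p =>
      quatFrameEquiv_apply _
  exact ((measurable_hopfArm n).comp h.measurable).subtype_mk

theorem isProbabilityMeasure_symmetricMeasure {n : ℕ} (hn : 2 ≤ n) :
    IsProbabilityMeasure (symmetricMeasure n) := by
  obtain ⟨h0, ht⟩ := stiefelVolume_univ hn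
  constructor
  rw [symmetricMeasure, Measure.smul_apply, Measure.map_apply (measurable_hopfPol n) MeasurableSet.univ,
    Set.preimage_univ, smul_eq_mul, ENNReal.inv_mul_cancel h0 ht]

/-- The symmetric measure does not distinguish edges: any two different edges have the same expected
angle, adjacent or not. -/
theorem symmetricMeasure_turningAngle (k : ℕ) {i j : Fin (2 + (k + 1))} (hij : i ≠ j) :
    ∫⁻ e, ENNReal.ofReal (InnerProductGeometry.angle ((e : Arm (2 + (k + 1))) i)
        ((e : Arm (2 + (k + 1))) j)) ∂symmetricMeasure (2 + (k + 1)) =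
      ENNReal.ofReal (Real.pi * (k + 2) / (2 * k + 3)) := by
  obtain ⟨h0, ht⟩ := stiefelVolume_univ (n := 2 + (k + 1)) (by omega)
  obtain ⟨μ, hμ, hμ'⟩ := exists_isMulLeftInvariant_unitaryGroup (2 + (k + 1))
  have hst : Fin.castAdd (k + 1) (0 : Fin 2) ≠ Fin.castAdd (k + 1) 1 := by simp
  have e : ∀ p : stiefel (2 + (k + 1)), InnerProductGeometry.angle
      ((hopfPol p : Arm (2 + (k + 1))) i) ((hopfPol p : Arm (2 + (k + 1))) j) =
      complexAngle (p.1.fst i) (p.1.snd i) (p.1.fst j) (p.1.snd j) := fun p =>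
    angle_hopf_frame _ _ _ _
  rw [symmetricMeasure, lintegral_smul_measure, lintegral_map
    (f := fun e : Pol (2 + (k + 1)) => ENNReal.ofReal (InnerProductGeometry.angle
      ((e : Arm (2 + (k + 1))) i) ((e : Arm (2 + (k + 1))) j)))
    ((measurable_turningAngle i j).comp measurable_subtype_coe).ennreal_ofReal
    (measurable_hopfPol _)]
  simp only [e]
  rw [lintegral_stiefel_complexAngle μ (by omega) hst, lintegral_unitary_eq k hij, smul_eq_mul,
    ← mul_assoc, ENNReal.inv_mul_cancel h0 ht, one_mul]

end RandomPolygon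

end

/-! ### The expected total curvature -/

theorem theorem3 (n : ℕ) (hn : 3 ≤ n) :
    IsProbabilityMeasure (RandomPolygon.symmetricMeasure n) ∧
    IsProbabilityMeasure (RandomPolygon.hopfGaussianClosed n) ∧
    Integrable (fun e : RandomPolygon.Pol n => RandomPolygon.totalCurvature (e : RandomPolygon.Arm n))
      (RandomPolygon.symmetricMeasure n) ∧
    Integrable (fun e : RandomPolygon.closedPolygons n =>
      RandomPolygon.totalCurvature (e : RandomPolygon.Arm n)) (RandomPolygon.hopfGaussianClosed n) ∧
    ∫ e : RandomPolygon.Pol n, RandomPolygon.totalCurvature (e : RandomPolygon.Arm n)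
        ∂(RandomPolygon.symmetricMeasure n) =
      ∫ e : RandomPolygon.closedPolygons n, RandomPolygon.totalCurvature (e : RandomPolygon.Arm n)
        ∂(RandomPolygon.hopfGaussianClosed n) ∧
    ∫ e : RandomPolygon.closedPolygons n, RandomPolygon.totalCurvature (e : RandomPolygon.Arm n)
        ∂(RandomPolygon.hopfGaussianClosed n) =
      Real.pi / 2 * (n : ℝ) + Real.pi / 4 * (2 * (n : ℝ) / (2 * (n : ℝ) - 3)) := by
  have ha : 0 ≤ Real.pi * ((n : ℝ) - 1) / (2 * n - 3) := by
    have : (3 : ℝ) ≤ n := by exact_mod_cast hn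
    exact div_nonneg (mul_nonneg Real.pi_pos.le (by linarith)) (by linarith)
  have hval : (n : ℝ) * (Real.pi * ((n : ℝ) - 1) / (2 * n - 3)) =
      Real.pi / 2 * (n : ℝ) + Real.pi / 4 * (2 * (n : ℝ) / (2 * (n : ℝ) - 3)) := by
    have : (3 : ℝ) ≤ n := by exact_mod_cast hn
    -- Naming the denominator and eliminating `n` leaves an identity of rational functions in `d ≠
    -- 0`.
    obtain ⟨d, hd⟩ : ∃ d, 2 * (n : ℝ) - 3 = d := ⟨_, rfl⟩
    have hd0 : d ≠ 0 := by linarith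
    rw [hd, show (n : ℝ) = (d + 3) / 2 by linarith]
    field_simp
    ring
  have hσ : ∀ i, ∫⁻ e : RandomPolygon.Pol n, ENNReal.ofReal (InnerProductGeometry.angle
      ((e : RandomPolygon.Arm n) i) ((e : RandomPolygon.Arm n) (finRotate n i)))
        ∂(RandomPolygon.symmetricMeasure n) =
      ENNReal.ofReal (Real.pi * ((n : ℝ) - 1) / (2 * n - 3)) := by
    -- Two coordinates enter the angle formula and at least one must remain, since `x₂` has to be
    -- nonzero; this uses `n ≥ 3`.
    obtain ⟨k, rfl⟩ : ∃ k, n = 2 + (k + 1) := ⟨n - 3, by omega⟩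
    intro i
    rw [RandomPolygon.symmetricMeasure_turningAngle k
      (RandomPolygon.finRotate_ne_self (by omega) i).symm]
    congr 1
    push_cast
    ring
  have hH : RandomPolygon.hopfGaussianClosed n Set.univ = 1 ∧
      ∀ i, ∫⁻ e : RandomPolygon.closedPolygons n, ENNReal.ofReal (InnerProductGeometry.angle
        ((e : RandomPolygon.Arm n) i) ((e : RandomPolygon.Arm n) (finRotate n i)))
          ∂(RandomPolygon.hopfGaussianClosed n) =
        ENNReal.ofReal (Real.pi * ((n : ℝ) - 1) / (2 * n - 3)) := by
    -- Deleting one edge leaves a chain of `k + 2` edges, the shortest to which the chain law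
    -- applies being of two.
    obtain ⟨k, rfl⟩ : ∃ k, n = k + 3 := ⟨n - 3, by omega⟩
    refine ⟨(RandomPolygon.hopfGaussianClosed_turningAngle k 0).1.measure_univ, fun i => ?_⟩
    rw [(RandomPolygon.hopfGaussianClosed_turningAngle k i).2]
    congr 1
    push_cast
    ring
  have hpσ := RandomPolygon.isProbabilityMeasure_symmetricMeasure (n := n) (by omega)
  have hpH : IsProbabilityMeasure (RandomPolygon.hopfGaussianClosed n) := ⟨hH.1⟩
  obtain ⟨h₁, h₂⟩ := RandomPolygon.integrable_totalCurvature (RandomPolygon.symmetricMeasure n)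
    measurable_subtype_coe ha hσ
  obtain ⟨h₃, h₄⟩ := RandomPolygon.integrable_totalCurvature (RandomPolygon.hopfGaussianClosed n)
    measurable_subtype_coe ha hH.2
  exact ⟨hpσ, hpH, h₁, h₃, h₂.trans h₄.symm, h₄.trans hval⟩
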